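/- Let $\mathbb K$ be $\mathbb R$ or $\mathbb C$. A semi-quasi-norm on a $\mathbb K$-linear space $E$ is a function $\|\cdot\|:E\to[0,\infty)$ with $\|\lambda x\|=|\lambda|\|x\|$ and $\|x+y\|\le\Delta(\|x\|+\|y\|)$ for some constant $\Delta$ and all $x,y,\lambda$; it is a quasi-norm if $\|x\|=0$ only for $x=0$. Let $\mathbf Q$ be the category of quasi-Banach (complete quasi-normed) spaces and $\mathbf Q_{1/2}$ that of semi-quasi-Banach (complete semi-quasi-normed) spaces, with operators (bounded, equivalently continuous, linear maps) as morphisms; $\mathfrak L(E,F)$ is the space of operators $E\to F$ with $\|T\|=\inf\{C\ge0:\|Tx\|\le C\|x\|\ \forall x\}$. For quasi-Banach spaces $X,Y$ consider the following three spaces. (1) $\operatorname{Ext}(X,Y)$: the short exact sequences $0\to Y\stackrel{\imath}{\to}Z\stackrel{\pi}{\to}X\to0$ of quasi-Banach spaces and operators, where two of them, with middle spaces $Z$ and $Z'$, are identified if some operator $t:Z\to Z'$ satisfies $t\imath=\imath'$ and $\pi't=\pi$. Addition is the Baer sum, the scalar $\lambda$ acts by push-out along $\lambda\,\mathbf I_Y$,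 zero is the class of the direct sum, and $f\in\mathfrak L(X',X)$, $g\in\mathfrak L(Y,Y')$ act by pull-back along $f$ and push-out along $g$. The semi-quasi-norm of a class is the infimum, over all sequences $(\imath,\pi)$ in the class and all bounded homogeneous sections $B:X\to Z$ of $\pi$, of $\sup_{x,y}\|\imath^{-1}(B(x+y)-Bx-By)\|/(\|x\|+\|y\|)$. (2) $\mathcal Q(X,Y)$: the quasilinear maps (homogeneous maps $F:X\to Y$ with $\|F(x+y)-F(x)-F(y)\|\le Q(\|x\|+\|y\|)$ for some $Q$; the least such $Q$ is $Q(F)$) modulo the trivial ones (sums of a linear map and a bounded homogeneous map), with $Q([F])=\inf\{Q(G):G-F\text{ is trivial}\}$ and action $[F]\mapsto[g\circ F\circ f]$. (3) $\operatorname{Ext}^\varpi(X,Y)$: choose for each couple $(X,Y)$ a relatively projective presentation of $X$, that is, a surjective operator $\varpi:\ell_q(I)\to X$ for some set $I$ and some $0<q<p\le1$ such that $X$ and $Y$ are both $p$-normable. With $K=\ker\varpi$, let $$\operatorname{Ext}^\varpi(X,Y)=\mathfrak L(K,Y)\big/\{v|_K:v\in\mathfrak L(\ell_q(I),Y)\},\qquad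 |[u]|_\varpi=\inf\{\|u-v|_K\|:v\in\mathfrak L(\ell_q(I),Y)\}.$$ Operators $f\in\mathfrak L(X',X)$ and $g\in\mathfrak L(Y,Y')$ send $[u]\in\operatorname{Ext}^{\varpi}(X,Y)$ to the class $[u']\in\operatorname{Ext}^{\varpi'}(X',Y')$, where $\varpi':\ell_{q'}(I')\to X'$ is the presentation chosen for $(X',Y')$, $K'=\ker\varpi'$, and $u'\in\mathfrak L(K',Y')$ is such that $(k',k)\mapsto u'(k')-g(u(k))$ extends from $K'\times K$ to an operator $\{(z',z)\in\ell_{q'}(I')\times\ell_q(I):\varpi z=f\varpi'z'\}\to Y'$. (If $f\varpi'$ lifts to $\varphi:\ell_{q'}(I')\to\ell_q(I)$ with $\varpi\varphi=f\varpi'$, this means $[u']=[g\circ u\circ\varphi|_{K'}]$.) Theorem. Relatively projective presentations exist for all couples. For every choice of them, the actions in (3) are well defined, and $\operatorname{Ext}$, $\mathcal Q$ and $\operatorname{Ext}^\varpi$ are functors from $\mathbf Q^{\mathrm{op}}\times\mathbf Q$ (contravariant in $X$, covariant in $Y$) to $\mathbf Q_{1/2}$; in particular the three spaces are complete. These three functors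 are naturally equivalent as functors into $\mathbf Q_{1/2}$, so the equivalences are linear homeomorphisms. -/

import Mathlib

open CategoryTheory Filter Topology

universe u v w

set_option linter.unusedSectionVars false

namespace QuasiExt

/-! ### Semi-quasi-normed and quasi-Banach spaces -/

/-- The function `x ↦ ‖x‖` is a semi-quasi-norm on the `𝕜`-linear space `E`. -/
class SemiQuasiNormed (𝕜 : Type) (E : Type v) [RCLike 𝕜] [AddCommGroup E] [Module 𝕜 E]
    [Norm E] : Prop where
  nonneg : ∀ x : E, 0 ≤ ‖x‖
  smul : ∀ (c : 𝕜) (x : E), ‖c • x‖ = ‖c‖ * ‖x‖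
  quasi : ∃ Δ : ℝ, ∀ x y : E, ‖x + y‖ ≤ Δ * (‖x‖ + ‖y‖)

/-- Completeness. The topology of a semi-quasi-normed space is pseudometrizable and linear, so
completeness is convergence of all Cauchy sequences. -/
def IsCompleteQN (E : Type v) [AddCommGroup E] [Norm E] : Prop :=
  ∀ s : ℕ → E, (∀ ε > 0, ∃ N, ∀ m ≥ N, ∀ n ≥ N, ‖s m - s n‖ < ε) →
    ∃ x, Tendsto (fun n => ‖s n - x‖) atTop (𝓝 0)

/-- Quasi-Banach spaces: complete, and `‖·‖` is a quasi-norm. -/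
class QuasiBanach (𝕜 : Type) (E : Type v) [RCLike 𝕜] [AddCommGroup E] [Module 𝕜 E]
    [Norm E] : Prop extends SemiQuasiNormed 𝕜 E where
  complete : IsCompleteQN E
  eq_zero : ∀ x : E, ‖x‖ = 0 → x = 0

section basic

variable (𝕜 : Type) [RCLike 𝕜] {E : Type v} [AddCommGroup E] [Module 𝕜 E] [Norm E]

theorem qn_nonneg [SemiQuasiNormed 𝕜 E] (x : E) : 0 ≤ ‖x‖ := SemiQuasiNormed.nonneg 𝕜 x

theorem qn_smul [SemiQuasiNormed 𝕜 E] (c : 𝕜) (x : E) : ‖c • x‖ = ‖c‖ * ‖x‖ :=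
  SemiQuasiNormed.smul c x

theorem qn_zero [SemiQuasiNormed 𝕜 E] : ‖(0 : E)‖ = 0 := by
  have := qn_smul 𝕜 (0 : 𝕜) (0 : E)
  simpa using this

theorem qn_neg [SemiQuasiNormed 𝕜 E] (x : E) : ‖-x‖ = ‖x‖ := by
  have := qn_smul 𝕜 (-1 : 𝕜) x
  simpa using this

theorem qn_sub_comm [SemiQuasiNormed 𝕜 E] (x y : E) : ‖x - y‖ = ‖y - x‖ := by
  rw [← qn_neg 𝕜, neg_sub]

theorem qn_quasi (E : Type v) [AddCommGroup E] [Module 𝕜 E] [Norm E] [SemiQuasiNormed 𝕜 E] :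
    ∃ Δ : ℝ, 1 ≤ Δ ∧ ∀ x y : E, ‖x + y‖ ≤ Δ * (‖x‖ + ‖y‖) := by
  obtain ⟨Δ, h⟩ := SemiQuasiNormed.quasi (𝕜 := 𝕜) (E := E)
  refine ⟨max Δ 1, le_max_right _ _, fun x y => (h x y).trans ?_⟩
  have := qn_nonneg 𝕜 x
  have := qn_nonneg 𝕜 y
  gcongr
  exact le_max_left _ _

theorem qn_sub_le [SemiQuasiNormed 𝕜 E] {Δ : ℝ} (h : ∀ x y : E, ‖x + y‖ ≤ Δ * (‖x‖ + ‖y‖))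
    (x y z : E) : ‖x - z‖ ≤ Δ * (‖x - y‖ + ‖y - z‖) := by
  have := h (x - y) (y - z)
  simpa using this

/-- A sequence with geometrically small increments converges. -/
theorem fast_limit [SemiQuasiNormed 𝕜 E] (hc : IsCompleteQN E) {Δ : ℝ} (hΔ : 1 ≤ Δ)
    (h : ∀ x y : E, ‖x + y‖ ≤ Δ * (‖x‖ + ‖y‖)) (s : ℕ → E) (r : ℕ → ℝ) (hr0 : ∀ n, 0 ≤ r n)
    (hr : ∀ n, 2 * Δ * r (n + 1) ≤ r n) (hs : ∀ n, ‖s (n + 1) - s n‖ ≤ r n) :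
    ∃ x, Tendsto (fun n => ‖s n - x‖) atTop (𝓝 0) ∧ ∀ n, ‖s n - x‖ ≤ 2 * Δ ^ 2 * r n := by
  have key : ∀ k n, ‖s n - s (n + k)‖ ≤ 2 * Δ * r n := by
    intro k
    induction k with
    | zero =>
      intro n
      have : 0 ≤ 2 * Δ * r n := by have := hr0 n; positivity
      simpa [qn_zero 𝕜] using this
    | succ k ih =>
      intro n
      have h1 := qn_sub_le 𝕜 h (s n) (s (n + 1)) (s (n + (k + 1)))
      have h2 := ih (n + 1)
      rw [show n + 1 + k = n + (k + 1) by ring] at h2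
      have h3 := hs n
      rw [qn_sub_comm 𝕜] at h3
      calc _ ≤ _ := h1
        _ ≤ Δ * (r n + 2 * Δ * r (n + 1)) := by gcongr
        _ ≤ Δ * (r n + r n) := by gcongr; exact hr n
        _ = _ := by ring
  have hdec : ∀ n, r n ≤ r 0 * (1 / 2) ^ n := by
    intro n
    induction n with
    | zero => simp
    | succ n ih =>
      have h1 := hr n
      have h2 := hr0 (n + 1)
      have : 2 * r (n + 1) ≤ 2 * Δ * r (n + 1) := by nlinarith
      rw [pow_succ]; linarith
  have hr_lim : Tendsto r atTop (𝓝 0) := by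
    refine squeeze_zero hr0 hdec ?_
    simpa using (tendsto_pow_atTop_nhds_zero_of_lt_one (r := (1 / 2 : ℝ)) (by norm_num)
      (by norm_num)).const_mul (r 0)
  have hanti : ∀ m n, m ≤ n → r n ≤ r m := fun m n hmn => by
    refine antitone_nat_of_succ_le (fun n => ?_) hmn
    have h1 := hr n
    have h2 := hr0 (n + 1)
    nlinarith
  obtain ⟨x, hx⟩ := hc s (by
    intro ε hε
    have : Tendsto (fun n => 2 * Δ * r n) atTop (𝓝 0) := by simpa using hr_lim.const_mul (2 * Δ)
    obtain ⟨N, hN⟩ := ((tendsto_order.1 this).2 ε hε).exists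
    refine ⟨N, fun m hm n hn => ?_⟩
    rcases le_total m n with hmn | hmn
    · obtain ⟨k, rfl⟩ := Nat.exists_eq_add_of_le hmn
      refine (key k m).trans_lt (lt_of_le_of_lt ?_ hN)
      gcongr
      exact hanti _ _ hm
    · obtain ⟨k, rfl⟩ := Nat.exists_eq_add_of_le hmn
      rw [qn_sub_comm 𝕜]
      refine (key k n).trans_lt (lt_of_le_of_lt ?_ hN)
      gcongr
      exact hanti _ _ hn)
  refine ⟨x, hx, fun n => ?_⟩
  have hlim : Tendsto (fun k => Δ * (2 * Δ * r n + ‖s (k + n) - x‖)) atTop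
      (𝓝 (Δ * (2 * Δ * r n + 0))) :=
    (((tendsto_add_atTop_iff_nat n).2 hx).const_add _).const_mul _
  have : ‖s n - x‖ ≤ Δ * (2 * Δ * r n + 0) := by
    refine ge_of_tendsto' hlim fun k => (qn_sub_le 𝕜 h _ (s (n + k)) _).trans ?_
    rw [add_comm k n]
    gcongr
    exact key k n
  linarith

theorem limit_unique [QuasiBanach 𝕜 E] {s : ℕ → E} {x y : E}
    (hx : Tendsto (fun n => ‖s n - x‖) atTop (𝓝 0))
    (hy : Tendsto (fun n => ‖s n - y‖) atTop (𝓝 0)) : x = y := by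
  obtain ⟨Δ, -, h⟩ := qn_quasi 𝕜 E
  have : ‖x - y‖ ≤ 0 := by
    have hl : Tendsto (fun n => Δ * (‖s n - x‖ + ‖s n - y‖)) atTop (𝓝 0) := by
      simpa using (hx.add hy).const_mul Δ
    refine ge_of_tendsto' hl fun n => ?_
    rw [qn_sub_comm 𝕜 (s n) x]
    exact qn_sub_le 𝕜 h _ _ _
  exact sub_eq_zero.1 (QuasiBanach.eq_zero (𝕜 := 𝕜) _ (le_antisymm this (qn_nonneg 𝕜 _)))

end basic

/-! ### Bounded operators -/

section op

variable (𝕜 : Type) [RCLike 𝕜]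

/-- The space `𝔏(E, F)` of operators (bounded, equivalently continuous, linear maps). -/
def Op (E : Type v) (F : Type w) [AddCommGroup E] [Module 𝕜 E] [Norm E]
    [AddCommGroup F] [Module 𝕜 F] [Norm F] : Type (max v w) :=
  {T : E →ₗ[𝕜] F // ∃ C : ℝ, ∀ x, ‖T x‖ ≤ C * ‖x‖}

variable {𝕜}
variable {E : Type*} {F : Type*} {G : Type*} [AddCommGroup E] [Module 𝕜 E] [Norm E]
    [AddCommGroup F] [Module 𝕜 F] [Norm F] [AddCommGroup G] [Module 𝕜 G] [Norm G]

instance : FunLike (Op 𝕜 E F) E F where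
  coe T := T.1
  coe_injective _ _ h := Subtype.ext (DFunLike.coe_injective h)

instance : LinearMapClass (Op 𝕜 E F) 𝕜 E F where
  map_add T := T.1.map_add
  map_smulₛₗ T := T.1.map_smul

theorem Op.ext {S T : Op 𝕜 E F} (h : ∀ x, S x = T x) : S = T := DFunLike.ext _ _ h

theorem Op.bound [SemiQuasiNormed 𝕜 E] (T : Op 𝕜 E F) :
    ∃ C : ℝ, 0 ≤ C ∧ ∀ x, ‖T x‖ ≤ C * ‖x‖ := by
  obtain ⟨C, hC⟩ := T.2
  refine ⟨max C 0, le_max_right _ _, fun x => (hC x).trans ?_⟩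
  have := qn_nonneg 𝕜 x
  gcongr
  exact le_max_left _ _

/-- The identity operator. -/
def Op.id : Op 𝕜 E E := ⟨LinearMap.id, 1, fun x => by simp⟩

/-- Composition of operators. -/
def Op.comp [SemiQuasiNormed 𝕜 F] (S : Op 𝕜 F G) (T : Op 𝕜 E F) : Op 𝕜 E G :=
  ⟨S.1 ∘ₗ T.1, by
    obtain ⟨C, hC0, hC⟩ := S.bound
    obtain ⟨D, hD⟩ := T.2
    refine ⟨C * D, fun x => (hC _).trans ?_⟩
    rw [mul_assoc]
    gcongr
    exact hD x⟩

@[simp] theorem Op.id_apply (x : E) : (Op.id : Op 𝕜 E E) x = x := rfl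

@[simp] theorem Op.comp_apply [SemiQuasiNormed 𝕜 F] (S : Op 𝕜 F G) (T : Op 𝕜 E F) (x : E) :
    S.comp T x = S (T x) := rfl

theorem Op.tendsto [SemiQuasiNormed 𝕜 E] [SemiQuasiNormed 𝕜 F] (T : Op 𝕜 E F) {s : ℕ → E} {x : E}
    (h : Tendsto (fun n => ‖s n - x‖) atTop (𝓝 0)) :
    Tendsto (fun n => ‖T (s n) - T x‖) atTop (𝓝 0) := by
  obtain ⟨C, hC⟩ := T.2
  refine squeeze_zero (fun _ => qn_nonneg 𝕜 _) (fun n => ?_) (by simpa using h.const_mul C)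
  rw [← map_sub]
  exact hC _

end op

/-! ### The open mapping theorem -/

section openMapping

variable {𝕜 : Type} [RCLike 𝕜]
variable {E : Type*} {F : Type*} [AddCommGroup E] [Module 𝕜 E] [Norm E]
    [AddCommGroup F] [Module 𝕜 F] [Norm F]

/-- Baire's theorem, in the form needed for the open mapping theorem. -/
theorem baire_step [QuasiBanach 𝕜 F] (S : ℕ → Set F) (hS : ∀ y, ∃ n, y ∈ S n) :
    ∃ n, ∃ y : F, ∃ r > 0, ∀ w, ‖w - y‖ ≤ r → ∀ ε > 0, ∃ z ∈ S n, ‖w - z‖ < ε := by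
  by_contra! hcon
  obtain ⟨Δ, hΔ, h⟩ := qn_quasi 𝕜 F
  choose w hw ε hε hz using hcon
  -- a sequence of balls avoiding the successive sets
  let step : ℕ → {p : F × ℝ // 0 < p.2} → {p : F × ℝ // 0 < p.2} := fun n p =>
    ⟨(w n p.1.1 p.1.2 p.2, min (p.1.2 / (2 * Δ)) (ε n p.1.1 p.1.2 p.2 / (4 * Δ ^ 2))), by
      have := p.2
      have := hε n p.1.1 p.1.2 p.2
      positivity⟩
  let seq : ℕ → {p : F × ℝ // 0 < p.2} := fun n => Nat.rec ⟨(0, 1), one_pos⟩ step n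
  have hseq : ∀ n, seq (n + 1) = step n (seq n) := fun n => rfl
  obtain ⟨y, -, hy⟩ := fast_limit 𝕜 (QuasiBanach.complete (𝕜 := 𝕜) (E := F)) hΔ h
    (fun n => (seq n).1.1) (fun n => (seq n).1.2) (fun n => (seq n).2.le)
    (fun n => by
      have : (seq (n + 1)).1.2 ≤ (seq n).1.2 / (2 * Δ) := by
        rw [hseq]; exact min_le_left _ _
      rw [le_div_iff₀ (by positivity)] at this
      linarith)
    (fun n => by
      rw [hseq]; exact hw n _ _ _)
  obtain ⟨n, hn⟩ := hS y
  have h1 := hz n (seq n).1.1 (seq n).1.2 (seq n).2 y hn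
  have h2 := hy (n + 1)
  have h3 : (seq (n + 1)).1.2 ≤ ε n (seq n).1.1 (seq n).1.2 (seq n).2 / (4 * Δ ^ 2) := by
    rw [hseq]; exact min_le_right _ _
  have h4 := hε n (seq n).1.1 (seq n).1.2 (seq n).2
  have h5 : (seq (n + 1)).1.1 = w n (seq n).1.1 (seq n).1.2 (seq n).2 := by rw [hseq]
  rw [h5] at h2
  rw [le_div_iff₀ (by positivity)] at h3
  nlinarith

theorem open_mapping [QuasiBanach 𝕜 E] [QuasiBanach 𝕜 F] (T : Op 𝕜 E F)
    (hT : Function.Surjective T) : ∃ C : ℝ, 0 ≤ C ∧ ∀ y, ∃ x, T x = y ∧ ‖x‖ ≤ C * ‖y‖ := by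
  obtain ⟨ΔE, hΔE, hE⟩ := qn_quasi 𝕜 E
  obtain ⟨ΔF, hΔF, hF⟩ := qn_quasi 𝕜 F
  obtain ⟨n, y₀, r, hr, hS⟩ := baire_step (𝕜 := 𝕜) (fun n : ℕ => T '' {x | ‖x‖ ≤ n}) (fun y => by
    obtain ⟨x, rfl⟩ := hT y
    obtain ⟨n, hn⟩ := exists_nat_ge ‖x‖
    exact ⟨n, x, hn, rfl⟩)
  -- approximate preimages of small vectors
  have happ : ∀ w : F, ‖w‖ ≤ r → ∀ ε > 0, ∃ x, ‖x‖ ≤ ΔE * (n + n) ∧ ‖w - T x‖ < ε := by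
    intro w hw ε hε
    obtain ⟨_, ⟨x₁, hx₁, rfl⟩, h₁⟩ := hS (y₀ + w) (by simpa using hw) (ε / (2 * ΔF)) (by positivity)
    obtain ⟨_, ⟨x₂, hx₂, rfl⟩, h₂⟩ := hS y₀ (by simpa [qn_zero 𝕜] using hr.le) (ε / (2 * ΔF))
      (by positivity)
    refine ⟨x₁ - x₂, ?_, ?_⟩
    · have := hE x₁ (-x₂)
      rw [qn_neg 𝕜, ← sub_eq_add_neg] at this
      refine this.trans ?_
      gcongr
      · exact hx₁
      · exact hx₂
    · have h3 := hF (y₀ + w - T x₁) (-(y₀ - T x₂))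
      rw [qn_neg 𝕜] at h3
      have h4 : y₀ + w - T x₁ + -(y₀ - T x₂) = w - T (x₁ - x₂) := by rw [map_sub]; abel
      rw [h4] at h3
      rw [lt_div_iff₀ (by positivity)] at h₁ h₂
      nlinarith
  set C : ℝ := ΔE * (n + n) / r with hCdef
  have hC0 : 0 ≤ C := by positivity
  have happ' : ∀ w : F, ∀ ε > 0, ∃ x, ‖x‖ ≤ C * ‖w‖ ∧ ‖w - T x‖ < ε := by
    intro w ε hε
    rcases (qn_nonneg 𝕜 w).eq_or_lt with hw | hw
    · refine ⟨0, ?_, ?_⟩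
      · rw [qn_zero 𝕜, ← hw]; simp
      · simpa [← hw] using hε
    · have hc : (0 : ℝ) < r / ‖w‖ := by positivity
      have hcn : ‖((r / ‖w‖ : ℝ) : 𝕜)‖ = r / ‖w‖ := by
        rw [RCLike.norm_ofReal, abs_of_pos hc]
      have hc' : ((r / ‖w‖ : ℝ) : 𝕜) ≠ 0 := by
        rw [← norm_ne_zero_iff, hcn]; exact hc.ne'
      obtain ⟨x, hx, hx'⟩ := happ (((r / ‖w‖ : ℝ) : 𝕜) • w)
        (by rw [qn_smul 𝕜, hcn, div_mul_cancel₀ _ hw.ne']) (r / ‖w‖ * ε) (by positivity)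
      refine ⟨(((r / ‖w‖ : ℝ) : 𝕜))⁻¹ • x, ?_, ?_⟩
      · rw [qn_smul 𝕜, norm_inv, hcn, inv_div, hCdef]
        calc ‖w‖ / r * ‖x‖ ≤ ‖w‖ / r * (ΔE * (n + n)) := by gcongr
          _ = _ := by ring
      · have : w - T ((((r / ‖w‖ : ℝ) : 𝕜))⁻¹ • x)
            = (((r / ‖w‖ : ℝ) : 𝕜))⁻¹ • (((r / ‖w‖ : ℝ) : 𝕜) • w - T x) := by
          rw [smul_sub, inv_smul_smul₀ hc', map_smul]
        rw [this, qn_smul 𝕜, norm_inv, hcn, inv_mul_lt_iff₀ hc]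
        exact hx'
  refine ⟨ΔE * (C * ΔE ^ 2 * 4), by positivity, fun y => ?_⟩
  rcases (qn_nonneg 𝕜 y).eq_or_lt with hy | hy
  · refine ⟨0, ?_, ?_⟩
    · rw [map_zero, QuasiBanach.eq_zero (𝕜 := 𝕜) y hy.symm]
    · rw [qn_zero 𝕜, ← hy]; simp
  choose f hf hf' using happ'
  have hpos : ∀ n : ℕ, 0 < ‖y‖ * (1 / (2 * ΔE)) ^ (n + 1) := fun n => by positivity
  -- successive residues
  let x : ℕ → E := fun n => Nat.rec 0 (fun k x => x + f (y - T x) _ (hpos k)) n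
  have hx : ∀ k, x (k + 1) = x k + f (y - T (x k)) _ (hpos k) := fun k => rfl
  have hres : ∀ k, ‖y - T (x k)‖ ≤ ‖y‖ * (1 / (2 * ΔE)) ^ k := by
    intro k
    cases k with
    | zero => simp [show x 0 = 0 from rfl]
    | succ k =>
      have := hf' (y - T (x k)) _ (hpos k)
      rw [hx, map_add, ← sub_sub]
      exact this.le
  obtain ⟨z, hz, hz'⟩ := fast_limit 𝕜 (QuasiBanach.complete (𝕜 := 𝕜) (E := E)) hΔE hE x
    (fun k => C * (‖y‖ * (1 / (2 * ΔE)) ^ k)) (fun k => by positivity)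
    (fun k => by
      apply le_of_eq
      rw [pow_succ]
      field_simp)
    (fun k => by
      rw [hx, add_sub_cancel_left]
      refine (hf _ _ (hpos k)).trans ?_
      gcongr
      exact hres k)
  refine ⟨z, ?_, ?_⟩
  · refine limit_unique 𝕜 (T.tendsto hz) ?_
    refine squeeze_zero (fun _ => qn_nonneg 𝕜 _)
      (fun k => (qn_sub_comm 𝕜 _ _).trans_le (hres k)) ?_
    have : Tendsto (fun k : ℕ => (1 / (2 * ΔE)) ^ k) atTop (𝓝 0) :=
      tendsto_pow_atTop_nhds_zero_of_lt_one (by positivity)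
        (by rw [div_lt_one (by positivity)]; linarith)
    simpa using this.const_mul ‖y‖
  · have := hz' 0
    simp only [show x 0 = 0 from rfl, zero_sub, qn_neg 𝕜, pow_zero, mul_one] at this
    refine this.trans ?_
    have : 0 ≤ C * ΔE ^ 2 * ‖y‖ := by positivity
    nlinarith

/-- Surjective operators have bounded homogeneous sections. -/
theorem exists_section [QuasiBanach 𝕜 E] [QuasiBanach 𝕜 F] (T : Op 𝕜 E F)
    (hT : Function.Surjective T) : ∃ B : F → E, (∀ (c : 𝕜) x, B (c • x) = c • B x) ∧
      (∃ C : ℝ, ∀ x, ‖B x‖ ≤ C * ‖x‖) ∧ ∀ x, T (B x) = x := by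
  obtain ⟨C, hC0, hC⟩ := open_mapping T hT
  choose b hb hb' using hC
  -- a representative on each line
  let rep : F → F := fun x => (Quotient.mk (MulAction.orbitRel 𝕜ˣ F) x).out
  have hrep : ∀ x, ∃ a : 𝕜ˣ, a • rep x = x := fun x =>
    (MulAction.orbitRel 𝕜ˣ F).symm (Quotient.mk_out (s := MulAction.orbitRel 𝕜ˣ F) x)
  choose a ha using hrep
  have hrep0 : ∀ x, x ≠ 0 → rep x ≠ 0 := by
    intro x hx h
    apply hx
    rw [← ha x, h, smul_zero]
  have hrepc : ∀ (c : 𝕜ˣ) x, rep (c • x) = rep x := fun c x =>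
    congrArg Quotient.out (Quotient.sound (s := MulAction.orbitRel 𝕜ˣ F) ⟨c, rfl⟩)
  classical
  refine ⟨fun x => if x = 0 then 0 else a x • b (rep x), fun c x => ?_, ⟨C, fun x => ?_⟩,
    fun x => ?_⟩
  · rcases eq_or_ne c 0 with rfl | hc
    · simp
    rcases eq_or_ne x 0 with rfl | hx
    · simp
    simp only [if_neg hx, if_neg (smul_ne_zero hc hx)]
    lift c to 𝕜ˣ using hc.isUnit
    have h1 : a (c • x) • rep x = (c * a x) • rep x := by
      rw [mul_smul, ha x, ← hrepc c x, ha]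
    have h2 : ((a (c • x) : 𝕜ˣ) : 𝕜) = ((c * a x : 𝕜ˣ) : 𝕜) :=
      smul_left_injective 𝕜 (hrep0 x hx) h1
    have h3 : a (c • x) = c * a x := Units.ext h2
    change a (c • x) • b (rep (c • x)) = c • (a x • b (rep x))
    rw [h3, hrepc, mul_smul]
  · rcases eq_or_ne x 0 with rfl | hx
    · simp [qn_zero 𝕜]
    · simp only [if_neg hx]
      have h1 : ‖a x • b (rep x)‖ = ‖(a x : 𝕜)‖ * ‖b (rep x)‖ := qn_smul 𝕜 _ _
      have h2 : ‖a x • rep x‖ = ‖(a x : 𝕜)‖ * ‖rep x‖ := qn_smul 𝕜 _ _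
      rw [ha] at h2
      rw [h1, h2]
      have := hb' (rep x)
      have h3 : ‖(a x : 𝕜)‖ * ‖b (rep x)‖ ≤ ‖(a x : 𝕜)‖ * (C * ‖rep x‖) := by gcongr
      linarith
  · rcases eq_or_ne x 0 with rfl | hx
    · simp
    · simp only [if_neg hx]
      refine (map_smul T (a x : 𝕜) (b (rep x))).trans ?_
      rw [hb]
      exact ha x

end openMapping

/-! ### Operator quasi-norm, products, subspaces, quotients, `ℓ_q(I)` -/

section constructions

variable {𝕜 : Type} [RCLike 𝕜]
variable {E : Type*} {F : Type*} [AddCommGroup E] [Module 𝕜 E] [Norm E]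
    [AddCommGroup F] [Module 𝕜 F] [Norm F]

variable (𝕜 E F) in
/-- `𝔏(E, F)` as a linear space. -/
def opSubmodule [SemiQuasiNormed 𝕜 E] [SemiQuasiNormed 𝕜 F] : Submodule 𝕜 (E →ₗ[𝕜] F) where
  carrier := {T | ∃ C : ℝ, ∀ x, ‖T x‖ ≤ C * ‖x‖}
  zero_mem' := ⟨0, fun x => by simp [qn_zero 𝕜]⟩
  add_mem' := by
    rintro S T ⟨C, hC⟩ ⟨D, hD⟩
    obtain ⟨Δ, hΔ, h⟩ := qn_quasi 𝕜 F
    refine ⟨Δ * (C + D), fun x => (h _ _).trans ?_⟩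
    have := hC x
    have := hD x
    rw [mul_assoc, add_mul]
    gcongr
  smul_mem' := by
    rintro c T ⟨C, hC⟩
    refine ⟨‖c‖ * C, fun x => ?_⟩
    rw [LinearMap.smul_apply, qn_smul 𝕜, mul_assoc]
    gcongr
    exact hC x

instance [SemiQuasiNormed 𝕜 E] [SemiQuasiNormed 𝕜 F] : AddCommGroup (Op 𝕜 E F) :=
  inferInstanceAs (AddCommGroup (opSubmodule 𝕜 E F))

instance [SemiQuasiNormed 𝕜 E] [SemiQuasiNormed 𝕜 F] : Module 𝕜 (Op 𝕜 E F) :=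
  inferInstanceAs (Module 𝕜 (opSubmodule 𝕜 E F))

/-- `‖T‖` is the least `C ≥ 0` with `‖T x‖ ≤ C ‖x‖` for all `x`. -/
noncomputable instance : Norm (Op 𝕜 E F) :=
  ⟨fun T => sInf {C : ℝ | 0 ≤ C ∧ ∀ x, ‖T x‖ ≤ C * ‖x‖}⟩

@[simp] theorem Op.add_apply [SemiQuasiNormed 𝕜 E] [SemiQuasiNormed 𝕜 F] (S T : Op 𝕜 E F) (x : E) :
    (S + T) x = S x + T x := rfl

@[simp] theorem Op.sub_apply [SemiQuasiNormed 𝕜 E] [SemiQuasiNormed 𝕜 F] (S T : Op 𝕜 E F) (x : E) :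
    (S - T) x = S x - T x := rfl

@[simp] theorem Op.zero_apply [SemiQuasiNormed 𝕜 E] [SemiQuasiNormed 𝕜 F] (x : E) :
    (0 : Op 𝕜 E F) x = 0 := rfl

@[simp] theorem Op.smul_apply [SemiQuasiNormed 𝕜 E] [SemiQuasiNormed 𝕜 F] (c : 𝕜) (T : Op 𝕜 E F)
    (x : E) : (c • T) x = c • T x := rfl

theorem Op.norm_le (T : Op 𝕜 E F) {C : ℝ} (h0 : 0 ≤ C) (h : ∀ x, ‖T x‖ ≤ C * ‖x‖) : ‖T‖ ≤ C :=
  csInf_le ⟨0, fun _ h => h.1⟩ ⟨h0, h⟩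

theorem Op.norm_nonneg (T : Op 𝕜 E F) : 0 ≤ ‖T‖ := Real.sInf_nonneg fun _ h => h.1

theorem Op.le_norm [SemiQuasiNormed 𝕜 E] (T : Op 𝕜 E F) (x : E) : ‖T x‖ ≤ ‖T‖ * ‖x‖ := by
  rcases (qn_nonneg 𝕜 x).eq_or_lt with hx | hx
  · obtain ⟨C, -, hC⟩ := T.bound
    have := hC x
    rw [← hx] at this ⊢
    simpa using this
  · rw [← div_le_iff₀ hx]
    refine le_csInf T.bound fun C hC => ?_
    rw [div_le_iff₀ hx]
    exact hC.2 x

instance [SemiQuasiNormed 𝕜 E] [SemiQuasiNormed 𝕜 F] : SemiQuasiNormed 𝕜 (Op 𝕜 E F) where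
  nonneg := Op.norm_nonneg
  smul c T := by
    have key : ∀ (c : 𝕜) (T : Op 𝕜 E F), ‖c • T‖ ≤ ‖c‖ * ‖T‖ := fun c T =>
      Op.norm_le _ (mul_nonneg (_root_.norm_nonneg c) T.norm_nonneg) fun x => by
        rw [Op.smul_apply, qn_smul 𝕜, mul_assoc]
        gcongr
        exact T.le_norm x
    refine le_antisymm (key c T) ?_
    rcases eq_or_ne c 0 with rfl | hc
    · simpa using Op.norm_nonneg _
    · have := key c⁻¹ (c • T)
      rw [inv_smul_smul₀ hc, norm_inv, le_inv_mul_iff₀ (norm_pos_iff.2 hc)] at this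
      exact this
  quasi := by
    obtain ⟨Δ, hΔ, h⟩ := qn_quasi 𝕜 F
    refine ⟨Δ, fun S T => Op.norm_le _ ?_ fun x => (h _ _).trans ?_⟩
    · have := S.norm_nonneg
      have := T.norm_nonneg
      positivity
    · rw [mul_assoc, add_mul]
      gcongr
      · exact S.le_norm x
      · exact T.le_norm x

theorem prod_qn_def (x : E × F) : ‖x‖ = max ‖x.1‖ ‖x.2‖ := rfl

instance [SemiQuasiNormed 𝕜 E] [SemiQuasiNormed 𝕜 F] : SemiQuasiNormed 𝕜 (E × F) where
  nonneg x := (qn_nonneg 𝕜 x.1).trans (le_max_left _ _)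
  smul c x := by
    simp only [prod_qn_def, Prod.smul_fst, Prod.smul_snd, qn_smul 𝕜]
    rw [mul_max_of_nonneg _ _ (norm_nonneg c)]
  quasi := by
    obtain ⟨Δ, hΔ, h⟩ := qn_quasi 𝕜 E
    obtain ⟨Δ', hΔ', h'⟩ := qn_quasi 𝕜 F
    refine ⟨max Δ Δ', fun x y => ?_⟩
    have h1 : 0 ≤ ‖x.1‖ := qn_nonneg 𝕜 x.1
    have h2 : 0 ≤ ‖y.1‖ := qn_nonneg 𝕜 y.1
    have h3 : 0 ≤ ‖x.2‖ := qn_nonneg 𝕜 x.2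
    have h4 : 0 ≤ ‖y.2‖ := qn_nonneg 𝕜 y.2
    simp only [prod_qn_def, Prod.fst_add, Prod.snd_add]
    refine max_le ((h _ _).trans ?_) ((h' _ _).trans ?_)
    · gcongr <;> exact le_max_left _ _
    · gcongr <;> exact le_max_right _ _

instance [QuasiBanach 𝕜 E] [QuasiBanach 𝕜 F] : QuasiBanach 𝕜 (E × F) where
  complete := by
    intro s hs
    obtain ⟨x, hx⟩ := QuasiBanach.complete (𝕜 := 𝕜) (E := E) (fun n => (s n).1) (fun ε hε => by
      obtain ⟨N, hN⟩ := hs ε hε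
      exact ⟨N, fun m hm n hn => (le_max_left _ _).trans_lt (hN m hm n hn)⟩)
    obtain ⟨y, hy⟩ := QuasiBanach.complete (𝕜 := 𝕜) (E := F) (fun n => (s n).2) (fun ε hε => by
      obtain ⟨N, hN⟩ := hs ε hε
      exact ⟨N, fun m hm n hn => (le_max_right _ _).trans_lt (hN m hm n hn)⟩)
    refine ⟨(x, y), ?_⟩
    have := hx.max hy
    rw [max_self] at this
    exact this
  eq_zero x hx := by
    have h1 : ‖x.1‖ ≤ 0 := (le_max_left _ _).trans hx.le
    have h2 : ‖x.2‖ ≤ 0 := (le_max_right _ _).trans hx.le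
    exact Prod.ext (QuasiBanach.eq_zero (𝕜 := 𝕜) _ (le_antisymm h1 (qn_nonneg 𝕜 _)))
      (QuasiBanach.eq_zero (𝕜 := 𝕜) _ (le_antisymm h2 (qn_nonneg 𝕜 _)))

/-- Subspaces carry the restricted quasi-norm. -/
instance (p : Submodule 𝕜 E) : Norm p := ⟨fun x => ‖(x : E)‖⟩

theorem sub_qn_def (p : Submodule 𝕜 E) (x : p) : ‖x‖ = ‖(x : E)‖ := rfl

instance [SemiQuasiNormed 𝕜 E] (p : Submodule 𝕜 E) : SemiQuasiNormed 𝕜 p where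
  nonneg x := qn_nonneg 𝕜 (x : E)
  smul c x := qn_smul 𝕜 c (x : E)
  quasi := by
    obtain ⟨Δ, -, h⟩ := qn_quasi 𝕜 E
    exact ⟨Δ, fun x y => h x y⟩

/-- Sequentially closed subspaces. -/
def SeqClosed (p : Submodule 𝕜 E) : Prop :=
  ∀ (s : ℕ → E) (x : E), (∀ n, s n ∈ p) → Tendsto (fun n => ‖s n - x‖) atTop (𝓝 0) → x ∈ p

theorem QuasiBanach.submodule [QuasiBanach 𝕜 E] {p : Submodule 𝕜 E} (hp : SeqClosed p) :
    QuasiBanach 𝕜 p where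
  complete := by
    intro s hs
    obtain ⟨x, hx⟩ := QuasiBanach.complete (𝕜 := 𝕜) (E := E) (fun n => (s n : E)) hs
    exact ⟨⟨x, hp _ _ (fun n => (s n).2) hx⟩, hx⟩
  eq_zero x hx := Subtype.ext (QuasiBanach.eq_zero (𝕜 := 𝕜) (x : E) hx)

/-- Quotients carry the quotient semi-quasi-norm `‖c‖ = inf {‖x‖ : x ∈ c}`. -/
noncomputable instance (p : Submodule 𝕜 E) : Norm (E ⧸ p) :=
  ⟨fun c => sInf {r : ℝ | ∃ x : E, p.mkQ x = c ∧ ‖x‖ = r}⟩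

theorem quot_qn_le [SemiQuasiNormed 𝕜 E] (p : Submodule 𝕜 E) (x : E) : ‖p.mkQ x‖ ≤ ‖x‖ :=
  csInf_le ⟨0, by rintro _ ⟨y, -, rfl⟩; exact qn_nonneg 𝕜 y⟩ ⟨x, rfl, rfl⟩

theorem quot_qn_lt (p : Submodule 𝕜 E) (c : E ⧸ p) {r : ℝ} (h : ‖c‖ < r) :
    ∃ x, p.mkQ x = c ∧ ‖x‖ < r := by
  obtain ⟨_, ⟨x, hx, rfl⟩, hr⟩ := exists_lt_of_csInf_lt (by
    obtain ⟨x, hx⟩ := p.mkQ_surjective c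
    exact ⟨_, x, hx, rfl⟩) h
  exact ⟨x, hx, hr⟩

instance [SemiQuasiNormed 𝕜 E] (p : Submodule 𝕜 E) : SemiQuasiNormed 𝕜 (E ⧸ p) where
  nonneg c := Real.sInf_nonneg (by rintro _ ⟨y, -, rfl⟩; exact qn_nonneg 𝕜 y)
  smul c x := by
    have key : ∀ (c : 𝕜) (x : E ⧸ p), ‖c • x‖ ≤ ‖c‖ * ‖x‖ := fun c x => by
      refine le_of_forall_pos_le_add fun ε hε => ?_
      have hc : 0 < ‖c‖ + 1 := by positivity
      obtain ⟨y, rfl, hy⟩ := quot_qn_lt p x (lt_add_of_pos_right ‖x‖ (div_pos hε hc))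
      rw [← map_smul]
      refine (quot_qn_le p _).trans ?_
      rw [qn_smul 𝕜]
      have h1 : ‖c‖ * ‖y‖ ≤ ‖c‖ * (‖p.mkQ y‖ + ε / (‖c‖ + 1)) := by gcongr
      have h2 : ‖c‖ * (ε / (‖c‖ + 1)) ≤ ε := by
        rw [mul_div_assoc', div_le_iff₀ hc]
        nlinarith
      linarith
    refine le_antisymm (key c x) ?_
    rcases eq_or_ne c 0 with rfl | hc
    · rw [norm_zero, zero_mul]
      exact Real.sInf_nonneg (by rintro _ ⟨y, -, rfl⟩; exact qn_nonneg 𝕜 y)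
    · have := key c⁻¹ (c • x)
      rw [inv_smul_smul₀ hc, norm_inv, le_inv_mul_iff₀ (norm_pos_iff.2 hc)] at this
      exact this
  quasi := by
    obtain ⟨Δ, hΔ, h⟩ := qn_quasi 𝕜 E
    refine ⟨Δ, fun x y => le_of_forall_pos_le_add fun ε hε => ?_⟩
    have hδ : 0 < ε / (2 * Δ) := by positivity
    obtain ⟨x, rfl, hx⟩ := quot_qn_lt p x (lt_add_of_pos_right ‖x‖ hδ)
    obtain ⟨y, rfl, hy⟩ := quot_qn_lt p y (lt_add_of_pos_right ‖y‖ hδ)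
    rw [← map_add]
    refine (quot_qn_le p _).trans ((h x y).trans ?_)
    calc Δ * (‖x‖ + ‖y‖)
        ≤ Δ * ((‖p.mkQ x‖ + ε / (2 * Δ)) + (‖p.mkQ y‖ + ε / (2 * Δ))) := by gcongr
      _ = _ := by field_simp; ring

theorem QuasiBanach.quotient [QuasiBanach 𝕜 E] {p : Submodule 𝕜 E} (hp : SeqClosed p) :
    QuasiBanach 𝕜 (E ⧸ p) where
  complete := by
    intro s hs
    obtain ⟨Δ, hΔ, h⟩ := qn_quasi 𝕜 E
    obtain ⟨Δ', hΔ', h'⟩ := qn_quasi 𝕜 (E ⧸ p)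
    set r : ℕ → ℝ := fun n => (1 / (2 * Δ)) ^ n with hr
    have hr0 : ∀ n, 0 < r n := fun n => by positivity
    choose N hN using fun n => hs (r n) (hr0 n)
    -- a rapidly Cauchy subsequence
    let φ : ℕ → ℕ := fun n => ∑ k ∈ Finset.range (n + 1), N k
    have hφ1 : ∀ n, N n ≤ φ n := fun n =>
      Finset.single_le_sum (f := N) (fun _ _ => Nat.zero_le _) (Finset.self_mem_range_succ n)
    have hφ2 : ∀ n, N n ≤ φ (n + 1) := fun n =>
      Finset.single_le_sum (f := N) (fun _ _ => Nat.zero_le _) (Finset.mem_range.2 (by omega))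
    have hstep : ∀ n (x : E), ∃ d : E, p.mkQ x = s (φ n) →
        p.mkQ (x + d) = s (φ (n + 1)) ∧ ‖d‖ ≤ r n := by
      intro n x
      obtain ⟨d, hd, hd'⟩ := quot_qn_lt p (s (φ (n + 1)) - s (φ n)) (hN n _ (hφ2 n) _ (hφ1 n))
      exact ⟨d, fun hx => ⟨by rw [map_add, hx, hd, add_sub_cancel], hd'.le⟩⟩
    choose d hd using hstep
    obtain ⟨x₀, hx₀⟩ := p.mkQ_surjective (s (φ 0))
    let x : ℕ → E := fun n => Nat.rec x₀ (fun k x => x + d k x) n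
    have hx : ∀ n, p.mkQ (x n) = s (φ n) := by
      intro n
      induction n with
      | zero => exact hx₀
      | succ n ih => exact (hd n _ ih).1
    obtain ⟨z, hz, hz'⟩ := fast_limit 𝕜 (QuasiBanach.complete (𝕜 := 𝕜) (E := E)) hΔ h x r
      (fun n => (hr0 n).le)
      (fun n => by
        apply le_of_eq
        rw [hr]
        simp only [pow_succ]
        field_simp)
      (fun n => by
        rw [show x (n + 1) = x n + d n (x n) from rfl, add_sub_cancel_left]
        exact (hd n _ (hx n)).2)
    refine ⟨p.mkQ z, ?_⟩
    have hrl : Tendsto r atTop (𝓝 0) :=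
      tendsto_pow_atTop_nhds_zero_of_lt_one (by positivity)
        (by rw [div_lt_one (by positivity)]; linarith)
    rw [Metric.tendsto_atTop]
    intro ε hε
    obtain ⟨M, hM⟩ := hs (ε / (2 * Δ')) (by positivity)
    have hev : ∀ᶠ k in atTop, ‖x k - z‖ < ε / (2 * Δ') :=
      (tendsto_order.1 hz).2 _ (by positivity)
    have hφ : ∀ᶠ k in atTop, r k < ε / (2 * Δ') := (tendsto_order.1 hrl).2 _ (by positivity)
    obtain ⟨k, hk, hk'⟩ := (hev.and hφ).exists
    refine ⟨max (N k) M, fun n hn => ?_⟩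
    rw [Real.dist_eq, sub_zero, abs_of_nonneg (qn_nonneg 𝕜 _)]
    have h1 : ‖s n - s (φ k)‖ < ε / (2 * Δ') :=
      (hN k n (le_of_max_le_left hn) _ (hφ1 k)).trans hk'
    have h2 : ‖s (φ k) - p.mkQ z‖ < ε / (2 * Δ') := by
      rw [← hx, ← map_sub]
      exact (quot_qn_le p _).trans_lt hk
    refine (qn_sub_le 𝕜 h' _ (s (φ k)) _).trans_lt ?_
    calc _ < Δ' * (ε / (2 * Δ') + ε / (2 * Δ')) := by gcongr
      _ = ε := by field_simp; norm_num
  eq_zero c hc := by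
    obtain ⟨x, rfl⟩ := p.mkQ_surjective c
    have : ∀ n : ℕ, ∃ y ∈ p, ‖y - x‖ < 1 / ((n : ℝ) + 1) := by
      intro n
      obtain ⟨z, hz, hz'⟩ := quot_qn_lt p (p.mkQ x) (hc.trans_lt (Nat.one_div_pos_of_nat (n := n)))
      refine ⟨x - z, ?_, ?_⟩
      · rw [← Submodule.ker_mkQ p, LinearMap.mem_ker, map_sub, hz, sub_self]
      · rw [sub_sub_cancel_left, qn_neg 𝕜]; exact hz'
    choose y hy hy' using this
    rw [← LinearMap.mem_ker, Submodule.ker_mkQ]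
    exact hp y x hy (squeeze_zero (fun _ => qn_nonneg 𝕜 _) (fun n => (hy' n).le)
      tendsto_one_div_add_atTop_nhds_zero_nat)

theorem lp_semiQuasiNormed (𝕜 : Type) [RCLike 𝕜] (I : Type w) {q : ℝ} (h0 : 0 < q) (h1 : q < 1) :
    SemiQuasiNormed 𝕜 (lp (fun _ : I => 𝕜) (ENNReal.ofReal q)) where
  nonneg := lp.norm_nonneg'
  smul c f := lp.norm_const_smul (by simpa using h0) f
  quasi := by
    have hq : (ENNReal.ofReal q).toReal = q := ENNReal.toReal_ofReal h0.le
    have hq' : 0 < (ENNReal.ofReal q).toReal := by rwa [hq]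
    refine ⟨2 ^ (1 / q), fun f g => ?_⟩
    have hf := lp.norm_nonneg' f
    have hg := lp.norm_nonneg' g
    set M := max ‖f‖ ‖g‖
    have hM : 0 ≤ M := hf.trans (le_max_left _ _)
    have key : ‖f + g‖ ^ q ≤ 2 * M ^ q := by
      have e1 := lp.norm_rpow_eq_tsum hq' (f + g)
      have e2 := lp.norm_rpow_eq_tsum hq' f
      have e3 := lp.norm_rpow_eq_tsum hq' g
      have s1 := (lp.memℓp (f + g)).summable hq'
      have s2 := (lp.memℓp f).summable hq'
      have s3 := (lp.memℓp g).summable hq'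
      rw [hq] at e1 e2 e3 s1 s2 s3
      have : ‖f + g‖ ^ q ≤ ‖f‖ ^ q + ‖g‖ ^ q := by
        rw [e1, e2, e3, ← s2.tsum_add s3]
        refine s1.tsum_le_tsum (fun i => ?_) (s2.add s3)
        refine (Real.rpow_le_rpow (norm_nonneg _) (norm_add_le _ _) h0.le).trans ?_
        exact Real.rpow_add_le_add_rpow (norm_nonneg _) (norm_nonneg _) h0.le h1.le
      have h2 : ‖f‖ ^ q ≤ M ^ q := Real.rpow_le_rpow hf (le_max_left _ _) h0.le
      have h3 : ‖g‖ ^ q ≤ M ^ q := Real.rpow_le_rpow hg (le_max_right _ _) h0.le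
      linarith
    have h4 : ‖f + g‖ ≤ 2 ^ (1 / q) * M := by
      rw [← Real.rpow_le_rpow_iff (lp.norm_nonneg' _) (by positivity) h0,
        Real.mul_rpow (by positivity) hM, ← Real.rpow_mul (by norm_num), one_div_mul_cancel h0.ne',
        Real.rpow_one]
      exact key
    refine h4.trans ?_
    gcongr
    exact max_le (by linarith) (by linarith)

end constructions

/-! ### Elementary operators -/

section elementary

variable {𝕜 : Type} [RCLike 𝕜]
variable {E : Type*} {F : Type*} {G : Type*} {H : Type*}
    [AddCommGroup E] [Module 𝕜 E] [Norm E] [AddCommGroup F] [Module 𝕜 F] [Norm F]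
    [AddCommGroup G] [Module 𝕜 G] [Norm G] [AddCommGroup H] [Module 𝕜 H] [Norm H]

/-- First projection. -/
def Op.fst : Op 𝕜 (E × F) E :=
  ⟨LinearMap.fst 𝕜 E F, 1, fun x => by rw [one_mul]; exact le_max_left _ _⟩

/-- Second projection. -/
def Op.snd : Op 𝕜 (E × F) F :=
  ⟨LinearMap.snd 𝕜 E F, 1, fun x => by rw [one_mul]; exact le_max_right _ _⟩

/-- The operator `x ↦ (S x, T x)`. -/
def Op.pair [SemiQuasiNormed 𝕜 G] (S : Op 𝕜 G E) (T : Op 𝕜 G F) : Op 𝕜 G (E × F) :=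
  ⟨S.1.prod T.1, by
    obtain ⟨C, hC0, hC⟩ := S.bound
    obtain ⟨D, hD0, hD⟩ := T.bound
    refine ⟨max C D, fun x => max_le ((hC x).trans ?_) ((hD x).trans ?_)⟩
    · have := qn_nonneg 𝕜 x
      gcongr
      exact le_max_left _ _
    · have := qn_nonneg 𝕜 x
      gcongr
      exact le_max_right _ _⟩

/-- The inclusion of a subspace. -/
def Op.incl (p : Submodule 𝕜 E) : Op 𝕜 p E := ⟨p.subtype, 1, fun x => by rw [one_mul]; rfl⟩

/-- Restriction of the codomain. -/
def Op.cod (p : Submodule 𝕜 F) (T : Op 𝕜 E F) (h : ∀ x, T x ∈ p) : Op 𝕜 E p :=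
  ⟨T.1.codRestrict p h, T.2⟩

/-- The natural map onto a quotient. -/
def Op.mkQ [SemiQuasiNormed 𝕜 E] (p : Submodule 𝕜 E) : Op 𝕜 E (E ⧸ p) :=
  ⟨p.mkQ, 1, fun x => by rw [one_mul]; exact quot_qn_le p x⟩

/-- The operator induced on a quotient. -/
def Op.liftQ [SemiQuasiNormed 𝕜 E] [SemiQuasiNormed 𝕜 F] (p : Submodule 𝕜 E) (T : Op 𝕜 E F)
    (h : ∀ x ∈ p, T x = 0) : Op 𝕜 (E ⧸ p) F :=
  ⟨p.liftQ T.1 h, by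
    obtain ⟨C, hC0, hC⟩ := T.bound
    refine ⟨C, fun c => le_of_forall_pos_le_add fun ε hε => ?_⟩
    have hC1 : 0 < C + 1 := by positivity
    obtain ⟨x, rfl, hx⟩ := quot_qn_lt p c (lt_add_of_pos_right ‖c‖ (div_pos hε hC1))
    have h1 : ‖T x‖ ≤ C * ‖x‖ := hC x
    have h2 : C * ‖x‖ ≤ C * (‖p.mkQ x‖ + ε / (C + 1)) := by gcongr
    have h3 : C * (ε / (C + 1)) ≤ ε := by
      rw [mul_div_assoc', div_le_iff₀ hC1]
      nlinarith
    have h4 : p.liftQ T.1 h (p.mkQ x) = T x := rfl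
    rw [h4]
    linarith⟩

@[simp] theorem Op.fst_apply (x : E × F) : (Op.fst : Op 𝕜 (E × F) E) x = x.1 := rfl
@[simp] theorem Op.snd_apply (x : E × F) : (Op.snd : Op 𝕜 (E × F) F) x = x.2 := rfl
@[simp] theorem Op.pair_apply [SemiQuasiNormed 𝕜 G] (S : Op 𝕜 G E) (T : Op 𝕜 G F) (x : G) :
    S.pair T x = (S x, T x) := rfl
@[simp] theorem Op.incl_apply (p : Submodule 𝕜 E) (x : p) : Op.incl p x = x := rfl
@[simp] theorem Op.cod_apply (p : Submodule 𝕜 F) (T : Op 𝕜 E F) (h : ∀ x, T x ∈ p) (x : E) :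
    Op.cod p T h x = ⟨T x, h x⟩ := rfl
@[simp] theorem Op.mkQ_apply [SemiQuasiNormed 𝕜 E] (p : Submodule 𝕜 E) (x : E) :
    Op.mkQ p x = p.mkQ x := rfl
@[simp] theorem Op.liftQ_apply [SemiQuasiNormed 𝕜 E] [SemiQuasiNormed 𝕜 F] (p : Submodule 𝕜 E)
    (T : Op 𝕜 E F) (h : ∀ x ∈ p, T x = 0) (x : E) : Op.liftQ p T h (p.mkQ x) = T x := rfl

/-- The diagonal `x ↦ (x, x)`. -/
def Op.diag [SemiQuasiNormed 𝕜 E] : Op 𝕜 E (E × E) := Op.id.pair Op.id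

/-- The sum `(x, y) ↦ x + y`. -/
def Op.sum [SemiQuasiNormed 𝕜 E] : Op 𝕜 (E × E) E := Op.fst + Op.snd

/-- The operator `(x, y) ↦ (S x, T y)`. -/
def Op.prodMap [SemiQuasiNormed 𝕜 E] [SemiQuasiNormed 𝕜 F] (S : Op 𝕜 E G) (T : Op 𝕜 F H) :
    Op 𝕜 (E × F) (G × H) := (S.comp Op.fst).pair (T.comp Op.snd)

@[simp] theorem Op.diag_apply [SemiQuasiNormed 𝕜 E] (x : E) :
    (Op.diag : Op 𝕜 E (E × E)) x = (x, x) := rfl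
@[simp] theorem Op.sum_apply [SemiQuasiNormed 𝕜 E] (x : E × E) :
    (Op.sum : Op 𝕜 (E × E) E) x = x.1 + x.2 := rfl
@[simp] theorem Op.prodMap_apply [SemiQuasiNormed 𝕜 E] [SemiQuasiNormed 𝕜 F] (S : Op 𝕜 E G)
    (T : Op 𝕜 F H) (x : E × F) : S.prodMap T x = (S x.1, T x.2) := rfl

end elementary

/-! ### Extensions and the space `Ext(X, Y)` -/

/-- An extension `0 → Y → Z → X → 0`: a short exact sequence of quasi-Banach spaces and
operators. -/
structure Extn (𝕜 : Type) [RCLike 𝕜] (X Y : Type u) [AddCommGroup X] [Module 𝕜 X] [Norm X]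
    [AddCommGroup Y] [Module 𝕜 Y] [Norm Y] where
  Z : Type u
  [grp : AddCommGroup Z]
  [mod : Module 𝕜 Z]
  [nrm : Norm Z]
  [ban : QuasiBanach 𝕜 Z]
  i : Op 𝕜 Y Z
  π : Op 𝕜 Z X
  inj : Function.Injective i
  exact : ∀ z, π z = 0 ↔ ∃ y, i y = z
  surj : Function.Surjective π

namespace Extn

attribute [instance] Extn.grp Extn.mod Extn.nrm Extn.ban

variable {𝕜 : Type} [RCLike 𝕜]
variable {X Y X' Y' X'' Y'' : Type u}
    [AddCommGroup X] [Module 𝕜 X] [Norm X] [QuasiBanach 𝕜 X]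
    [AddCommGroup Y] [Module 𝕜 Y] [Norm Y] [QuasiBanach 𝕜 Y]
    [AddCommGroup X'] [Module 𝕜 X'] [Norm X'] [QuasiBanach 𝕜 X']
    [AddCommGroup Y'] [Module 𝕜 Y'] [Norm Y'] [QuasiBanach 𝕜 Y']
    [AddCommGroup X''] [Module 𝕜 X''] [Norm X''] [QuasiBanach 𝕜 X'']
    [AddCommGroup Y''] [Module 𝕜 Y''] [Norm Y''] [QuasiBanach 𝕜 Y'']

@[simp] theorem π_i (E : Extn 𝕜 X Y) (y : Y) : E.π (E.i y) = 0 := (E.exact _).2 ⟨y, rfl⟩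

/-- `i` is an isomorphism onto its range. -/
theorem i_lower (E : Extn 𝕜 X Y) : ∃ C : ℝ, 0 ≤ C ∧ ∀ y, ‖y‖ ≤ C * ‖E.i y‖ := by
  let p : Submodule 𝕜 E.Z := LinearMap.ker E.π.1
  have : QuasiBanach 𝕜 p := QuasiBanach.submodule (by
    intro s x hs hx
    have h1 := E.π.tendsto hx
    have h2 : ∀ n, E.π (s n) = 0 := hs
    simp only [h2] at h1
    have h3 : Tendsto (fun _ : ℕ => ‖(0 : X) - 0‖) atTop (𝓝 0) := by simp [qn_zero 𝕜]
    exact limit_unique 𝕜 h1 h3)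
  let j : Op 𝕜 Y p := Op.cod p E.i E.π_i
  obtain ⟨C, hC0, hC⟩ := open_mapping j (by
    rintro ⟨z, hz⟩
    obtain ⟨y, rfl⟩ := (E.exact z).1 hz
    exact ⟨y, rfl⟩)
  refine ⟨C, hC0, fun y => ?_⟩
  obtain ⟨y', hy', hy''⟩ := hC (j y)
  have : y' = y := E.inj (congrArg Subtype.val hy')
  rw [← this] at hy'' ⊢
  exact hy''

/-- Equivalence of extensions. -/
def Equivalent (E E' : Extn 𝕜 X Y) : Prop :=
  ∃ t : Op 𝕜 E.Z E'.Z, (∀ y, t (E.i y) = E'.i y) ∧ ∀ z, E'.π (t z) = E.π z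

theorem Equivalent.refl (E : Extn 𝕜 X Y) : E.Equivalent E := ⟨Op.id, fun _ => rfl, fun _ => rfl⟩

theorem Equivalent.trans {E E' E'' : Extn 𝕜 X Y} (h : E.Equivalent E') (h' : E'.Equivalent E'') :
    E.Equivalent E'' := by
  obtain ⟨t, h1, h2⟩ := h
  obtain ⟨t', h3, h4⟩ := h'
  exact ⟨t'.comp t, fun y => by simp [h1, h3], fun z => by simp [h2, h4]⟩

theorem Equivalent.symm {E E' : Extn 𝕜 X Y} (h : E.Equivalent E') : E'.Equivalent E := by
  obtain ⟨t, h1, h2⟩ := h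
  have hinj : Function.Injective t := by
    rw [injective_iff_map_eq_zero]
    intro z hz
    obtain ⟨y, rfl⟩ := (E.exact z).1 (by rw [← h2, hz, map_zero])
    rw [h1] at hz
    rw [(injective_iff_map_eq_zero E'.i).1 E'.inj y hz, map_zero]
  have hsurj : Function.Surjective t := by
    intro z'
    obtain ⟨z, hz⟩ := E.surj (E'.π z')
    obtain ⟨y, hy⟩ := (E'.exact (z' - t z)).1 (by rw [map_sub, h2, hz, sub_self])
    exact ⟨z + E.i y, by rw [map_add, h1, hy, add_sub_cancel]⟩
  obtain ⟨C, -, hC⟩ := open_mapping t hsurj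
  let e := LinearEquiv.ofBijective t.1 ⟨hinj, hsurj⟩
  have he : ∀ z, e.symm (t z) = z := fun z => e.symm_apply_apply z
  have hs : ∀ z', ∃ z, t z = z' := hsurj
  refine ⟨⟨e.symm.toLinearMap, C, fun z' => ?_⟩, fun y => ?_, fun z' => ?_⟩
  · obtain ⟨z, rfl, hz⟩ := hC z'
    exact (congrArg norm (he z)).trans_le hz
  · rw [← h1]; exact he _
  · obtain ⟨z, rfl⟩ := hs z'
    rw [h2]; exact congrArg E.π (he z)

variable (𝕜 X Y) in
/-- Equivalence of extensions as a setoid. -/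
def setoid : Setoid (Extn 𝕜 X Y) := ⟨Equivalent, Equivalent.refl, Equivalent.symm, Equivalent.trans⟩

/-- The subspace `{(y', x', z) : f x' = π z}` of `Y' × X' × Z`. -/
def amb (E : Extn 𝕜 X Y) (f : Op 𝕜 X' X) (Y' : Type u) [AddCommGroup Y'] [Module 𝕜 Y'] [Norm Y'] :
    Submodule 𝕜 (Y' × X' × E.Z) where
  carrier := {w | f w.2.1 = E.π w.2.2}
  zero_mem' := by simp
  add_mem' := by
    intro a b (ha : f a.2.1 = _) (hb : f b.2.1 = _)
    change f (a.2.1 + b.2.1) = E.π (a.2.2 + b.2.2)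
    rw [map_add, map_add, ha, hb]
  smul_mem' := by
    intro c a (ha : f a.2.1 = _)
    change f (c • a.2.1) = E.π (c • a.2.2)
    rw [map_smul, map_smul, ha]

/-- The subspace `{(- g y, 0, i y) : y ∈ Y}`. -/
def glue (E : Extn 𝕜 X Y) (f : Op 𝕜 X' X) (g : Op 𝕜 Y Y') : Submodule 𝕜 (E.amb f Y') where
  carrier := {w | ∃ y, w.1.1 = -g y ∧ w.1.2.1 = 0 ∧ w.1.2.2 = E.i y}
  zero_mem' := ⟨0, by simp⟩
  add_mem' := by
    rintro a b ⟨y, h1, h2, h3⟩ ⟨y', h1', h2', h3'⟩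
    refine ⟨y + y', ?_, ?_, ?_⟩
    · change a.1.1 + b.1.1 = _
      rw [h1, h1', map_add]; abel
    · change a.1.2.1 + b.1.2.1 = _
      rw [h2, h2', add_zero]
    · change a.1.2.2 + b.1.2.2 = _
      rw [h3, h3', map_add]
  smul_mem' := by
    rintro c a ⟨y, h1, h2, h3⟩
    refine ⟨c • y, ?_, ?_, ?_⟩
    · change c • a.1.1 = _
      rw [h1, map_smul, smul_neg]
    · change c • a.1.2.1 = _
      rw [h2, smul_zero]
    · change c • a.1.2.2 = _
      rw [h3, map_smul]

instance (E : Extn 𝕜 X Y) (f : Op 𝕜 X' X) : QuasiBanach 𝕜 (E.amb f Y') :=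
  QuasiBanach.submodule (by
    intro s w hs hw
    have h1 := (f.comp (Op.fst.comp Op.snd)).tendsto hw
    have h2 := (E.π.comp (Op.snd.comp Op.snd)).tendsto hw
    have h3 : ∀ n, f.comp (Op.fst.comp Op.snd) (s n) = E.π.comp (Op.snd.comp Op.snd) (s n) := hs
    simp only [h3] at h1
    exact limit_unique 𝕜 h1 h2)

theorem glue_closed (E : Extn 𝕜 X Y) (f : Op 𝕜 X' X) (g : Op 𝕜 Y Y') : SeqClosed (E.glue f g) := by
  intro s w hs hw
  choose y h1 h2 h3 using hs
  obtain ⟨C, hC0, hC⟩ := E.i_lower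
  have t1 := (Op.fst.comp (Op.incl (E.amb f Y'))).tendsto hw
  have t2 := ((Op.fst.comp Op.snd).comp (Op.incl (E.amb f Y'))).tendsto hw
  have t3 := ((Op.snd.comp Op.snd).comp (Op.incl (E.amb f Y'))).tendsto hw
  simp only [Op.comp_apply, Op.incl_apply, Op.fst_apply, Op.snd_apply, h1, h2, h3] at t1 t2 t3
  have e2 : (w : Y' × X' × E.Z).2.1 = 0 := by
    refine (limit_unique 𝕜 t2 (y := 0) ?_)
    simp [qn_zero 𝕜]
  have hz : E.π (w : Y' × X' × E.Z).2.2 = 0 := by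
    have := w.2
    change f w.1.2.1 = E.π w.1.2.2 at this
    rw [← this, e2, map_zero]
  obtain ⟨y₀, hy₀⟩ := (E.exact _).1 hz
  rw [← hy₀] at t3
  have t4 : Tendsto (fun n => ‖y n - y₀‖) atTop (𝓝 0) := by
    refine squeeze_zero (fun _ => qn_nonneg 𝕜 _) (fun n => ?_) (by simpa using t3.const_mul C)
    rw [← map_sub]
    exact hC _
  have t5 := (-g).tendsto t4
  refine ⟨y₀, limit_unique 𝕜 t1 t5, e2, hy₀.symm⟩

instance (E : Extn 𝕜 X Y) (f : Op 𝕜 X' X) (g : Op 𝕜 Y Y') :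
    QuasiBanach 𝕜 (E.amb f Y' ⧸ E.glue f g) := QuasiBanach.quotient (E.glue_closed f g)

/-- Pull-back along `f : X' → X` followed by push-out along `g : Y → Y'`: the middle space is the
quotient of `Y' × {(x', z) : f x' = π z}` by the copy `{(- g y, (0, i y))}` of `Y`. -/
noncomputable def map (E : Extn 𝕜 X Y) (f : Op 𝕜 X' X) (g : Op 𝕜 Y Y') : Extn 𝕜 X' Y' where
  Z := E.amb f Y' ⧸ E.glue f g
  i := (Op.mkQ (E.glue f g)).comp (Op.cod (E.amb f Y') (Op.id.pair 0) fun y' => by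
    change f 0 = E.π 0
    rw [map_zero, map_zero])
  π := Op.liftQ (E.glue f g) ((Op.fst.comp Op.snd).comp (Op.incl _)) (by
    rintro w ⟨y, -, h, -⟩
    exact h)
  inj := by
    rw [injective_iff_map_eq_zero]
    intro y' hy'
    have : (⟨(y', 0), _⟩ : E.amb f Y') ∈ E.glue f g := (Submodule.Quotient.mk_eq_zero _).1 hy'
    obtain ⟨y, h1, -, h3⟩ := this
    have : y = 0 := (injective_iff_map_eq_zero E.i).1 E.inj y h3.symm
    subst this
    simpa using h1
  exact := by
    intro c
    obtain ⟨w, rfl⟩ := (E.glue f g).mkQ_surjective c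
    constructor
    · intro (h : w.1.2.1 = 0)
      have h2 : f w.1.2.1 = E.π w.1.2.2 := w.2
      rw [h, map_zero] at h2
      obtain ⟨y, hy⟩ := (E.exact _).1 h2.symm
      refine ⟨w.1.1 + g y, ?_⟩
      refine (Submodule.Quotient.eq _).2 ⟨-y, ?_, ?_, ?_⟩
      · change w.1.1 + g y - w.1.1 = _
        rw [map_neg]; abel
      · change 0 - w.1.2.1 = 0
        rw [h, sub_zero]
      · change 0 - w.1.2.2 = _
        rw [map_neg, hy, zero_sub]
    · rintro ⟨y', h⟩
      rw [← h]
      rfl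
  surj := by
    intro x'
    obtain ⟨z, hz⟩ := E.surj (f x')
    exact ⟨(E.glue f g).mkQ ⟨(0, x', z), hz.symm⟩, rfl⟩

/-- The direct product of two extensions. -/
def prod (E : Extn 𝕜 X Y) (E' : Extn 𝕜 X' Y') : Extn 𝕜 (X × X') (Y × Y') where
  Z := E.Z × E'.Z
  i := E.i.prodMap E'.i
  π := E.π.prodMap E'.π
  inj := E.inj.prodMap E'.inj
  exact := by
    rintro ⟨z, z'⟩
    constructor
    · intro h
      obtain ⟨y, hy⟩ := (E.exact z).1 (congrArg Prod.fst h)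
      obtain ⟨y', hy'⟩ := (E'.exact z').1 (congrArg Prod.snd h)
      exact ⟨(y, y'), Prod.ext hy hy'⟩
    · rintro ⟨y, h⟩
      rw [← h]
      exact Prod.ext (E.π_i _) (E'.π_i _)
  surj := E.surj.prodMap E'.surj

variable (𝕜 X Y) in
/-- The trivial extension `0 → Y → Y ⊕ X → X → 0`. -/
def split : Extn 𝕜 X Y where
  Z := Y × X
  i := Op.id.pair 0
  π := Op.snd
  inj := fun a b h => congrArg Prod.fst h
  exact := by
    rintro ⟨y, x⟩
    exact ⟨fun (h : x = 0) => ⟨y, Prod.ext rfl h.symm⟩, by rintro ⟨y', h⟩; rw [← h]; rfl⟩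
  surj := fun x => ⟨(0, x), rfl⟩

/-! Universal property of `Extn.map`. -/

/-- The pull-back `{(x', z) : f x' = π z}`. -/
def pb (E : Extn 𝕜 X Y) (f : Op 𝕜 X' X) : Submodule 𝕜 (X' × E.Z) where
  carrier := {w | f w.1 = E.π w.2}
  zero_mem' := by simp
  add_mem' := by
    intro a b (ha : f a.1 = _) (hb : f b.1 = _)
    change f (a.1 + b.1) = E.π (a.2 + b.2)
    rw [map_add, map_add, ha, hb]
  smul_mem' := by
    intro c a (ha : f a.1 = _)
    change f (c • a.1) = E.π (c • a.2)
    rw [map_smul, map_smul, ha]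

/-- `E'` receives an operator from the pull-back of `E` along `f`, inducing `g` on the kernels and
the identity on `X'`. -/
def Rel (f : Op 𝕜 X' X) (g : Op 𝕜 Y Y') (E : Extn 𝕜 X Y) (E' : Extn 𝕜 X' Y') : Prop :=
  ∃ T : Op 𝕜 (E.pb f) E'.Z, (∀ y h, T ⟨(0, E.i y), h⟩ = E'.i (g y)) ∧ ∀ w, E'.π (T w) = w.1.1

theorem rel_map (E : Extn 𝕜 X Y) (f : Op 𝕜 X' X) (g : Op 𝕜 Y Y') : Rel f g E (E.map f g) := by
  refine ⟨(Op.mkQ (E.glue f g)).comp (Op.cod (E.amb f Y')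
    ((0 : Op 𝕜 (E.pb f) Y').pair (Op.incl _)) fun w => w.2), fun y h => ?_, fun w => rfl⟩
  refine (Submodule.Quotient.eq _).2 ⟨y, ?_, ?_, ?_⟩
  · change 0 - g y = -g y
    rw [zero_sub]
  · change (0 : X') - 0 = 0
    rw [sub_zero]
  · change E.i y - 0 = E.i y
    rw [sub_zero]

theorem Rel.equiv {f : Op 𝕜 X' X} {g : Op 𝕜 Y Y'} {E : Extn 𝕜 X Y} {E' : Extn 𝕜 X' Y'}
    (h : Rel f g E E') : (E.map f g).Equivalent E' := by
  obtain ⟨T, h1, h2⟩ := h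
  let T₁ : Op 𝕜 (E.amb f Y') (E.pb f) := Op.cod (E.pb f) (Op.snd.comp (Op.incl _)) fun w => w.2
  let S : Op 𝕜 (E.amb f Y') E'.Z := E'.i.comp (Op.fst.comp (Op.incl _)) + T.comp T₁
  refine ⟨Op.liftQ (E.glue f g) S ?_, fun y' => ?_, fun c => ?_⟩
  · rintro ⟨⟨y', x', z⟩, hw⟩ ⟨y, e1, e2, e3⟩
    dsimp only at e1 e2 e3
    subst e1 e2 e3
    refine (congrArg (fun z => E'.i (-g y) + z) (h1 y hw)).trans ?_
    rw [map_neg, neg_add_cancel]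
  · change E'.i y' + T 0 = E'.i y'
    rw [map_zero, add_zero]
  · obtain ⟨w, rfl⟩ := (E.glue f g).mkQ_surjective c
    change E'.π (E'.i w.1.1 + T (T₁ w)) = w.1.2.1
    rw [map_add, π_i, zero_add, h2]
    rfl

theorem Rel.comp {f : Op 𝕜 X' X} {g : Op 𝕜 Y Y'} {f' : Op 𝕜 X'' X'} {g' : Op 𝕜 Y' Y''}
    {E : Extn 𝕜 X Y} {E' : Extn 𝕜 X' Y'} {E'' : Extn 𝕜 X'' Y''}
    (h : Rel f g E E') (h' : Rel f' g' E' E'') : Rel (f.comp f') (g'.comp g) E E'' := by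
  obtain ⟨T, h1, h2⟩ := h
  obtain ⟨T', h3, h4⟩ := h'
  let A : Op 𝕜 (E.pb (f.comp f')) (E.pb f) := Op.cod (E.pb f)
    ((f'.comp (Op.fst.comp (Op.incl _))).pair (Op.snd.comp (Op.incl _))) fun w => w.2
  let B : Op 𝕜 (E.pb (f.comp f')) (E'.pb f') := Op.cod (E'.pb f')
    ((Op.fst.comp (Op.incl _)).pair (T.comp A)) fun w => by
      change f' w.1.1 = E'.π (T (A w))
      rw [h2]
      rfl
  refine ⟨T'.comp B, fun y hy => ?_, fun w => ?_⟩
  · have hA : A ⟨(0, E.i y), hy⟩ = ⟨(0, E.i y), by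
        change f 0 = _
        rw [π_i, map_zero]⟩ := Subtype.ext (Prod.ext (map_zero f') rfl)
    have hB : B ⟨(0, E.i y), hy⟩ = ⟨(0, E'.i (g y)), by
        change f' 0 = _
        rw [π_i, map_zero]⟩ := Subtype.ext (Prod.ext rfl (by
          change T (A _) = _
          rw [hA, h1]))
    rw [Op.comp_apply, hB, h3]
    rfl
  · rw [Op.comp_apply, h4]
    rfl

theorem Rel.prod {X₂ Y₂ X₂' Y₂' : Type u}
    [AddCommGroup X₂] [Module 𝕜 X₂] [Norm X₂] [QuasiBanach 𝕜 X₂]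
    [AddCommGroup Y₂] [Module 𝕜 Y₂] [Norm Y₂] [QuasiBanach 𝕜 Y₂]
    [AddCommGroup X₂'] [Module 𝕜 X₂'] [Norm X₂'] [QuasiBanach 𝕜 X₂']
    [AddCommGroup Y₂'] [Module 𝕜 Y₂'] [Norm Y₂'] [QuasiBanach 𝕜 Y₂']
    {f : Op 𝕜 X' X} {g : Op 𝕜 Y Y'} {f₂ : Op 𝕜 X₂' X₂} {g₂ : Op 𝕜 Y₂ Y₂'}
    {E : Extn 𝕜 X Y} {E' : Extn 𝕜 X' Y'} {E₂ : Extn 𝕜 X₂ Y₂} {E₂' : Extn 𝕜 X₂' Y₂'}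
    (h : Rel f g E E') (h' : Rel f₂ g₂ E₂ E₂') :
    Rel (f.prodMap f₂) (g.prodMap g₂) (E.prod E₂) (E'.prod E₂') := by
  obtain ⟨T, h1, h2⟩ := h
  obtain ⟨T', h3, h4⟩ := h'
  let A : Op 𝕜 ((E.prod E₂).pb (f.prodMap f₂)) (E.pb f) := Op.cod (E.pb f)
    ((Op.fst.prodMap Op.fst).comp (Op.incl _)) fun w => congrArg Prod.fst w.2
  let B : Op 𝕜 ((E.prod E₂).pb (f.prodMap f₂)) (E₂.pb f₂) := Op.cod (E₂.pb f₂)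
    ((Op.snd.prodMap Op.snd).comp (Op.incl _)) fun w => congrArg Prod.snd w.2
  refine ⟨(T.comp A).pair (T'.comp B), fun y hy => ?_, fun w => ?_⟩
  · exact Prod.ext (h1 y.1 _) (h3 y.2 _)
  · exact Prod.ext (h2 _) (h4 _)

theorem Rel.cast {f f' : Op 𝕜 X' X} {g g' : Op 𝕜 Y Y'} {E : Extn 𝕜 X Y} {E' : Extn 𝕜 X' Y'}
    (h : Rel f g E E') (hf : ∀ x, f x = f' x) (hg : ∀ y, g y = g' y) : Rel f' g' E E' := by
  rwa [← Op.ext hf, ← Op.ext hg]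

theorem Equivalent.rel {E E' : Extn 𝕜 X Y} (h : E.Equivalent E') : Rel Op.id Op.id E E' := by
  obtain ⟨t, h1, h2⟩ := h
  refine ⟨t.comp (Op.snd.comp (Op.incl _)), fun y hy => h1 y, fun w => ?_⟩
  rw [Op.comp_apply, h2]
  exact w.2.symm

/-! The functional `ϱ(i, π)`. -/

/-- Homogeneous bounded sections of `π`. -/
def IsSection (E : Extn 𝕜 X Y) (B : X → E.Z) : Prop :=
  (∀ (c : 𝕜) x, B (c • x) = c • B x) ∧ (∃ C : ℝ, ∀ x, ‖B x‖ ≤ C * ‖x‖) ∧ ∀ x, E.π (B x) = x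

/-- The constants `Q ≥ 0` with `‖i⁻¹(B(x + y) - B x - B y)‖ ≤ Q (‖x‖ + ‖y‖)` for all `x`, `y`. -/
def defects (E : Extn 𝕜 X Y) (B : X → E.Z) : Set ℝ :=
  {Q | 0 ≤ Q ∧ ∀ x y w, E.i w = B (x + y) - B x - B y → ‖w‖ ≤ Q * (‖x‖ + ‖y‖)}

/-- `ϱ(i, π) = inf_B sup_{x, y} ‖i⁻¹(B(x + y) - B x - B y)‖ / (‖x‖ + ‖y‖)`, where `B` runs over the
homogeneous bounded sections of `π`. -/
noncomputable def rho (E : Extn 𝕜 X Y) : ℝ :=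
  sInf {r | ∃ B, E.IsSection B ∧ sInf (E.defects B) = r}

theorem defects_nonempty (E : Extn 𝕜 X Y) {B : X → E.Z} (hB : E.IsSection B) :
    (E.defects B).Nonempty := by
  obtain ⟨-, ⟨C, hC⟩, -⟩ := hB
  obtain ⟨D, hD0, hD⟩ := E.i_lower
  obtain ⟨Δ, hΔ, h⟩ := qn_quasi 𝕜 E.Z
  obtain ⟨Δ', hΔ', h'⟩ := qn_quasi 𝕜 X
  have hC' : ∀ x, ‖B x‖ ≤ max C 0 * ‖x‖ := fun x => (hC x).trans (by
    have := qn_nonneg 𝕜 x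
    gcongr
    exact le_max_left _ _)
  have hM : 0 ≤ max C 0 := le_max_right _ _
  set M := max C 0
  refine ⟨D * (Δ * (Δ * (M * Δ' + M) + M)), by positivity, fun x y w hw => ?_⟩
  have hx := qn_nonneg 𝕜 x
  have hy := qn_nonneg 𝕜 y
  have h1 : ‖B (x + y)‖ ≤ M * Δ' * (‖x‖ + ‖y‖) := by
    refine (hC' _).trans ?_
    rw [mul_assoc]
    gcongr
    exact h' x y
  have h2 : ‖B x‖ ≤ M * (‖x‖ + ‖y‖) := (hC' x).trans (by gcongr; linarith)
  have h3 : ‖B y‖ ≤ M * (‖x‖ + ‖y‖) := (hC' y).trans (by gcongr; linarith)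
  have h4 : ‖B (x + y) - B x‖ ≤ Δ * (‖B (x + y)‖ + ‖B x‖) := by
    have := h (B (x + y)) (-B x)
    rwa [qn_neg 𝕜, ← sub_eq_add_neg] at this
  have h5 : ‖B (x + y) - B x - B y‖ ≤ Δ * (‖B (x + y) - B x‖ + ‖B y‖) := by
    have := h (B (x + y) - B x) (-B y)
    rwa [qn_neg 𝕜, ← sub_eq_add_neg] at this
  refine (hD w).trans ?_
  rw [hw, mul_assoc]
  gcongr
  calc _ ≤ _ := h5
    _ ≤ Δ * (Δ * (M * Δ' * (‖x‖ + ‖y‖) + M * (‖x‖ + ‖y‖)) + M * (‖x‖ + ‖y‖)) := by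
        gcongr
        refine h4.trans ?_
        gcongr
    _ = _ := by ring

theorem rho_nonneg (E : Extn 𝕜 X Y) : 0 ≤ E.rho :=
  Real.sInf_nonneg (by rintro _ ⟨B, -, rfl⟩; exact Real.sInf_nonneg fun _ h => h.1)

theorem rho_le (E : Extn 𝕜 X Y) {B : X → E.Z} (hB : E.IsSection B) {Q : ℝ} (hQ : Q ∈ E.defects B) :
    E.rho ≤ Q := by
  have h1 : E.rho ≤ sInf (E.defects B) :=
    csInf_le ⟨0, by rintro _ ⟨B, -, rfl⟩; exact Real.sInf_nonneg fun _ h => h.1⟩ ⟨B, hB, rfl⟩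
  exact h1.trans (csInf_le ⟨0, fun _ h => h.1⟩ hQ)

theorem exists_of_rho_lt (E : Extn 𝕜 X Y) {r : ℝ} (h : E.rho < r) :
    ∃ B, E.IsSection B ∧ ∃ Q ∈ E.defects B, Q < r := by
  have hne : {r | ∃ B, E.IsSection B ∧ sInf (E.defects B) = r}.Nonempty := by
    obtain ⟨B, hB⟩ := exists_section E.π E.surj
    exact ⟨_, B, hB, rfl⟩
  obtain ⟨_, ⟨B, hB, rfl⟩, h2⟩ := exists_lt_of_csInf_lt hne h
  obtain ⟨Q, hQ, h3⟩ := exists_lt_of_csInf_lt (E.defects_nonempty hB) h2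
  exact ⟨B, hB, Q, hQ, h3⟩

theorem Rel.section {f : Op 𝕜 X' X} {g : Op 𝕜 Y Y'} {E : Extn 𝕜 X Y} {E' : Extn 𝕜 X' Y'}
    (h : Rel f g E E') {B : X → E.Z} (hB : E.IsSection B) {Q C D : ℝ} (hQ : Q ∈ E.defects B)
    (hC0 : 0 ≤ C) (hC : ∀ x, ‖f x‖ ≤ C * ‖x‖) (hD0 : 0 ≤ D) (hD : ∀ y, ‖g y‖ ≤ D * ‖y‖) :
    ∃ B', E'.IsSection B' ∧ D * Q * C ∈ E'.defects B' := by
  obtain ⟨T, h1, h2⟩ := h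
  obtain ⟨M, hM0, hM⟩ := T.bound
  obtain ⟨hB1, ⟨N, hN⟩, hB3⟩ := hB
  obtain ⟨hQ0, hQ⟩ := hQ
  have mem : ∀ x, (x, B (f x)) ∈ E.pb f := fun x => (hB3 (f x)).symm
  refine ⟨fun x => T ⟨(x, B (f x)), mem x⟩, ⟨fun c x => ?_, ⟨M * max 1 (max N 0 * C), fun x => ?_⟩,
    fun x => h2 _⟩, by positivity, fun x y w hw => ?_⟩
  · rw [← map_smul]
    refine congrArg T (Subtype.ext (Prod.ext rfl ?_))
    change B (f (c • x)) = c • B (f x)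
    rw [map_smul, hB1]
  · refine (hM _).trans ?_
    rw [mul_assoc]
    gcongr
    have hx := qn_nonneg 𝕜 x
    refine max_le ?_ ?_
    · change ‖x‖ ≤ _
      nlinarith [le_max_left 1 (max N 0 * C)]
    · change ‖B (f x)‖ ≤ _
      calc ‖B (f x)‖ ≤ N * ‖f x‖ := hN _
        _ ≤ max N 0 * (C * ‖x‖) := by
            have := qn_nonneg 𝕜 (f x)
            gcongr
            · exact le_max_left _ _
            · exact hC x
        _ = max N 0 * C * ‖x‖ := by ring
        _ ≤ _ := by gcongr; exact le_max_right _ _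
  · obtain ⟨v, hv⟩ := (E.exact (B (f x + f y) - B (f x) - B (f y))).1 (by
      simp only [map_sub, hB3]; abel)
    have h3 : E'.i w = E'.i (g v) := by
      have hmem : ((0 : X'), E.i v) ∈ E.pb f := by
        change f 0 = _
        rw [π_i, map_zero]
      rw [hw, ← h1 v hmem, ← map_sub, ← map_sub]
      congr 1
      refine Subtype.ext (Prod.ext ?_ ?_)
      · change x + y - x - y = 0
        abel
      · change B (f (x + y)) - B (f x) - B (f y) = E.i v
        rw [map_add, hv]
    rw [E'.inj h3]
    have h4 := hQ _ _ _ hv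
    have h5 := hC x
    have h6 := hC y
    calc ‖g v‖ ≤ D * ‖v‖ := hD v
      _ ≤ D * (Q * (C * ‖x‖ + C * ‖y‖)) := by
          gcongr
          refine h4.trans ?_
          gcongr
      _ = _ := by ring

theorem prod_section {E : Extn 𝕜 X Y} {E' : Extn 𝕜 X' Y'} {B : X → E.Z} {B' : X' → E'.Z}
    (hB : E.IsSection B) (hB' : E'.IsSection B') {Q Q' : ℝ} (hQ : Q ∈ E.defects B)
    (hQ' : Q' ∈ E'.defects B') :
    ∃ B'', (E.prod E').IsSection B'' ∧ Q + Q' ∈ (E.prod E').defects B'' := by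
  obtain ⟨hB1, ⟨N, hN⟩, hB3⟩ := hB
  obtain ⟨hB1', ⟨N', hN'⟩, hB3'⟩ := hB'
  obtain ⟨hQ0, hQ⟩ := hQ
  obtain ⟨hQ0', hQ'⟩ := hQ'
  refine ⟨fun x => (B x.1, B' x.2), ⟨fun c x => Prod.ext (hB1 c x.1) (hB1' c x.2),
    ⟨max N N' ⊔ 0, fun x => ?_⟩, fun x => Prod.ext (hB3 _) (hB3' _)⟩, by positivity,
    fun x y w hw => ?_⟩
  · have h1 := qn_nonneg 𝕜 x.1
    have h2 := qn_nonneg 𝕜 x.2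
    refine max_le ((hN _).trans ?_) ((hN' _).trans ?_)
    · exact mul_le_mul ((le_max_left _ _).trans (le_max_left _ _)) (le_max_left _ _) h1
        (le_max_right _ _)
    · exact mul_le_mul ((le_max_right _ _).trans (le_max_left _ _)) (le_max_right _ _) h2
        (le_max_right _ _)
  · have hx : ‖x.1‖ ≤ ‖x‖ := le_max_left _ _
    have hx' : ‖x.2‖ ≤ ‖x‖ := le_max_right _ _
    have hy : ‖y.1‖ ≤ ‖y‖ := le_max_left _ _
    have hy' : ‖y.2‖ ≤ ‖y‖ := le_max_right _ _
    have h1 := qn_nonneg 𝕜 x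
    have h2 := qn_nonneg 𝕜 y
    have h3 := qn_nonneg 𝕜 x.1
    have h4 := qn_nonneg 𝕜 y.1
    have h5 := qn_nonneg 𝕜 x.2
    have h6 := qn_nonneg 𝕜 y.2
    refine max_le ((hQ x.1 y.1 w.1 (congrArg Prod.fst hw)).trans ?_)
      ((hQ' x.2 y.2 w.2 (congrArg Prod.snd hw)).trans ?_)
    · gcongr
      linarith
    · gcongr
      linarith

theorem split_section : ∃ B, (split 𝕜 X Y).IsSection B ∧ (0 : ℝ) ∈ (split 𝕜 X Y).defects B := by
  refine ⟨fun x => (0, x), ⟨fun c x => Prod.ext (smul_zero c).symm rfl, ⟨1, fun x => ?_⟩,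
    fun x => rfl⟩, le_rfl, fun x y w hw => ?_⟩
  · rw [one_mul]
    refine max_le ?_ le_rfl
    exact (qn_zero 𝕜).trans_le (qn_nonneg 𝕜 x)
  · have h1 : w = (0 : Y) - 0 - 0 := congrArg Prod.fst hw
    rw [h1, sub_zero, sub_zero, qn_zero 𝕜, zero_mul]

end Extn

section Ext

variable {𝕜 : Type} [RCLike 𝕜]
variable {X Y X' Y' X'' Y'' : Type u}
    [AddCommGroup X] [Module 𝕜 X] [Norm X] [QuasiBanach 𝕜 X]
    [AddCommGroup Y] [Module 𝕜 Y] [Norm Y] [QuasiBanach 𝕜 Y]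
    [AddCommGroup X'] [Module 𝕜 X'] [Norm X'] [QuasiBanach 𝕜 X']
    [AddCommGroup Y'] [Module 𝕜 Y'] [Norm Y'] [QuasiBanach 𝕜 Y']
    [AddCommGroup X''] [Module 𝕜 X''] [Norm X''] [QuasiBanach 𝕜 X'']
    [AddCommGroup Y''] [Module 𝕜 Y''] [Norm Y''] [QuasiBanach 𝕜 Y'']

variable (𝕜 X Y) in
/-- `Ext(X, Y)`: extensions of `X` by `Y` modulo equivalence. -/
def Ext : Type (u + 1) := Quotient (Extn.setoid 𝕜 X Y)

namespace Ext

open Extn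

/-- The class of an extension. -/
def mk (E : Extn 𝕜 X Y) : Ext 𝕜 X Y := Quotient.mk (Extn.setoid 𝕜 X Y) E

theorem mk_eq_iff {E E' : Extn 𝕜 X Y} : mk E = mk E' ↔ E.Equivalent E' := Quotient.eq (r := setoid 𝕜 X Y)

theorem exists_rep (c : Ext 𝕜 X Y) : ∃ E, mk E = c := Quotient.exists_rep c

theorem mk_map_eq {f : Op 𝕜 X' X} {g : Op 𝕜 Y Y'} {E : Extn 𝕜 X Y} {E' : Extn 𝕜 X' Y'}
    (h : Rel f g E E') : mk (E.map f g) = mk E' := mk_eq_iff.2 h.equiv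

theorem mk_eq_mk {f f' : Op 𝕜 X' X} {g g' : Op 𝕜 Y Y'} {E : Extn 𝕜 X Y} {E₁ E₂ : Extn 𝕜 X' Y'}
    (h : Rel f g E E₁) (h' : Rel f' g' E E₂) (hf : ∀ x, f x = f' x) (hg : ∀ y, g y = g' y) :
    mk E₁ = mk E₂ := (mk_map_eq (h.cast hf hg)).symm.trans (mk_map_eq h')

/-- Pull-back along `f` and push-out along `g`. -/
noncomputable def map (f : Op 𝕜 X' X) (g : Op 𝕜 Y Y') (c : Ext 𝕜 X Y) : Ext 𝕜 X' Y' :=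
  Quotient.liftOn c (fun E => mk (E.map f g)) fun _ E₂ h =>
    mk_map_eq ((Equivalent.rel h).comp (rel_map E₂ f g))

theorem map_mk (f : Op 𝕜 X' X) (g : Op 𝕜 Y Y') (E : Extn 𝕜 X Y) :
    map f g (mk E) = mk (E.map f g) := rfl

/-- The Baer sum. -/
noncomputable instance : Add (Ext 𝕜 X Y) :=
  ⟨fun c d => Quotient.liftOn₂ c d (fun E E' => mk ((E.prod E').map Op.diag Op.sum))
    fun _ _ E₂ E₂' h h' =>
      mk_map_eq (((Equivalent.rel h).prod (Equivalent.rel h')).comp (rel_map (E₂.prod E₂') Op.diag Op.sum))⟩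

theorem add_mk (E E' : Extn 𝕜 X Y) : mk E + mk E' = mk ((E.prod E').map Op.diag Op.sum) := rfl

/-- Multiplication by a scalar: push-out along the homothety of `Y`. -/
noncomputable instance : SMul 𝕜 (Ext 𝕜 X Y) := ⟨fun a c => map Op.id (a • Op.id) c⟩

theorem smul_mk (a : 𝕜) (E : Extn 𝕜 X Y) : a • mk E = mk (E.map Op.id (a • Op.id)) := rfl

instance : Zero (Ext 𝕜 X Y) := ⟨mk (split 𝕜 X Y)⟩

theorem zero_def : (0 : Ext 𝕜 X Y) = mk (split 𝕜 X Y) := rfl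

theorem rel_add (E E' : Extn 𝕜 X Y) :
    Rel Op.diag Op.sum (E.prod E') ((E.prod E').map Op.diag Op.sum) := rel_map _ _ _

theorem rel_smul (a : 𝕜) (E : Extn 𝕜 X Y) :
    Rel Op.id (a • Op.id) E (E.map Op.id (a • Op.id)) := rel_map _ _ _

/-- Pushing out along zero gives the trivial extension. -/
theorem rel_zero (E : Extn 𝕜 X Y) (f : Op 𝕜 X' X) : Rel f 0 E (split 𝕜 X' Y') :=
  ⟨(0 : Op 𝕜 (E.pb f) Y').pair (Op.fst.comp (Op.incl _)), fun _ _ => rfl, fun _ => rfl⟩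

/-- The class of `(E × E)` along the diagonal of `X` is a push-out of `E`. -/
theorem rel_prod_self {E : Extn 𝕜 X Y} {g : Op 𝕜 (Y × Y) Y'} {E' : Extn 𝕜 X Y'}
    (h : Rel Op.diag g (E.prod E) E') : Rel Op.id (g.comp Op.diag) E E' := by
  obtain ⟨T, h1, h2⟩ := h
  let A : Op 𝕜 (E.pb (Op.id : Op 𝕜 X X)) ((E.prod E).pb Op.diag) := Op.cod ((E.prod E).pb Op.diag)
    ((Op.fst.comp (Op.incl _)).pair ((Op.snd.comp (Op.incl _)).pair (Op.snd.comp (Op.incl _))))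
    fun w => Prod.ext w.2 w.2
  refine ⟨T.comp A, fun y hy => ?_, fun w => h2 _⟩
  exact h1 (y, y) (Prod.ext hy hy)

theorem map_id (c : Ext 𝕜 X Y) : map Op.id Op.id c = c := by
  obtain ⟨E, rfl⟩ := exists_rep c
  exact mk_map_eq (Equivalent.refl E).rel

theorem map_comp (f : Op 𝕜 X' X) (g : Op 𝕜 Y Y') (f' : Op 𝕜 X'' X') (g' : Op 𝕜 Y' Y'')
    (c : Ext 𝕜 X Y) : map f' g' (map f g c) = map (f.comp f') (g'.comp g) c := by
  obtain ⟨E, rfl⟩ := exists_rep c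
  exact mk_eq_mk ((rel_map E f g).comp (rel_map _ f' g')) (rel_map E _ _) (fun _ => rfl)
    fun _ => rfl

theorem map_add (f : Op 𝕜 X' X) (g : Op 𝕜 Y Y') (c d : Ext 𝕜 X Y) :
    map f g (c + d) = map f g c + map f g d := by
  obtain ⟨E, rfl⟩ := exists_rep c
  obtain ⟨E', rfl⟩ := exists_rep d
  exact mk_eq_mk ((rel_add E E').comp (rel_map _ f g))
    (((rel_map E f g).prod (rel_map E' f g)).comp (rel_add _ _)) (fun _ => rfl)
    fun y => _root_.map_add g y.1 y.2

theorem map_smul (f : Op 𝕜 X' X) (g : Op 𝕜 Y Y') (a : 𝕜) (c : Ext 𝕜 X Y) :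
    map f g (a • c) = a • map f g c := by
  obtain ⟨E, rfl⟩ := exists_rep c
  exact mk_eq_mk ((rel_smul a E).comp (rel_map _ f g)) ((rel_map E f g).comp (rel_smul a _))
    (fun _ => rfl) fun y => _root_.map_smul g a y

theorem add_comm' (c d : Ext 𝕜 X Y) : c + d = d + c := by
  obtain ⟨E, rfl⟩ := exists_rep c
  obtain ⟨E', rfl⟩ := exists_rep d
  have swap : Rel (Op.snd.pair Op.fst) (Op.snd.pair Op.fst) (E.prod E') (E'.prod E) := by
    refine ⟨(Op.snd.pair Op.fst).comp (Op.snd.comp (Op.incl _)), fun y hy => rfl, fun w => ?_⟩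
    have := w.2
    exact Prod.ext (congrArg Prod.snd this).symm (congrArg Prod.fst this).symm
  exact mk_eq_mk (rel_add E E') (swap.comp (rel_add E' E)) (fun _ => rfl)
    fun y => add_comm y.1 y.2

theorem add_assoc' (c d e : Ext 𝕜 X Y) : c + d + e = c + (d + e) := by
  obtain ⟨E, rfl⟩ := exists_rep c
  obtain ⟨E', rfl⟩ := exists_rep d
  obtain ⟨E'', rfl⟩ := exists_rep e
  have assoc : Rel ((Op.fst.pair (Op.fst.comp Op.snd)).pair (Op.snd.comp Op.snd))
      ((Op.fst.comp Op.fst).pair ((Op.snd.comp Op.fst).pair Op.snd))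
      ((E.prod E').prod E'') (E.prod (E'.prod E'')) := by
    refine ⟨((Op.fst.comp Op.fst).pair ((Op.snd.comp Op.fst).pair Op.snd)).comp
      (Op.snd.comp (Op.incl _)), fun y hy => rfl, fun w => ?_⟩
    have := w.2
    exact Prod.ext (congrArg (fun x => x.1.1) this).symm
      (Prod.ext (congrArg (fun x => x.1.2) this).symm (congrArg (fun x => x.2) this).symm)
  exact mk_eq_mk (((rel_add E E').prod (Equivalent.refl E'').rel).comp (rel_add _ _))
    (assoc.comp (((Equivalent.refl E).rel.prod (rel_add E' E'')).comp (rel_add _ _))) (fun _ => rfl)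
    fun y => add_assoc y.1.1 y.1.2 y.2

theorem smul_add' (a : 𝕜) (c d : Ext 𝕜 X Y) : a • (c + d) = a • c + a • d :=
  map_add _ _ c d

theorem add_smul' (a b : 𝕜) (c : Ext 𝕜 X Y) : (a + b) • c = a • c + b • c := by
  obtain ⟨E, rfl⟩ := exists_rep c
  refine mk_eq_mk (rel_smul (a + b) E) (rel_prod_self
    ((((rel_smul a E).prod (rel_smul b E)).comp (rel_add _ _)).cast (f' := Op.diag)
      (fun _ => rfl) fun y => rfl)) (fun _ => rfl) fun y => ?_
  exact add_smul a b y

theorem mul_smul' (a b : 𝕜) (c : Ext 𝕜 X Y) : (a * b) • c = a • b • c := by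
  obtain ⟨E, rfl⟩ := exists_rep c
  exact mk_eq_mk (rel_smul (a * b) E) ((rel_smul b E).comp (rel_smul a _)) (fun _ => rfl)
    fun y => mul_smul a b y

theorem one_smul' (c : Ext 𝕜 X Y) : (1 : 𝕜) • c = c := by
  obtain ⟨E, rfl⟩ := exists_rep c
  exact mk_eq_mk (rel_smul 1 E) (Equivalent.refl E).rel (fun _ => rfl) fun y => one_smul 𝕜 y

theorem zero_smul' (c : Ext 𝕜 X Y) : (0 : 𝕜) • c = 0 := by
  obtain ⟨E, rfl⟩ := exists_rep c
  exact mk_eq_mk (rel_smul 0 E) (rel_zero E Op.id) (fun _ => rfl) fun y => zero_smul 𝕜 y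

theorem add_zero' (c : Ext 𝕜 X Y) : c + 0 = c := by
  conv_lhs => rw [← one_smul' c, ← zero_smul' c, ← add_smul']
  rw [add_zero, one_smul']

noncomputable instance : Neg (Ext 𝕜 X Y) := ⟨fun c => (-1 : 𝕜) • c⟩

noncomputable instance : AddCommGroup (Ext 𝕜 X Y) where
  add_assoc := add_assoc'
  add_comm := add_comm'
  add_zero := add_zero'
  zero_add c := by rw [add_comm', add_zero']
  neg_add_cancel c := by
    change (-1 : 𝕜) • c + c = 0
    conv_lhs => rw [← one_smul' c, ← mul_smul', ← add_smul']
    rw [mul_one, neg_add_cancel, zero_smul']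
  nsmul := nsmulRec
  zsmul := zsmulRec

noncomputable instance : Module 𝕜 (Ext 𝕜 X Y) where
  one_smul := one_smul'
  mul_smul := mul_smul'
  smul_zero a := by rw [← zero_smul' (0 : Ext 𝕜 X Y), ← mul_smul', mul_zero]
  smul_add := smul_add'
  add_smul := add_smul'
  zero_smul := zero_smul'

/-- `ϱ` of a class is the infimum of `ϱ(i', π')` over all extensions in the class. -/
noncomputable instance : Norm (Ext 𝕜 X Y) := ⟨fun c => sInf {r | ∃ E, mk E = c ∧ E.rho = r}⟩

theorem norm_mk_le {E : Extn 𝕜 X Y} {B : X → E.Z} (hB : E.IsSection B) {Q : ℝ}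
    (hQ : Q ∈ E.defects B) : ‖mk E‖ ≤ Q := by
  have h1 : ‖mk E‖ ≤ E.rho :=
    csInf_le ⟨0, by rintro _ ⟨E, -, rfl⟩; exact E.rho_nonneg⟩ ⟨E, rfl, rfl⟩
  exact h1.trans (E.rho_le hB hQ)

theorem exists_of_norm_lt (c : Ext 𝕜 X Y) {r : ℝ} (h : ‖c‖ < r) :
    ∃ E, mk E = c ∧ ∃ B, E.IsSection B ∧ ∃ Q ∈ E.defects B, Q < r := by
  have hne : {r | ∃ E, mk E = c ∧ E.rho = r}.Nonempty := by
    obtain ⟨E, hE⟩ := exists_rep c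
    exact ⟨_, E, hE, rfl⟩
  obtain ⟨_, ⟨E, hE, rfl⟩, h2⟩ := exists_lt_of_csInf_lt hne h
  exact ⟨E, hE, E.exists_of_rho_lt h2⟩

theorem norm_map_le (f : Op 𝕜 X' X) (g : Op 𝕜 Y Y') {C D : ℝ}
    (hC0 : 0 ≤ C) (hC : ∀ x, ‖f x‖ ≤ C * ‖x‖) (hD0 : 0 ≤ D) (hD : ∀ y, ‖g y‖ ≤ D * ‖y‖)
    (c : Ext 𝕜 X Y) : ‖map f g c‖ ≤ D * C * ‖c‖ := by
  refine le_of_forall_pos_le_add fun ε hε => ?_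
  have hM : 0 < D * C + 1 := by positivity
  obtain ⟨E, rfl, B, hB, Q, hQ, hlt⟩ :=
    exists_of_norm_lt c (lt_add_of_pos_right ‖c‖ (div_pos hε hM))
  obtain ⟨B', hB', hQ'⟩ := (rel_map E f g).section hB hQ hC0 hC hD0 hD
  have h1 : ‖map f g (mk E)‖ ≤ D * Q * C := norm_mk_le hB' hQ'
  have h2 : D * C * Q ≤ D * C * (‖mk E‖ + ε / (D * C + 1)) := by gcongr
  have h3 : D * C * (ε / (D * C + 1)) ≤ ε := by
    rw [mul_div_assoc', div_le_iff₀ hM]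
    nlinarith
  linarith

instance : SemiQuasiNormed 𝕜 (Ext 𝕜 X Y) where
  nonneg c := Real.sInf_nonneg (by rintro _ ⟨E, -, rfl⟩; exact E.rho_nonneg)
  smul a c := by
    have key : ∀ (a : 𝕜) (c : Ext 𝕜 X Y), ‖a • c‖ ≤ ‖a‖ * ‖c‖ := fun a c => by
      have := norm_map_le (Op.id : Op 𝕜 X X) (a • Op.id : Op 𝕜 Y Y) zero_le_one
        (fun x => (one_mul _).ge) (norm_nonneg a) (fun y => (qn_smul 𝕜 a y).le) c
      rwa [mul_one] at this
    refine le_antisymm (key a c) ?_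
    rcases eq_or_ne a 0 with rfl | ha
    · rw [norm_zero, zero_mul]
      exact Real.sInf_nonneg (by rintro _ ⟨E, -, rfl⟩; exact E.rho_nonneg)
    · have := key a⁻¹ (a • c)
      rw [inv_smul_smul₀ ha, norm_inv, le_inv_mul_iff₀ (norm_pos_iff.2 ha)] at this
      exact this
  quasi := by
    obtain ⟨D, hD0, hD⟩ := (Op.sum : Op 𝕜 (Y × Y) Y).bound
    refine ⟨D, fun c d => le_of_forall_pos_le_add fun ε hε => ?_⟩
    have hM : 0 < 2 * D + 1 := by positivity
    obtain ⟨E, rfl, B, hB, Q, hQ, hlt⟩ :=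
      exists_of_norm_lt c (lt_add_of_pos_right ‖c‖ (div_pos hε hM))
    obtain ⟨E', rfl, B', hB', Q', hQ', hlt'⟩ :=
      exists_of_norm_lt d (lt_add_of_pos_right ‖d‖ (div_pos hε hM))
    obtain ⟨B₁, hB₁, hQ₁⟩ := prod_section hB hB' hQ hQ'
    obtain ⟨B₂, hB₂, hQ₂⟩ := (rel_add E E').section hB₁ hQ₁ zero_le_one
      (fun x => by rw [one_mul]; exact max_le le_rfl le_rfl) hD0 hD
    have h1 : ‖mk E + mk E'‖ ≤ D * (Q + Q') * 1 := norm_mk_le hB₂ hQ₂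
    have h2 : D * (Q + Q') ≤ D * (‖mk E‖ + ε / (2 * D + 1) + (‖mk E'‖ + ε / (2 * D + 1))) := by
      gcongr
    have h3 : D * (ε / (2 * D + 1) + ε / (2 * D + 1)) ≤ ε := by
      rw [← add_div, mul_div_assoc', div_le_iff₀ hM]
      nlinarith
    linarith

/-- Pull-back along `f` and push-out along `g`, as an operator between semi-quasi-normed spaces. -/
noncomputable def mapOp (f : Op 𝕜 X' X) (g : Op 𝕜 Y Y') : Op 𝕜 (Ext 𝕜 X Y) (Ext 𝕜 X' Y') :=
  ⟨{ toFun := map f g, map_add' := map_add f g, map_smul' := map_smul f g }, by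
    obtain ⟨C, hC0, hC⟩ := f.bound
    obtain ⟨D, hD0, hD⟩ := g.bound
    exact ⟨D * C, norm_map_le f g hC0 hC hD0 hD⟩⟩

end Ext
end Ext

/-! ### Quasilinear maps and the space `𝒬(X, Y)` -/

section quasilinear

variable (𝕜 : Type) [RCLike 𝕜] (X Y X' Y' : Type u)
    [AddCommGroup X] [Module 𝕜 X] [Norm X] [AddCommGroup Y] [Module 𝕜 Y] [Norm Y]
    [AddCommGroup X'] [Module 𝕜 X'] [Norm X'] [AddCommGroup Y'] [Module 𝕜 Y'] [Norm Y']

/-- The space of quasilinear maps `X → Y`: homogeneous maps `F` with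
`‖F (x + y) - F x - F y‖ ≤ Q (‖x‖ + ‖y‖)` for some constant `Q`. -/
def quasilinearMaps [SemiQuasiNormed 𝕜 X] [SemiQuasiNormed 𝕜 Y] : Submodule 𝕜 (X → Y) where
  carrier := {F | (∀ (c : 𝕜) x, F (c • x) = c • F x) ∧
    ∃ Q : ℝ, ∀ x y, ‖F (x + y) - F x - F y‖ ≤ Q * (‖x‖ + ‖y‖)}
  zero_mem' := ⟨fun c x => (smul_zero c).symm, 0, fun x y => by simp [qn_zero 𝕜]⟩
  add_mem' := by
    rintro F G ⟨hF, C, hC⟩ ⟨hG, D, hD⟩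
    obtain ⟨Δ, hΔ, h⟩ := qn_quasi 𝕜 Y
    refine ⟨fun c x => ?_, Δ * (C + D), fun x y => ?_⟩
    · simp only [Pi.add_apply, hF, hG, smul_add]
    · have e : (F + G) (x + y) - (F + G) x - (F + G) y
          = (F (x + y) - F x - F y) + (G (x + y) - G x - G y) := by
        simp only [Pi.add_apply]; abel
      rw [e, mul_assoc, add_mul]
      refine (h _ _).trans ?_
      gcongr
      · exact hC x y
      · exact hD x y
  smul_mem' := by
    rintro a F ⟨hF, C, hC⟩
    refine ⟨fun c x => ?_, ‖a‖ * C, fun x y => ?_⟩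
    · simp only [Pi.smul_apply, hF, smul_comm a c]
    · simp only [Pi.smul_apply, ← smul_sub]
      rw [qn_smul 𝕜, mul_assoc]
      gcongr
      exact hC x y

/-- The type of quasilinear maps. -/
def QLin [SemiQuasiNormed 𝕜 X] [SemiQuasiNormed 𝕜 Y] : Type u := quasilinearMaps 𝕜 X Y

variable {𝕜 X Y X' Y'}
variable [SemiQuasiNormed 𝕜 X] [SemiQuasiNormed 𝕜 Y] [SemiQuasiNormed 𝕜 X'] [SemiQuasiNormed 𝕜 Y']

instance : AddCommGroup (QLin 𝕜 X Y) := inferInstanceAs (AddCommGroup (quasilinearMaps 𝕜 X Y))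

instance : Module 𝕜 (QLin 𝕜 X Y) := inferInstanceAs (Module 𝕜 (quasilinearMaps 𝕜 X Y))

instance : CoeFun (QLin 𝕜 X Y) fun _ => X → Y := ⟨fun F => F.1⟩

/-- `Q(F)`, the least `Q ≥ 0` with `‖F (x + y) - F x - F y‖ ≤ Q (‖x‖ + ‖y‖)` for all `x`, `y`. -/
noncomputable instance : Norm (QLin 𝕜 X Y) :=
  ⟨fun F => sInf {Q : ℝ | 0 ≤ Q ∧ ∀ x y, ‖F (x + y) - F x - F y‖ ≤ Q * (‖x‖ + ‖y‖)}⟩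

theorem QLin.norm_nonneg (F : QLin 𝕜 X Y) : 0 ≤ ‖F‖ := Real.sInf_nonneg fun _ h => h.1

theorem QLin.norm_le (F : QLin 𝕜 X Y) {Q : ℝ} (h0 : 0 ≤ Q)
    (h : ∀ x y, ‖F (x + y) - F x - F y‖ ≤ Q * (‖x‖ + ‖y‖)) : ‖F‖ ≤ Q :=
  csInf_le ⟨0, fun _ h => h.1⟩ ⟨h0, h⟩

theorem QLin.le_norm (F : QLin 𝕜 X Y) (x y : X) :
    ‖F (x + y) - F x - F y‖ ≤ ‖F‖ * (‖x‖ + ‖y‖) := by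
  obtain ⟨C, hC⟩ := F.2.2
  have hx := qn_nonneg 𝕜 x
  have hy := qn_nonneg 𝕜 y
  rcases (add_nonneg hx hy).eq_or_lt with h | h
  · have := hC x y
    rw [← h] at this ⊢
    simpa using this
  · rw [← div_le_iff₀ h]
    refine le_csInf ⟨max C 0, le_max_right _ _, fun x y => (hC x y).trans ?_⟩ fun Q hQ => ?_
    · have hx := qn_nonneg 𝕜 x
      have hy := qn_nonneg 𝕜 y
      gcongr
      exact le_max_left _ _
    · rw [div_le_iff₀ h]
      exact hQ.2 x y

instance : SemiQuasiNormed 𝕜 (QLin 𝕜 X Y) where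
  nonneg := QLin.norm_nonneg
  smul c F := by
    have key : ∀ (c : 𝕜) (F : QLin 𝕜 X Y), ‖c • F‖ ≤ ‖c‖ * ‖F‖ := fun c F =>
      QLin.norm_le _ (mul_nonneg (_root_.norm_nonneg c) F.norm_nonneg) fun x y => by
        have e : (c • F) (x + y) - (c • F) x - (c • F) y = c • (F (x + y) - F x - F y) := by
          rw [smul_sub, smul_sub]; rfl
        rw [e, qn_smul 𝕜, mul_assoc]
        gcongr
        exact F.le_norm x y
    refine le_antisymm (key c F) ?_
    rcases eq_or_ne c 0 with rfl | hc
    · rw [norm_zero, zero_mul]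
      exact QLin.norm_nonneg _
    · have := key c⁻¹ (c • F)
      rw [inv_smul_smul₀ hc, norm_inv, le_inv_mul_iff₀ (norm_pos_iff.2 hc)] at this
      exact this
  quasi := by
    obtain ⟨Δ, hΔ, h⟩ := qn_quasi 𝕜 Y
    refine ⟨Δ, fun F G => QLin.norm_le _ ?_ fun x y => ?_⟩
    · have := F.norm_nonneg
      have := G.norm_nonneg
      positivity
    · have e : (F + G) (x + y) - (F + G) x - (F + G) y
          = (F (x + y) - F x - F y) + (G (x + y) - G x - G y) := by
        change F (x + y) + G (x + y) - (F x + G x) - (F y + G y) = _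
        abel
      rw [e, mul_assoc, add_mul]
      refine (h _ _).trans ?_
      gcongr
      · exact F.le_norm x y
      · exact G.le_norm x y

variable (𝕜 X Y) in
/-- Trivial quasilinear maps: sums of a linear map `L` and a bounded homogeneous map `B = F - L`. -/
def trivialMaps : Submodule 𝕜 (QLin 𝕜 X Y) where
  carrier := {F | ∃ L : X →ₗ[𝕜] Y, ∃ C : ℝ, ∀ x, ‖F x - L x‖ ≤ C * ‖x‖}
  zero_mem' := ⟨0, 0, fun x => by
    change ‖(0 : Y) - 0‖ ≤ _
    rw [sub_zero, qn_zero 𝕜, zero_mul]⟩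
  add_mem' := by
    rintro F G ⟨L, C, hC⟩ ⟨M, D, hD⟩
    obtain ⟨Δ, hΔ, h⟩ := qn_quasi 𝕜 Y
    refine ⟨L + M, Δ * (C + D), fun x => ?_⟩
    have e : (F + G) x - (L + M) x = (F x - L x) + (G x - M x) := by
      change F x + G x - (L x + M x) = _
      abel
    rw [e, mul_assoc, add_mul]
    refine (h _ _).trans ?_
    gcongr
    · exact hC x
    · exact hD x
  smul_mem' := by
    rintro a F ⟨L, C, hC⟩
    refine ⟨a • L, ‖a‖ * C, fun x => ?_⟩
    have e : (a • F) x - (a • L) x = a • (F x - L x) := by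
      rw [smul_sub]; rfl
    rw [e, qn_smul 𝕜, mul_assoc]
    gcongr
    exact hC x

variable (𝕜 X Y) in
/-- `𝒬(X, Y)`: quasilinear maps modulo trivial ones. Its quotient semi-quasi-norm is
`Q([F]) = inf {Q(G) : G equivalent to F}`. -/
abbrev QSpace : Type u := QLin 𝕜 X Y ⧸ trivialMaps 𝕜 X Y

/-- The operator `F ↦ g ∘ F ∘ f` between spaces of quasilinear maps. -/
noncomputable def QLin.map (f : Op 𝕜 X' X) (g : Op 𝕜 Y Y') : Op 𝕜 (QLin 𝕜 X Y) (QLin 𝕜 X' Y') :=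
  have key : ∀ (C D : ℝ), 0 ≤ C → 0 ≤ D → (∀ x, ‖f x‖ ≤ C * ‖x‖) → (∀ y, ‖g y‖ ≤ D * ‖y‖) →
      ∀ (F : QLin 𝕜 X Y) x y, ‖g (F (f (x + y))) - g (F (f x)) - g (F (f y))‖
        ≤ (D * C * ‖F‖) * (‖x‖ + ‖y‖) := fun C D hC0 hD0 hC hD F x y => by
    rw [← map_sub, ← map_sub, map_add]
    have h0 := F.norm_nonneg
    calc _ ≤ D * (‖F‖ * (‖f x‖ + ‖f y‖)) := (hD _).trans (by gcongr; exact F.le_norm _ _)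
      _ ≤ D * (‖F‖ * (C * ‖x‖ + C * ‖y‖)) := by
          gcongr
          · exact hC x
          · exact hC y
      _ = _ := by ring
  ⟨{ toFun := fun F => ⟨fun x => g (F (f x)),
        fun c x => (congrArg (fun z => g (F z)) (map_smul f c x)).trans
          ((congrArg g (F.2.1 c (f x))).trans (map_smul g c _)), by
          obtain ⟨C, hC0, hC⟩ := f.bound
          obtain ⟨D, hD0, hD⟩ := g.bound
          exact ⟨_, key C D hC0 hD0 hC hD F⟩⟩
     map_add' := fun F G => Subtype.ext (funext fun x => map_add g _ _)
     map_smul' := fun c F => Subtype.ext (funext fun x => map_smul g _ _) }, by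
    obtain ⟨C, hC0, hC⟩ := f.bound
    obtain ⟨D, hD0, hD⟩ := g.bound
    refine ⟨D * C, fun F => QLin.norm_le _ ?_ (key C D hC0 hD0 hC hD F)⟩
    have := F.norm_nonneg
    positivity⟩

@[simp] theorem QLin.map_apply (f : Op 𝕜 X' X) (g : Op 𝕜 Y Y') (F : QLin 𝕜 X Y) (x : X') :
    QLin.map f g F x = g (F (f x)) := rfl

/-- The operator `[F] ↦ [g ∘ F ∘ f]`. -/
noncomputable def QSpace.map (f : Op 𝕜 X' X) (g : Op 𝕜 Y Y') : Op 𝕜 (QSpace 𝕜 X Y) (QSpace 𝕜 X' Y') :=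
  Op.liftQ _ ((Op.mkQ (trivialMaps 𝕜 X' Y')).comp (QLin.map f g)) (by
    rintro F ⟨L, C, hC⟩
    refine (Submodule.Quotient.mk_eq_zero _).2 ?_
    obtain ⟨D, hD0, hD⟩ := g.bound
    obtain ⟨M, hM0, hM⟩ := f.bound
    refine ⟨g.1 ∘ₗ L ∘ₗ f.1, D * max C 0 * M, fun x => ?_⟩
    change ‖g (F (f x)) - g (L (f x))‖ ≤ _
    rw [← map_sub]
    have := qn_nonneg 𝕜 (f x)
    calc _ ≤ D * (max C 0 * ‖f x‖) := (hD _).trans (by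
            gcongr
            refine (hC _).trans ?_
            gcongr
            exact le_max_left _ _)
      _ ≤ D * (max C 0 * (M * ‖x‖)) := by
          gcongr
          exact hM x
      _ = _ := by ring)

@[simp] theorem QSpace.map_mk (f : Op 𝕜 X' X) (g : Op 𝕜 Y Y') (F : QLin 𝕜 X Y) :
    QSpace.map f g ((trivialMaps 𝕜 X Y).mkQ F) = (trivialMaps 𝕜 X' Y').mkQ (QLin.map f g F) := rfl

theorem QSpace.map_id (c : QSpace 𝕜 X Y) : QSpace.map Op.id Op.id c = c := by
  obtain ⟨F, rfl⟩ := Submodule.mkQ_surjective _ c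
  rfl

theorem QSpace.map_comp {X'' Y'' : Type u} [AddCommGroup X''] [Module 𝕜 X''] [Norm X'']
    [AddCommGroup Y''] [Module 𝕜 Y''] [Norm Y''] [SemiQuasiNormed 𝕜 X''] [SemiQuasiNormed 𝕜 Y'']
    (f : Op 𝕜 X' X) (g : Op 𝕜 Y Y') (f' : Op 𝕜 X'' X') (g' : Op 𝕜 Y' Y'') (c : QSpace 𝕜 X Y) :
    QSpace.map f' g' (QSpace.map f g c) = QSpace.map (f.comp f') (g'.comp g) c := by
  obtain ⟨F, rfl⟩ := Submodule.mkQ_surjective _ c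
  rfl

end quasilinear

/-! ### Relatively projective presentations and the space `Ext^ϖ(X, Y)` -/

section presentation

/-- The space `ℓ_q(I)`. -/
abbrev Ellq (𝕜 : Type) [RCLike 𝕜] (q : ℝ) (I : Type u) : Type u :=
  lp (fun _ : I => 𝕜) (ENNReal.ofReal q)

/-- `E` is `p`-normable: it has an equivalent quasi-norm `N` with
`N (x + y) ^ p ≤ N x ^ p + N y ^ p`. -/
def PNormable (𝕜 : Type) [RCLike 𝕜] (p : ℝ) (E : Type u) [AddCommGroup E] [Module 𝕜 E]
    [Norm E] : Prop :=
  ∃ N : E → ℝ, (∀ x, 0 ≤ N x) ∧ (∀ (c : 𝕜) x, N (c • x) = ‖c‖ * N x) ∧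
    (∀ x y, N (x + y) ^ p ≤ N x ^ p + N y ^ p) ∧
    ∃ a > 0, ∃ b > 0, ∀ x, a * ‖x‖ ≤ N x ∧ N x ≤ b * ‖x‖

/-- A relatively projective presentation of `X` for the couple `(X, Y)`: an operator `ϖ` of
`ℓ_q(I)` onto `X`, where `0 < q < p ≤ 1` and both `X` and `Y` are `p`-normable. -/
structure Presentation (𝕜 : Type) [RCLike 𝕜] (X Y : Type u) [AddCommGroup X] [Module 𝕜 X] [Norm X]
    [AddCommGroup Y] [Module 𝕜 Y] [Norm Y] where
  p : ℝ
  p_le_one : p ≤ 1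
  pNormable_left : PNormable 𝕜 p X
  pNormable_right : PNormable 𝕜 p Y
  q : ℝ
  q_pos : 0 < q
  q_lt : q < p
  I : Type u
  ϖ : Op 𝕜 (Ellq 𝕜 q I) X
  surj : Function.Surjective ϖ

variable {𝕜 : Type} [RCLike 𝕜] {X Y X' Y' : Type u}
    [AddCommGroup X] [Module 𝕜 X] [Norm X] [QuasiBanach 𝕜 X]
    [AddCommGroup Y] [Module 𝕜 Y] [Norm Y] [QuasiBanach 𝕜 Y]
    [AddCommGroup X'] [Module 𝕜 X'] [Norm X'] [QuasiBanach 𝕜 X']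
    [AddCommGroup Y'] [Module 𝕜 Y'] [Norm Y'] [QuasiBanach 𝕜 Y']

namespace Presentation

/-- The space `ℓ_q(I)` of the presentation. -/
abbrev L (P : Presentation 𝕜 X Y) : Type u := Ellq 𝕜 P.q P.I

instance (P : Presentation 𝕜 X Y) : SemiQuasiNormed 𝕜 P.L :=
  lp_semiQuasiNormed 𝕜 P.I P.q_pos (P.q_lt.trans_le P.p_le_one)

/-- The kernel `K` of `ϖ`. -/
noncomputable def K (P : Presentation 𝕜 X Y) : Submodule 𝕜 P.L := LinearMap.ker P.ϖ.1

theorem mem_K (P : Presentation 𝕜 X Y) {z : P.L} : z ∈ P.K ↔ P.ϖ z = 0 := Iff.rfl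

/-- The operators `K → Y` which are restrictions of operators `ℓ_q(I) → Y`. -/
noncomputable def restrictions (P : Presentation 𝕜 X Y) : Submodule 𝕜 (Op 𝕜 P.K Y) where
  carrier := {u | ∃ v : Op 𝕜 P.L Y, ∀ k : P.K, u k = v k}
  zero_mem' := ⟨0, fun _ => rfl⟩
  add_mem' := by
    rintro u u' ⟨v, h⟩ ⟨v', h'⟩
    exact ⟨v + v', fun k => by rw [Op.add_apply, Op.add_apply, h, h']⟩
  smul_mem' := by
    rintro c u ⟨v, h⟩
    exact ⟨c • v, fun k => by rw [Op.smul_apply, Op.smul_apply, h]⟩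

/-- `Ext^ϖ(X, Y) = 𝔏(K, Y) / {restrictions of operators ℓ_q(I) → Y}`. Its quotient semi-quasi-norm is
`|[u]|_ϖ = inf {‖u - v|_K‖ : v ∈ 𝔏(ℓ_q(I), Y)}`. -/
abbrev ExtPi (P : Presentation 𝕜 X Y) : Type u := Op 𝕜 P.K Y ⧸ P.restrictions

/-- The class `[u]`. -/
noncomputable def cls (P : Presentation 𝕜 X Y) (u : Op 𝕜 P.K Y) : P.ExtPi := P.restrictions.mkQ u

/-- The space `{(z', z) : ϖ z = f (ϖ' z')}`, the pull-back of `ϖ` and `f ∘ ϖ'`. -/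
noncomputable def fiber (P : Presentation 𝕜 X Y) (P' : Presentation 𝕜 X' Y') (f : Op 𝕜 X' X) :
    Submodule 𝕜 (P'.L × P.L) where
  carrier := {w | P.ϖ w.2 = f (P'.ϖ w.1)}
  zero_mem' := by simp
  add_mem' := by
    intro a b (ha : P.ϖ a.2 = _) (hb : P.ϖ b.2 = _)
    change P.ϖ (a.2 + b.2) = f (P'.ϖ (a.1 + b.1))
    rw [map_add, map_add, map_add, ha, hb]
  smul_mem' := by
    intro c a (ha : P.ϖ a.2 = _)
    change P.ϖ (c • a.2) = f (P'.ϖ (c • a.1))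
    rw [map_smul, map_smul, map_smul, ha]

/-- The graph of the action of the functor `Ext^ϖ` on a pair of operators `f : X' → X`,
`g : Y → Y'`, computed with the presentations `P` of `(X, Y)` and `P'` of `(X', Y')`: the operators
`u : K → Y` and `u' : K' → Y'` are related when `(k', k) ↦ u' k' - g (u k)` extends from `K' × K` to
an operator on `{(z', z) : ϖ z = f (ϖ' z')}`. If `f ∘ ϖ'` lifts to `φ : ℓ_{q'}(I') → ℓ_q(I)`, then
the operator related to `u` is `g ∘ u ∘ φ|_{K'}`, see `induces_of_lift`; such a lifting exists when
`q' ≤ q`, but the exponents of the two presentations may come in any order. -/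
def Induces (P : Presentation 𝕜 X Y) (P' : Presentation 𝕜 X' Y') (f : Op 𝕜 X' X) (g : Op 𝕜 Y Y')
    (u : Op 𝕜 P.K Y) (u' : Op 𝕜 P'.K Y') : Prop :=
  ∃ W : Op 𝕜 (P.fiber P' f) Y', ∀ (k' : P'.K) (k : P.K) (h : ((k' : P'.L), (k : P.L)) ∈ P.fiber P' f),
    W ⟨(k', k), h⟩ = u' k' - g (u k)

theorem induces_of_lift (P : Presentation 𝕜 X Y) (P' : Presentation 𝕜 X' Y') (f : Op 𝕜 X' X)
    (g : Op 𝕜 Y Y') (u : Op 𝕜 P.K Y) (φ : Op 𝕜 P'.L P.L) (hφ : ∀ z, P.ϖ (φ z) = f (P'.ϖ z)) :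
    P.Induces P' f g u ((g.comp u).comp (Op.cod P.K (φ.comp (Op.incl P'.K)) fun k => by
      rw [mem_K, Op.comp_apply, hφ]
      exact (congrArg f k.2).trans (map_zero f))) := by
  let D : Op 𝕜 (P.fiber P' f) P.K := Op.cod P.K
    ((φ.comp (Op.fst.comp (Op.incl _))) - (Op.snd.comp (Op.incl _))) fun w => by
      have h : P.ϖ w.1.2 = f (P'.ϖ w.1.1) := w.2
      change P.ϖ (φ w.1.1 - w.1.2) = 0
      rw [map_sub, hφ, h, sub_self]
  refine ⟨(g.comp u).comp D, fun k' k h => ?_⟩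
  rw [Op.comp_apply, Op.comp_apply, Op.comp_apply, Op.comp_apply, ← map_sub, ← map_sub]
  rfl

end Presentation

end presentation

/-! ### Categories and functors -/

section categories

/-- Semi-quasi-normed spaces over `𝕜`. -/
structure SQNSp (𝕜 : Type) [RCLike 𝕜] : Type (v + 1) where
  carrier : Type v
  [grp : AddCommGroup carrier]
  [mod : Module 𝕜 carrier]
  [nrm : Norm carrier]
  [sqn : SemiQuasiNormed 𝕜 carrier]

attribute [instance] SQNSp.grp SQNSp.mod SQNSp.nrm SQNSp.sqn

variable (𝕜 : Type) [RCLike 𝕜]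

instance : CoeSort (SQNSp.{v} 𝕜) (Type v) := ⟨SQNSp.carrier⟩

/-- Morphisms of semi-quasi-normed spaces are the operators. -/
structure SQNSp.Hom (E F : SQNSp.{v} 𝕜) where
  toOp : Op 𝕜 E F

instance : Category (SQNSp.{v} 𝕜) where
  Hom E F := SQNSp.Hom 𝕜 E F
  id _ := ⟨Op.id⟩
  comp S T := ⟨T.toOp.comp S.toOp⟩

/-- Complete semi-quasi-normed spaces. -/
def isComplete : ObjectProperty (SQNSp.{v} 𝕜) := fun E => IsCompleteQN E

/-- Quasi-Banach spaces. -/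
def isQuasiBanach : ObjectProperty (SQNSp.{v} 𝕜) := fun E => QuasiBanach 𝕜 E

/-- The category of semi-quasi-Banach spaces and operators. Its isomorphisms are the linear
homeomorphisms. -/
abbrev SQBan := (isComplete.{v} 𝕜).FullSubcategory

/-- The category of quasi-Banach spaces and operators. -/
abbrev QBan := (isQuasiBanach.{v} 𝕜).FullSubcategory

instance : CoeSort (QBan.{v} 𝕜) (Type v) := ⟨fun E => E.obj.carrier⟩

instance (E : QBan.{v} 𝕜) : QuasiBanach 𝕜 E := E.property

variable {𝕜}

/-- The operator underlying a morphism of quasi-Banach spaces. -/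
def toOp {E F : QBan.{v} 𝕜} (f : E ⟶ F) : Op 𝕜 E F := f.hom.toOp

instance {E : Type u} [AddCommGroup E] [Module 𝕜 E] [Norm E] [SemiQuasiNormed 𝕜 E] :
    SemiQuasiNormed 𝕜 (ULift.{w} E) where
  nonneg x := qn_nonneg 𝕜 x.down
  smul c x := qn_smul 𝕜 c x.down
  quasi := by
    obtain ⟨Δ, -, h⟩ := qn_quasi 𝕜 E
    exact ⟨Δ, fun x y => h x.down y.down⟩

/-- A copy of an operator in a larger universe. -/
def Op.ulift {E F : Type u} [AddCommGroup E] [Module 𝕜 E] [Norm E] [AddCommGroup F] [Module 𝕜 F]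
    [Norm F] (T : Op 𝕜 E F) : Op 𝕜 (ULift.{w} E) (ULift.{w} F) :=
  ⟨ULift.moduleEquiv.symm.toLinearMap ∘ₗ T.1 ∘ₗ ULift.moduleEquiv.toLinearMap,
    T.2.imp fun _ h x => h x.down⟩

variable (𝕜)

/-- A quasi-Banach space in `Type u` has its extensions by another one in `Type (u + 1)`; this
functor copies `𝒬(X, Y)` and `Ext^ϖ(X, Y)` to that universe. -/
def uliftFunctor : SQNSp.{u} 𝕜 ⥤ SQNSp.{u + 1} 𝕜 where
  obj E := ⟨ULift.{u + 1} E⟩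
  map T := ⟨T.toOp.ulift⟩

/-- The functor `Ext`, contravariant in `X` and covariant in `Y`. -/
noncomputable def extFunctor : (QBan.{u} 𝕜)ᵒᵖ × QBan.{u} 𝕜 ⥤ SQNSp.{u + 1} 𝕜 where
  obj A := ⟨Ext 𝕜 A.1.unop A.2⟩
  map φ := ⟨Ext.mapOp (toOp φ.1.unop) (toOp φ.2)⟩
  map_id _ := congrArg SQNSp.Hom.mk (Op.ext fun c => Ext.map_id c)
  map_comp φ ψ := congrArg SQNSp.Hom.mk (Op.ext fun c =>
    (Ext.map_comp (toOp φ.1.unop) (toOp φ.2) (toOp ψ.1.unop) (toOp ψ.2) c).symm)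

/-- The functor `𝒬`, with action `[F] ↦ [g ∘ F ∘ f]`. -/
noncomputable def qFunctor : (QBan.{u} 𝕜)ᵒᵖ × QBan.{u} 𝕜 ⥤ SQNSp.{u} 𝕜 where
  obj A := ⟨QSpace 𝕜 A.1.unop A.2⟩
  map φ := ⟨QSpace.map (toOp φ.1.unop) (toOp φ.2)⟩
  map_id _ := congrArg SQNSp.Hom.mk (Op.ext fun c => QSpace.map_id c)
  map_comp φ ψ := congrArg SQNSp.Hom.mk (Op.ext fun c =>
    (QSpace.map_comp (toOp φ.1.unop) (toOp φ.2) (toOp ψ.1.unop) (toOp ψ.2) c).symm)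

variable {𝕜}

/-- The action of `Ext^ϖ` on morphisms, for a choice of presentations for all couples: operators
`Ext^ϖ(X, Y) → Ext^ϖ(X', Y')` whose graph is given by `Presentation.Induces`, and which respect
identities and compositions. -/
structure ExtPiAction (pres : ∀ X Y : QBan.{u} 𝕜, Presentation 𝕜 X Y) where
  map : ∀ {X X' Y Y' : QBan.{u} 𝕜}, (X' ⟶ X) → (Y ⟶ Y') →
    Op 𝕜 (pres X Y).ExtPi (pres X' Y').ExtPi
  map_cls_iff : ∀ {X X' Y Y' : QBan.{u} 𝕜} (f : X' ⟶ X) (g : Y ⟶ Y') (u : Op 𝕜 (pres X Y).K Y)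
    (u' : Op 𝕜 (pres X' Y').K Y'), map f g ((pres X Y).cls u) = (pres X' Y').cls u' ↔
      (pres X Y).Induces (pres X' Y') (toOp f) (toOp g) u u'
  map_id : ∀ X Y : QBan.{u} 𝕜, map (𝟙 X) (𝟙 Y) = Op.id
  map_comp : ∀ {X X' X'' Y Y' Y'' : QBan.{u} 𝕜} (f : X' ⟶ X) (g : Y ⟶ Y') (f' : X'' ⟶ X')
    (g' : Y' ⟶ Y''), map (f' ≫ f) (g ≫ g') = (map f' g').comp (map f g)

/-- The functor `Ext^ϖ`. -/
noncomputable def extPiFunctor {pres : ∀ X Y : QBan.{u} 𝕜, Presentation 𝕜 X Y}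
    (S : ExtPiAction pres) : (QBan.{u} 𝕜)ᵒᵖ × QBan.{u} 𝕜 ⥤ SQNSp.{u} 𝕜 where
  obj A := ⟨(pres A.1.unop A.2).ExtPi⟩
  map φ := ⟨S.map φ.1.unop φ.2⟩
  map_id _ := congrArg SQNSp.Hom.mk (S.map_id _ _)
  map_comp _ _ := congrArg SQNSp.Hom.mk (S.map_comp _ _ _ _)

end categories

end QuasiExt

open QuasiExt

/-!
Everything is compared with `Ext`.

An extension `0 → Y → Z → X → 0` has a bounded homogeneous section `B` and a linear section `L`, and
`F = i⁻¹ (B - L)` is a quasilinear map `X → Y`; say that `F` represents the extension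
(`Extn.Realizes`). The defect of `F` is that of `B`, another choice of `B` and `L` changes `F` by a
trivial map, two extensions represented by the same `F` are equivalent, and every `F` represents its
twisted sum `Twisted F`. Pull-backs, push-outs and products of extensions correspond to composition and
products of quasilinear maps (`Extn.Rel.realizes`, `Extn.Realizes.prod`). So the class of `F` defines a
natural isometry from `Ext(X, Y)` onto `𝒬(X, Y)` (`Ext.equivQ`).

For a presentation with kernel `K`, the push-out of `0 → K → ℓ_q(I) → X → 0` along `u : K → Y` defines a
bounded linear map from `𝔏(K, Y)` to `Ext(X, Y)`, and the push-out splits exactly when `u` extends to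
`ℓ_q(I)`. What remains is that every class of small norm is a push-out along an operator of controlled
norm (`Presentation.exists_toExt_eq`). Here `q < p` enters, through Kalton's estimate
`exists_norm_map_sum_sub_le`: a quasilinear map `F` with constant one satisfies
`‖F (∑ x_j) - ∑ F x_j‖ ≤ C (∑ ‖x_j‖ ^ q) ^ (1 / q)`. This makes `ϖ` lift to an operator from `ℓ_q(I)` to
the twisted sum by `F`, with a bound depending only on the presentation, and `u` is the restriction of
this lift to `K`. Therefore `Ext^ϖ(X, Y)` and `Ext(X, Y)` are linearly homeomorphic. The former is a
quotient of `𝔏(K, Y)`, hence complete, and so are `Ext(X, Y)` and `𝒬(X, Y)`.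

The action of `Ext^ϖ` on operators is defined by transport from `Ext`, which makes it functorial and the
equivalence natural. Its graph is the prescribed one (`Presentation.map_toExt_eq_iff`): operators
related to the same `u` differ by a restriction, because the projection of the fibre product onto
`ℓ_{q'}(I')` is open.

Presentations exist by the theorem of Aoki and Rolewicz (`pNormable_of_quasi`). This theorem and Kalton's
estimate both follow from one bound for functions of finite sets, `split_bound`, proved by repeatedly
splitting a finite sum into two parts of comparable mass.
-/

namespace QuasiExt

/-! ### Balanced splittings of finite sums -/

/-- If no term exceeds a third of the total, a subset of least cardinality carrying at least a third
of the total carries at most two thirds of it. -/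
theorem exists_balanced_subset {ι : Type*} (s : Finset ι) (a : ι → ℝ)
    (hS : 0 < ∑ j ∈ s, a j) (hsmall : ∀ j ∈ s, 3 * a j ≤ ∑ j ∈ s, a j) :
    ∃ t ⊆ s, ∑ j ∈ s, a j ≤ 3 * ∑ j ∈ t, a j ∧ 3 * ∑ j ∈ t, a j ≤ 2 * ∑ j ∈ s, a j := by
  classical
  obtain ⟨t, ht, hmin⟩ := Finset.exists_min_image
    (s.powerset.filter fun t => ∑ j ∈ s, a j ≤ 3 * ∑ j ∈ t, a j) Finset.card
    ⟨s, by simp; linarith⟩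
  rw [Finset.mem_filter, Finset.mem_powerset] at ht
  refine ⟨t, ht.1, ht.2, ?_⟩
  have hne : t.Nonempty := by
    rw [Finset.nonempty_iff_ne_empty]
    rintro rfl
    simp at ht
    linarith
  obtain ⟨j, hj⟩ := hne
  have h1 : 3 * ∑ i ∈ t.erase j, a i < ∑ j ∈ s, a j := by
    by_contra! h
    have := hmin (t.erase j) (by
      rw [Finset.mem_filter, Finset.mem_powerset]
      exact ⟨(Finset.erase_subset _ _).trans ht.1, h⟩)
    have h2 := Finset.card_erase_lt_of_mem hj
    omega
  have h2 := Finset.add_sum_erase t a hj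
  have h3 := hsmall j (ht.1 hj)
  linarith

/-- A bound for functions of finite sets that are almost additive on disjoint unions. If `D (s ∪ t)` is
at most `κ (D s + D t)` up to an error `c S ^ r`, where `S` is the total mass of `s ∪ t`, then `D` itself
is bounded by a multiple of `S ^ r`, provided that `r` is large enough for `κ (2 / 3) ^ (r - 1) < 1`.
The proof splits a set into two parts having each at most two thirds of the mass, or splits off a
single element having more than a third of it. -/
theorem split_bound {ι : Type*} {D : Finset ι → ℝ} {a : ι → ℝ} {κ c r θ : ℝ} (ha : ∀ j, 0 ≤ a j)
    (hκ : 0 ≤ κ) (hc : 0 ≤ c) (hr : 1 ≤ r) (hθ : κ * (2 / 3) ^ (r - 1) ≤ θ) (hθ1 : θ < 1)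
    (hzero : ∀ s, (∀ j ∈ s, a j = 0) → D s ≤ 0) (hsing : ∀ j, D {j} ≤ c * a j ^ r)
    (hsplit : ∀ s t, Disjoint s t → ∀ (_ : DecidableEq ι),
      D (s ∪ t) ≤ κ * (D s + D t) + c * (∑ j ∈ s ∪ t, a j) ^ r) (s : Finset ι) :
    D s ≤ (κ + 1) * c / (1 - θ) * (∑ j ∈ s, a j) ^ r := by
  classical
  set M := (κ + 1) * c / (1 - θ) with hM
  have h1θ : 0 < 1 - θ := by linarith
  have hM0 : 0 ≤ M := by positivity
  have hMe : (κ + 1) * c = (1 - θ) * M := by rw [hM]; field_simp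
  have hr' : r ≠ 0 := by linarith
  -- the gain from a part of at most two thirds of the total mass
  have gain : ∀ A S : ℝ, 0 ≤ A → 0 < S → 3 * A ≤ 2 * S → A ^ r ≤ (2 / 3) ^ (r - 1) * S ^ (r - 1) * A := by
    intro A S hA hS h
    have e : A ^ r = A ^ (r - 1) * A := by
      rcases hA.eq_or_lt with rfl | hA
      · rw [mul_zero, Real.zero_rpow hr']
      · rw [Real.rpow_sub_one hA.ne', div_mul_cancel₀ _ hA.ne']
    rw [e, ← Real.mul_rpow (by norm_num) hS.le]
    gcongr
    linarith
  induction s using Finset.strongInduction with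
  | H s ih =>
  set S := ∑ j ∈ s, a j with hSdef
  have hS0 : 0 ≤ S := Finset.sum_nonneg fun j _ => ha j
  rcases hS0.eq_or_lt with hS | hS
  · rw [← hS, Real.zero_rpow hr', mul_zero]
    exact hzero s ((Finset.sum_eq_zero_iff_of_nonneg fun j _ => ha j).1 hS.symm)
  have hSr : S ^ r = S ^ (r - 1) * S := by
    rw [Real.rpow_sub_one hS.ne', div_mul_cancel₀ _ hS.ne']
  have hSp : 0 < S ^ (r - 1) := by positivity
  have hSpr : 0 < S ^ r := by positivity
  by_cases hbig : ∀ j ∈ s, 3 * a j ≤ S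
  · obtain ⟨t, hts, h1, h2⟩ := exists_balanced_subset s a hS hbig
    have hsum : ∑ j ∈ s \ t, a j + ∑ j ∈ t, a j = S := Finset.sum_sdiff hts
    have hA0 : 0 ≤ ∑ j ∈ t, a j := Finset.sum_nonneg fun j _ => ha j
    have hB0 : 0 ≤ ∑ j ∈ s \ t, a j := Finset.sum_nonneg fun j _ => ha j
    have ht : t ⊂ s := hts.ssubset_of_ne (by rintro rfl; linarith)
    have ht' : s \ t ⊂ s := Finset.sdiff_subset.ssubset_of_ne (by
      intro h; rw [h] at hsum; linarith)
    have i1 := ih t ht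
    have i2 := ih _ ht'
    have h3 := hsplit (s \ t) t Finset.sdiff_disjoint inferInstance
    rw [Finset.sdiff_union_of_subset hts] at h3
    have g1 := gain _ S hA0 hS h2
    have g2 := gain _ S hB0 hS (by linarith)
    have h4 : D (s \ t) + D t ≤ M * ((2 / 3) ^ (r - 1) * S ^ r) := by
      calc _ ≤ M * (∑ j ∈ s \ t, a j) ^ r + M * (∑ j ∈ t, a j) ^ r := add_le_add i2 i1
        _ ≤ M * ((2 / 3) ^ (r - 1) * S ^ (r - 1) * ∑ j ∈ s \ t, a j)
            + M * ((2 / 3) ^ (r - 1) * S ^ (r - 1) * ∑ j ∈ t, a j) := by gcongr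
        _ = M * ((2 / 3) ^ (r - 1) * (S ^ (r - 1) * (∑ j ∈ s \ t, a j + ∑ j ∈ t, a j))) := by ring
        _ = _ := by rw [hsum, ← hSr]
    calc D s ≤ κ * (D (s \ t) + D t) + c * S ^ r := h3
      _ ≤ κ * (M * ((2 / 3) ^ (r - 1) * S ^ r)) + (κ + 1) * c * S ^ r := by
          gcongr
          nlinarith
      _ = κ * (2 / 3) ^ (r - 1) * (M * S ^ r) + (1 - θ) * M * S ^ r := by rw [hMe]; ring
      _ ≤ θ * (M * S ^ r) + (1 - θ) * M * S ^ r := by gcongr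
      _ = M * S ^ r := by ring
  · push Not at hbig
    obtain ⟨j, hj, hjS⟩ := hbig
    have hsum := Finset.add_sum_erase s a hj
    have hB0 : 0 ≤ ∑ i ∈ s.erase j, a i := Finset.sum_nonneg fun j _ => ha j
    have i2 := ih _ (Finset.erase_ssubset hj)
    have h3 := hsplit {j} (s.erase j) (by simp) inferInstance
    rw [← Finset.insert_eq, Finset.insert_erase hj] at h3
    have g2 := gain _ S hB0 hS (by linarith)
    have hjr : a j ^ r ≤ S ^ r := Real.rpow_le_rpow (ha j) (by linarith) (by linarith)
    have h4 : D (s.erase j) ≤ M * ((2 / 3) ^ (r - 1) * S ^ r) := by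
      calc _ ≤ M * (∑ i ∈ s.erase j, a i) ^ r := i2
        _ ≤ M * ((2 / 3) ^ (r - 1) * S ^ (r - 1) * ∑ i ∈ s.erase j, a i) := by gcongr
        _ ≤ M * ((2 / 3) ^ (r - 1) * S ^ (r - 1) * S) := by
            gcongr
            have := ha j
            linarith
        _ = _ := by rw [hSr]; ring
    have h5 : D {j} ≤ c * S ^ r := (hsing j).trans (by gcongr)
    calc D s ≤ κ * (D {j} + D (s.erase j)) + c * S ^ r := h3
      _ ≤ κ * (c * S ^ r + M * ((2 / 3) ^ (r - 1) * S ^ r)) + c * S ^ r := by gcongr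
      _ = κ * (2 / 3) ^ (r - 1) * (M * S ^ r) + (κ + 1) * c * S ^ r := by ring
      _ ≤ θ * (M * S ^ r) + (1 - θ) * M * S ^ r := by rw [hMe]; gcongr
      _ = M * S ^ r := by ring

/-! ### Unconditional sums in quasi-Banach spaces -/

section sums

variable {𝕜 : Type} [RCLike 𝕜] {E : Type*} {F : Type*} [AddCommGroup E] [Module 𝕜 E] [Norm E]
  [AddCommGroup F] [Module 𝕜 F] [Norm F]

/-- The family `v` sums unconditionally to `w`: the finite partial sums converge to `w` along the
directed set of finite subsets of the index set. -/
def SumsTo {ι : Type*} (v : ι → E) (w : E) : Prop :=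
  Tendsto (fun s : Finset ι => ‖w - ∑ i ∈ s, v i‖) atTop (𝓝 0)

variable {ι : Type*}

variable (𝕜) in
theorem SumsTo.unique [QuasiBanach 𝕜 E] {v : ι → E} {w w' : E} (h : SumsTo v w)
    (h' : SumsTo v w') : w = w' := by
  obtain ⟨Δ, -, hΔ⟩ := qn_quasi 𝕜 E
  have hl : Tendsto (fun s : Finset ι => Δ * (‖w - ∑ i ∈ s, v i‖ + ‖w' - ∑ i ∈ s, v i‖)) atTop
      (𝓝 0) := by simpa using (h.add h').const_mul Δ
  have : ‖w - w'‖ ≤ 0 := ge_of_tendsto' hl fun s => by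
    rw [qn_sub_comm 𝕜 w' (∑ i ∈ s, v i)]
    exact qn_sub_le 𝕜 hΔ _ _ _
  exact sub_eq_zero.1 (QuasiBanach.eq_zero (𝕜 := 𝕜) _ (le_antisymm this (qn_nonneg 𝕜 _)))

variable (𝕜) in
theorem SumsTo.add [SemiQuasiNormed 𝕜 E] {v v' : ι → E} {w w' : E} (h : SumsTo v w)
    (h' : SumsTo v' w') : SumsTo (fun i => v i + v' i) (w + w') := by
  obtain ⟨Δ, -, hΔ⟩ := qn_quasi 𝕜 E
  refine squeeze_zero (fun _ => qn_nonneg 𝕜 _) (fun s => ?_)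
    (by simpa using (Tendsto.add h h').const_mul Δ)
  rw [Finset.sum_add_distrib, add_sub_add_comm]
  exact hΔ _ _

theorem SumsTo.map [SemiQuasiNormed 𝕜 F] (T : Op 𝕜 E F) {v : ι → E} {w : E} (h : SumsTo v w) :
    SumsTo (fun i => T (v i)) (T w) := by
  obtain ⟨C, hC⟩ := T.2
  refine squeeze_zero (fun _ => qn_nonneg 𝕜 _) (fun s => ?_) (by simpa using h.const_mul C)
  rw [← map_sum, ← map_sub]
  exact hC _

theorem SumsTo.const_smul [SemiQuasiNormed 𝕜 E] (c : 𝕜) {v : ι → E} {w : E} (h : SumsTo v w) :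
    SumsTo (fun i => c • v i) (c • w) := by
  have := h.map (c • Op.id : Op 𝕜 E E)
  simpa only [Op.smul_apply, Op.id_apply] using this

variable (𝕜) in
theorem SumsTo.norm_le [SemiQuasiNormed 𝕜 E] {Δ : ℝ}
    (hΔ : ∀ x y : E, ‖x + y‖ ≤ Δ * (‖x‖ + ‖y‖)) {v : ι → E} {w : E} (h : SumsTo v w) {M : ℝ}
    (hΔ0 : 0 ≤ Δ) (hM : ∀ s, ‖∑ i ∈ s, v i‖ ≤ M) : ‖w‖ ≤ Δ * M := by
  have hl : Tendsto (fun s : Finset ι => Δ * (‖w - ∑ i ∈ s, v i‖ + M)) atTop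
      (𝓝 (Δ * M)) := by simpa using (Tendsto.add_const M h).const_mul Δ
  refine ge_of_tendsto' hl fun s => ?_
  have := hΔ (w - ∑ i ∈ s, v i) (∑ i ∈ s, v i)
  rw [sub_add_cancel] at this
  refine this.trans ?_
  gcongr
  exact hM s

variable (𝕜) in
/-- Cauchy's criterion. -/
theorem exists_sumsTo [SemiQuasiNormed 𝕜 E] (hE : IsCompleteQN E) (v : ι → E)
    (hv : ∀ ε > 0, ∃ s : Finset ι, ∀ t, Disjoint t s → ‖∑ i ∈ t, v i‖ < ε) : ∃ w, SumsTo v w := by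
  classical
  obtain ⟨Δ, hΔ1, hΔ⟩ := qn_quasi 𝕜 E
  choose s hs using fun n : ℕ => hv (1 / ((n : ℝ) + 1)) Nat.one_div_pos_of_nat
  have key : ∀ (N : ℕ) (t : Finset ι), s N ⊆ t →
      ‖∑ i ∈ t, v i - ∑ i ∈ s N, v i‖ < 1 / ((N : ℝ) + 1) := fun N t h => by
    rw [← Finset.sum_sdiff h, add_sub_cancel_right]
    exact hs N _ Finset.sdiff_disjoint
  have key2 : ∀ (N : ℕ) (t t' : Finset ι), s N ⊆ t → s N ⊆ t' →
      ‖∑ i ∈ t, v i - ∑ i ∈ t', v i‖ ≤ Δ * (1 / ((N : ℝ) + 1) + 1 / ((N : ℝ) + 1)) :=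
    fun N t t' h h' => by
      refine (qn_sub_le 𝕜 hΔ _ (∑ i ∈ s N, v i) _).trans ?_
      rw [qn_sub_comm 𝕜 (∑ i ∈ s N, v i)]
      gcongr
      · exact (key N t h).le
      · exact (key N t' h').le
  have hlim : Tendsto (fun N : ℕ => Δ * (1 / ((N : ℝ) + 1) + 1 / ((N : ℝ) + 1))) atTop (𝓝 0) := by
    have := tendsto_one_div_add_atTop_nhds_zero_nat (𝕜 := ℝ)
    simpa using (this.add this).const_mul Δ
  let t : ℕ → Finset ι := fun n => (Finset.range (n + 1)).biUnion s
  have ht : ∀ N n, N ≤ n → s N ⊆ t n := fun N n h =>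
    Finset.subset_biUnion_of_mem s (Finset.mem_range.2 (by omega))
  obtain ⟨w, hw⟩ := hE (fun n => ∑ i ∈ t n, v i) (fun ε hε => by
    obtain ⟨N, hN⟩ := ((tendsto_order.1 hlim).2 ε hε).exists
    exact ⟨N, fun m hm n hn => (key2 N _ _ (ht N m hm) (ht N n hn)).trans_lt hN⟩)
  refine ⟨w, ?_⟩
  refine tendsto_order.2 ⟨fun a ha => Eventually.of_forall fun _ => ha.trans_le (qn_nonneg 𝕜 _),
    fun ε hε => ?_⟩
  have hΔ0 : 0 < Δ := by linarith
  have e1 := (tendsto_order.1 hlim).2 (ε / (2 * Δ)) (by positivity)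
  obtain ⟨N, hN⟩ := e1.exists
  have e2 := (tendsto_order.1 hw).2 (ε / (2 * Δ)) (by positivity)
  obtain ⟨n, hn, hNn⟩ := (e2.and (eventually_ge_atTop N)).exists
  filter_upwards [eventually_ge_atTop (s N)] with u hu
  have h1 := qn_sub_le 𝕜 hΔ w (∑ i ∈ t n, v i) (∑ i ∈ u, v i)
  have h2 := (key2 N _ u (ht N n hNn) hu).trans_lt hN
  rw [qn_sub_comm 𝕜 w (∑ i ∈ t n, v i)] at h1
  calc _ ≤ _ := h1
    _ < Δ * (ε / (2 * Δ) + ε / (2 * Δ)) := by gcongr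
    _ = ε := by field_simp; norm_num

end sums

/-! ### The spaces `ℓ_q(I)` for `0 < q < 1` -/

section ellq

variable {𝕜 : Type} [RCLike 𝕜] {q : ℝ} {I : Type u}

theorem ellq_hasSum (h0 : 0 < q) (z : Ellq 𝕜 q I) : HasSum (fun i => ‖z i‖ ^ q) (‖z‖ ^ q) := by
  have h := lp.hasSum_norm (p := ENNReal.ofReal q) (by rwa [ENNReal.toReal_ofReal h0.le]) z
  rwa [ENNReal.toReal_ofReal h0.le] at h

theorem ellq_sum_le (h0 : 0 < q) (z : Ellq 𝕜 q I) (s : Finset I) :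
    ∑ i ∈ s, ‖z i‖ ^ q ≤ ‖z‖ ^ q :=
  sum_le_hasSum s (fun i _ => by positivity) (ellq_hasSum h0 z)

theorem ellq_apply_le (h0 : 0 < q) (z : Ellq 𝕜 q I) (i : I) : ‖z i‖ ≤ ‖z‖ :=
  lp.norm_apply_le_norm (by simpa using h0) z i

/-- The completeness of `ℓ_q(I)` for every `q > 0`; Mathlib has it for `1 ≤ q`. -/
theorem ellq_complete (h0 : 0 < q) : IsCompleteQN (Ellq 𝕜 q I) := by
  intro s hs
  have hq : (ENNReal.ofReal q).toReal = q := ENNReal.toReal_ofReal h0.le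
  have hq' : 0 < (ENNReal.ofReal q).toReal := by rwa [hq]
  have hcoord : ∀ i, ∃ y, Tendsto (fun n => s n i) atTop (𝓝 y) := fun i => by
    refine cauchySeq_tendsto_of_complete (Metric.cauchySeq_iff.2 fun ε hε => ?_)
    obtain ⟨N, hN⟩ := hs ε hε
    refine ⟨N, fun m hm n hn => ?_⟩
    rw [dist_eq_norm]
    exact (ellq_apply_le h0 (s m - s n) i).trans_lt (hN m hm n hn)
  choose f hf using hcoord
  have key : ∀ ε > 0, ∀ N : ℕ, (∀ m ≥ N, ∀ n ≥ N, ‖s m - s n‖ < ε) → ∀ m ≥ N,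
      ∀ t : Finset I, ∑ i ∈ t, ‖(s m : ∀ _, 𝕜) i - f i‖ ^ q ≤ ε ^ q := by
    intro ε hε N hN m hm t
    have hl : Tendsto (fun n => ∑ i ∈ t, ‖s m i - s n i‖ ^ q) atTop
        (𝓝 (∑ i ∈ t, ‖s m i - f i‖ ^ q)) :=
      tendsto_finsetSum _ fun i _ => ((hf i).const_sub (s m i)).norm.rpow_const (Or.inr h0.le)
    refine le_of_tendsto hl ?_
    filter_upwards [eventually_ge_atTop N] with n hn
    refine (ellq_sum_le h0 (s m - s n) t).trans ?_
    gcongr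
    · exact lp.norm_nonneg' _
    · exact (hN m hm n hn).le
  obtain ⟨N₁, hN₁⟩ := hs 1 one_pos
  have hmem : Memℓp (fun i => s N₁ i - f i) (ENNReal.ofReal q) := memℓp_gen' (C := 1 ^ q) fun t => by
    rw [hq]
    exact key 1 one_pos N₁ hN₁ N₁ le_rfl t
  let g : Ellq 𝕜 q I := s N₁ - ⟨_, hmem⟩
  have hg : ∀ i, g i = f i := fun i => sub_sub_cancel (s N₁ i) (f i)
  refine ⟨g, tendsto_order.2 ⟨fun a ha => Eventually.of_forall fun _ =>
    ha.trans_le (lp.norm_nonneg' _), fun ε hε => ?_⟩⟩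
  obtain ⟨N, hN⟩ := hs (ε / 2) (by positivity)
  filter_upwards [eventually_ge_atTop N] with m hm
  refine (lp.norm_le_of_forall_sum_le hq' (C := ε / 2) (by positivity) fun t => ?_).trans_lt
    (half_lt_self hε)
  rw [hq]
  refine le_trans (le_of_eq ?_) (key (ε / 2) (by positivity) N hN m hm t)
  refine Finset.sum_congr rfl fun i _ => ?_
  rw [← hg i]
  rfl

theorem ellq_quasiBanach (h0 : 0 < q) (h1 : q < 1) : QuasiBanach 𝕜 (Ellq 𝕜 q I) :=
  { lp_semiQuasiNormed 𝕜 I h0 h1 with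
    complete := ellq_complete h0
    eq_zero := fun x hx => by
      refine lp.ext (funext fun i => ?_)
      have := ellq_apply_le h0 x i
      rw [hx] at this
      exact norm_le_zero_iff.1 this }

open Classical in
variable (𝕜 q) in
/-- The unit vectors of `ℓ_q(I)`. -/
noncomputable def ellqUnit (i : I) : Ellq 𝕜 q I := lp.single _ i 1

theorem ellqUnit_norm (h0 : 0 < q) (i : I) : ‖ellqUnit 𝕜 q i‖ = 1 := by
  classical
  rw [ellqUnit, lp.norm_single (by simpa using h0), norm_one]

theorem ellq_sumsTo (h0 : 0 < q) (z : Ellq 𝕜 q I) :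
    SumsTo (fun i => z i • ellqUnit 𝕜 q i) z := by
  classical
  have hq : (ENNReal.ofReal q).toReal = q := ENNReal.toReal_ofReal h0.le
  have e : ∀ s : Finset I, ‖z - ∑ i ∈ s, z i • ellqUnit 𝕜 q i‖
      = (‖z‖ ^ q - ∑ i ∈ s, ‖z i‖ ^ q) ^ (1 / q) := fun s => by
    have h := lp.norm_compl_sum_single (p := ENNReal.ofReal q) (by rwa [hq]) z s
    rw [hq] at h
    have e2 : ∀ i, z i • ellqUnit 𝕜 q i = lp.single (ENNReal.ofReal q) i (z i) := fun i => by
      rw [ellqUnit, ← lp.single_smul, smul_eq_mul, mul_one]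
    simp only [e2]
    rw [← h, ← Real.rpow_mul (lp.norm_nonneg' _), mul_one_div_cancel h0.ne', Real.rpow_one]
  have hl : Tendsto (fun s : Finset I => (‖z‖ ^ q - ∑ i ∈ s, ‖z i‖ ^ q) ^ (1 / q)) atTop
      (𝓝 ((‖z‖ ^ q - ‖z‖ ^ q) ^ (1 / q))) :=
    (Tendsto.const_sub _ (ellq_hasSum h0 z)).rpow_const (Or.inr (by positivity))
  rw [sub_self, Real.zero_rpow (by positivity)] at hl
  exact hl.congr fun s => (e s).symm

variable {Z : Type*} [AddCommGroup Z] [Module 𝕜 Z] [Norm Z] [QuasiBanach 𝕜 Z]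

theorem ellq_op_ext (h0 : 0 < q) {S T : Op 𝕜 (Ellq 𝕜 q I) Z}
    (h : ∀ i, S (ellqUnit 𝕜 q i) = T (ellqUnit 𝕜 q i)) : S = T := Op.ext fun z => by
  have h1 := (ellq_sumsTo h0 z).map S
  have h2 := (ellq_sumsTo h0 z).map T
  simp only [map_smul, h] at h1 h2
  exact h1.unique 𝕜 h2

/-- Operators on `ℓ_q(I)` are prescribed by their values on the unit vectors, as long as the
resulting linear map on the finitely supported vectors is bounded. -/
theorem exists_ellq_op (h0 : 0 < q) {Δ : ℝ} (hΔ0 : 0 ≤ Δ)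
    (hΔ : ∀ x y : Z, ‖x + y‖ ≤ Δ * (‖x‖ + ‖y‖)) (b : I → Z) {C : ℝ} (hC : 0 ≤ C)
    (hb : ∀ (c : I → 𝕜) (s : Finset I), ‖∑ i ∈ s, c i • b i‖ ≤ C * (∑ i ∈ s, ‖c i‖ ^ q) ^ (1 / q)) :
    ∃ T : Op 𝕜 (Ellq 𝕜 q I) Z, (∀ i, T (ellqUnit 𝕜 q i) = b i) ∧ ∀ z, ‖T z‖ ≤ Δ * C * ‖z‖ := by
  classical
  have hex : ∀ z : Ellq 𝕜 q I, ∃ w, SumsTo (fun i => z i • b i) w := fun z => by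
    refine exists_sumsTo 𝕜 (QuasiBanach.complete (𝕜 := 𝕜)) _ fun ε hε => ?_
    have hC1 : 0 < C + 1 := by positivity
    obtain ⟨s, hs⟩ := summable_iff_vanishing_norm.1 (ellq_hasSum h0 z).summable
      ((ε / (C + 1)) ^ q) (by positivity)
    refine ⟨s, fun t ht => (hb z t).trans_lt ?_⟩
    have h1 : ∑ i ∈ t, ‖z i‖ ^ q < (ε / (C + 1)) ^ q := (le_abs_self _).trans_lt (hs t ht)
    have h2 : 0 ≤ ∑ i ∈ t, ‖z i‖ ^ q := Finset.sum_nonneg fun i _ => by positivity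
    have h3 : (∑ i ∈ t, ‖z i‖ ^ q) ^ (1 / q) ≤ ε / (C + 1) := by
      rw [one_div, Real.rpow_inv_le_iff_of_pos h2 (by positivity) h0]
      exact h1.le
    calc _ ≤ C * (ε / (C + 1)) := by gcongr
      _ < (C + 1) * (ε / (C + 1)) := by
          have : 0 < ε / (C + 1) := by positivity
          nlinarith
      _ = ε := by field_simp
  choose T hT using hex
  have hbound : ∀ z, ‖T z‖ ≤ Δ * C * ‖z‖ := fun z => by
    rw [mul_assoc]
    refine (hT z).norm_le 𝕜 hΔ hΔ0 fun s => (hb z s).trans ?_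
    gcongr
    have h2 : 0 ≤ ∑ i ∈ s, ‖z i‖ ^ q := Finset.sum_nonneg fun i _ => by positivity
    rw [one_div, Real.rpow_inv_le_iff_of_pos h2 (lp.norm_nonneg' _) h0]
    exact ellq_sum_le h0 z s
  refine ⟨⟨{ toFun := T, map_add' := fun z z' => ?_, map_smul' := fun c z => ?_ }, _, hbound⟩,
    fun i => ?_, hbound⟩
  · refine (hT (z + z')).unique 𝕜 ?_
    have := (hT z).add 𝕜 (hT z')
    simp only [← add_smul] at this
    exact this
  · refine (hT (c • z)).unique 𝕜 ?_
    have := (hT z).const_smul c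
    simp only [smul_smul] at this
    exact this
  · refine (hT _).unique 𝕜 ?_
    refine tendsto_const_nhds.congr' ?_
    filter_upwards [eventually_ge_atTop {i}] with s hs
    rw [Finset.sum_eq_single i]
    · rw [show ellqUnit 𝕜 q i i = (1 : 𝕜) from lp.single_apply_self _ i 1, one_smul, sub_self,
        qn_zero 𝕜]
    · intro j _ hj
      rw [show ellqUnit 𝕜 q i j = (0 : 𝕜) from lp.single_apply_ne _ i 1 hj, zero_smul]
    · intro h
      exact absurd (hs (Finset.mem_singleton_self i)) h

end ellq

/-! ### The theorem of Aoki and Rolewicz -/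

section normability

variable {𝕜 : Type} [RCLike 𝕜] {E : Type u} [AddCommGroup E] [Module 𝕜 E] [Norm E]

variable (𝕜) in
/-- A quasi-norm with constant `Δ` satisfies the `p`-inequality for finite sums, up to a constant, for all `p`
which are sufficiently small in terms of `Δ`. -/
theorem norm_sum_le_of_quasi [QuasiBanach 𝕜 E] {Δ : ℝ} (hΔ0 : 0 ≤ Δ)
    (hΔ : ∀ x y : E, ‖x + y‖ ≤ Δ * (‖x‖ + ‖y‖)) {p : ℝ} (hp : 0 < p) (hp1 : p ≤ 1)
    (hθ : Δ * (2 / 3) ^ (1 / p - 1) ≤ 1 / 2) {ι : Type*} (s : Finset ι) (x : ι → E) :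
    ‖∑ j ∈ s, x j‖ ≤ 2 * (Δ + 1) * (∑ j ∈ s, ‖x j‖ ^ p) ^ (1 / p) := by
  have hpow : ∀ j, (‖x j‖ ^ p) ^ (1 / p) = ‖x j‖ := fun j => by
    rw [← Real.rpow_mul (qn_nonneg 𝕜 _), mul_one_div_cancel hp.ne', Real.rpow_one]
  have h0 : ∀ j, 0 ≤ ‖x j‖ ^ p := fun j => Real.rpow_nonneg (qn_nonneg 𝕜 _) _
  have := split_bound (D := fun s => ‖∑ j ∈ s, x j‖) (a := fun j => ‖x j‖ ^ p) (κ := Δ) (c := 1)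
    (r := 1 / p) (θ := 1 / 2) h0 hΔ0
    zero_le_one (by rwa [one_le_div hp]) hθ (by norm_num) (fun t ht => ?_) (fun j => ?_)
    (fun s t hst hdec => ?_) s
  · convert this using 2
    ring
  · refine le_of_eq ?_
    rw [Finset.sum_eq_zero, qn_zero 𝕜]
    intro j hj
    exact QuasiBanach.eq_zero (𝕜 := 𝕜) _
      ((Real.rpow_eq_zero_iff_of_nonneg (qn_nonneg 𝕜 _)).1 (ht j hj)).1
  · rw [Finset.sum_singleton, hpow, one_mul]
  · rw [Finset.sum_union hst]
    refine (hΔ _ _).trans ?_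
    have : 0 ≤ (∑ j ∈ s ∪ t, ‖x j‖ ^ p) ^ (1 / p) :=
      Real.rpow_nonneg (Finset.sum_nonneg fun j _ => h0 j) _
    linarith

/-- The equivalent `p`-norm is `inf (∑ ‖x_j‖ ^ p) ^ (1 / p)`, over all finite decompositions
`x = ∑ x_j`. -/
theorem pNormable_of_quasi [QuasiBanach 𝕜 E] {Δ : ℝ} (hΔ0 : 0 ≤ Δ)
    (hΔ : ∀ x y : E, ‖x + y‖ ≤ Δ * (‖x‖ + ‖y‖)) {p : ℝ} (hp : 0 < p) (hp1 : p ≤ 1)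
    (hθ : Δ * (2 / 3) ^ (1 / p - 1) ≤ 1 / 2) : PNormable 𝕜 p E := by
  set M := 2 * (Δ + 1) with hM
  have hM0 : 0 < M := by positivity
  -- `ν` is the `p`-th power of the new quasi-norm
  let A : E → Set ℝ := fun x => {S | ∃ l : List E, l.sum = x ∧ (l.map (‖·‖ ^ p)).sum = S}
  let ν : E → ℝ := fun x => sInf (A x)
  have hne : ∀ x, (A x).Nonempty := fun x => ⟨_, [x], by simp, rfl⟩
  have hpos : ∀ x, ∀ S ∈ A x, 0 ≤ S := by
    rintro x _ ⟨l, -, rfl⟩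
    refine List.sum_nonneg fun a ha => ?_
    obtain ⟨y, -, rfl⟩ := List.mem_map.1 ha
    exact Real.rpow_nonneg (qn_nonneg 𝕜 _) _
  have hbdd : ∀ x, BddBelow (A x) := fun x => ⟨0, hpos x⟩
  have hν0 : ∀ x, 0 ≤ ν x := fun x => Real.sInf_nonneg (hpos x)
  have hupper : ∀ x, ν x ≤ ‖x‖ ^ p := fun x => csInf_le (hbdd x) ⟨[x], by simp, by simp⟩
  have hlower : ∀ x, (1 / M * ‖x‖) ^ p ≤ ν x := fun x => by
    refine le_csInf (hne x) ?_
    rintro _ ⟨l, rfl, rfl⟩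
    have h := norm_sum_le_of_quasi 𝕜 hΔ0 hΔ hp hp1 hθ Finset.univ (fun i : Fin l.length => l[i])
    have e1 : ∑ i : Fin l.length, l[i] = l.sum := by
      rw [← List.sum_ofFn]; simp
    have e2 : ∑ i : Fin l.length, ‖l[i]‖ ^ p = (l.map (‖·‖ ^ p)).sum := by
      rw [← List.sum_ofFn]; congr 1; apply List.ext_getElem <;> simp
    rw [e1, e2] at h
    have h0 : 0 ≤ (l.map (‖·‖ ^ p)).sum := hpos _ _ ⟨l, rfl, rfl⟩
    have hn := qn_nonneg 𝕜 l.sum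
    rw [← Real.le_rpow_inv_iff_of_pos (by positivity) h0 hp, ← one_div, div_mul_eq_mul_div, one_mul,
      div_le_iff₀' hM0]
    exact h
  have hadd : ∀ x y, ν (x + y) ≤ ν x + ν y := fun x y => by
    refine le_of_forall_pos_le_add fun ε hε => ?_
    obtain ⟨_, ⟨l, rfl, rfl⟩, h1⟩ := exists_lt_of_csInf_lt (hne x)
      (lt_add_of_pos_right (ν x) (half_pos hε))
    obtain ⟨_, ⟨l', rfl, rfl⟩, h2⟩ := exists_lt_of_csInf_lt (hne y)
      (lt_add_of_pos_right (ν y) (half_pos hε))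
    have : ν (l.sum + l'.sum) ≤ (l.map (‖·‖ ^ p)).sum + (l'.map (‖·‖ ^ p)).sum :=
      csInf_le (hbdd _) ⟨l ++ l', by simp, by simp⟩
    linarith
  have hsmul_le : ∀ (c : 𝕜) x, ν (c • x) ≤ ‖c‖ ^ p * ν x := fun c x => by
    rw [← smul_eq_mul, ← Real.sInf_smul_of_nonneg (by positivity)]
    refine le_csInf ((hne x).smul_set) ?_
    rintro _ ⟨_, ⟨l, rfl, rfl⟩, rfl⟩
    refine csInf_le (hbdd _) ⟨l.map (c • ·), by simp [List.smul_sum], ?_⟩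
    simp only [List.map_map, Function.comp_def, smul_eq_mul]
    rw [← List.sum_map_mul_left]
    congr 2
    funext y
    rw [qn_smul 𝕜, Real.mul_rpow (norm_nonneg c) (qn_nonneg 𝕜 y)]
  have hsmul : ∀ (c : 𝕜) x, ν (c • x) = ‖c‖ ^ p * ν x := fun c x => by
    refine le_antisymm (hsmul_le c x) ?_
    rcases eq_or_ne c 0 with rfl | hc
    · rw [norm_zero, Real.zero_rpow hp.ne', zero_mul]
      exact hν0 _
    · have := hsmul_le c⁻¹ (c • x)
      rw [inv_smul_smul₀ hc, norm_inv, Real.inv_rpow (norm_nonneg c),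
        le_inv_mul_iff₀ (by have := norm_pos_iff.2 hc; positivity)] at this
      exact this
  refine ⟨fun x => ν x ^ (1 / p), fun x => Real.rpow_nonneg (hν0 x) _, fun c x => ?_, fun x y => ?_,
    1 / M, by positivity, 1, one_pos, fun x => ⟨?_, ?_⟩⟩
  · change ν (c • x) ^ (1 / p) = ‖c‖ * ν x ^ (1 / p)
    rw [hsmul, Real.mul_rpow (by positivity) (hν0 x), ← Real.rpow_mul (norm_nonneg c),
      mul_one_div_cancel hp.ne', Real.rpow_one]
  · have e : ∀ x, (ν x ^ (1 / p)) ^ p = ν x := fun x => by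
      rw [← Real.rpow_mul (hν0 x), one_div_mul_cancel hp.ne', Real.rpow_one]
    simp only [e]
    exact hadd x y
  · have hn := qn_nonneg 𝕜 x
    rw [one_div p, Real.le_rpow_inv_iff_of_pos (by positivity) (hν0 x) hp]
    exact hlower x
  · rw [one_mul, one_div, Real.rpow_inv_le_iff_of_pos (hν0 x) (qn_nonneg 𝕜 x) hp]
    exact hupper x

theorem sum_rpow_le_rpow_sum {ι : Type*} (s : Finset ι) {a : ι → ℝ} (ha : ∀ j, 0 ≤ a j) {r : ℝ}
    (hr : 1 ≤ r) : ∑ j ∈ s, a j ^ r ≤ (∑ j ∈ s, a j) ^ r := by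
  classical
  induction s using Finset.induction_on with
  | empty => simp [Real.zero_rpow (show r ≠ 0 by linarith)]
  | insert j s hj ih =>
    rw [Finset.sum_insert hj, Finset.sum_insert hj]
    have := Real.add_rpow_le_rpow_add (ha j) (Finset.sum_nonneg fun i (_ : i ∈ s) => ha i) hr
    linarith

end normability

/-! ### Kalton's estimate for quasilinear maps -/

section kalton

variable {𝕜 : Type} [RCLike 𝕜] {X Y : Type u}
    [AddCommGroup X] [Module 𝕜 X] [Norm X] [QuasiBanach 𝕜 X]
    [AddCommGroup Y] [Module 𝕜 Y] [Norm Y] [QuasiBanach 𝕜 Y]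

theorem PNormable.sum_le {N : X → ℝ} {p : ℝ} (hp : 0 < p) (hN0 : ∀ x, 0 ≤ N x)
    (hN1 : ∀ (c : 𝕜) x, N (c • x) = ‖c‖ * N x) (hN2 : ∀ x y, N (x + y) ^ p ≤ N x ^ p + N y ^ p)
    {q : ℝ} (hq : 0 < q) (hqp : q ≤ p) {ι : Type*} (s : Finset ι) (x : ι → X) :
    N (∑ j ∈ s, x j) ^ p ≤ (∑ j ∈ s, N (x j) ^ q) ^ (p / q) := by
  have h0 : N 0 ^ p = 0 := by
    have := hN1 0 0
    rw [zero_smul, norm_zero, zero_mul] at this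
    rw [this, Real.zero_rpow hp.ne']
  have h1 : N (∑ j ∈ s, x j) ^ p ≤ ∑ j ∈ s, N (x j) ^ p :=
    Finset.le_sum_of_subadditive (fun x => N x ^ p) h0.le hN2 s x
  refine h1.trans (le_trans (le_of_eq ?_) (sum_rpow_le_rpow_sum s
    (fun j => Real.rpow_nonneg (hN0 (x j)) q) (r := p / q) (by rwa [one_le_div hq])))
  refine Finset.sum_congr rfl fun j _ => ?_
  rw [← Real.rpow_mul (hN0 _), mul_div_cancel₀ _ hq.ne']

/-- A space which is `p`-normable satisfies the `q`-inequality for finite sums, `q ≤ p`. -/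
theorem PNormable.exists_norm_sum_le {p : ℝ} (h : PNormable 𝕜 p X) {q : ℝ} (hq : 0 < q)
    (hqp : q ≤ p) : ∃ C : ℝ, 0 ≤ C ∧ ∀ {ι : Type u} (s : Finset ι) (x : ι → X),
      ‖∑ j ∈ s, x j‖ ≤ C * (∑ j ∈ s, ‖x j‖ ^ q) ^ (1 / q) := by
  obtain ⟨N, hN0, hN1, hN2, a, ha, b, hb, hab⟩ := h
  have hp : 0 < p := hq.trans_le hqp
  refine ⟨a⁻¹ * b, by positivity, fun s x => ?_⟩
  have h0 : ∀ j, 0 ≤ ‖x j‖ ^ q := fun j => Real.rpow_nonneg (qn_nonneg 𝕜 _) _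
  have h0' : ∀ j, 0 ≤ N (x j) ^ q := fun j => Real.rpow_nonneg (hN0 _) _
  have hS : 0 ≤ ∑ j ∈ s, ‖x j‖ ^ q := Finset.sum_nonneg fun j _ => h0 j
  have hS' : 0 ≤ ∑ j ∈ s, N (x j) ^ q := Finset.sum_nonneg fun j _ => h0' j
  have h1 := PNormable.sum_le hp hN0 hN1 hN2 hq hqp s x
  have h2 : N (∑ j ∈ s, x j) ≤ (∑ j ∈ s, N (x j) ^ q) ^ (1 / q) := by
    rw [← Real.rpow_le_rpow_iff (hN0 _) (by positivity) hp, ← Real.rpow_mul hS', one_div_mul_eq_div]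
    exact h1
  have h3 : (∑ j ∈ s, N (x j) ^ q) ≤ b ^ q * ∑ j ∈ s, ‖x j‖ ^ q := by
    rw [Finset.mul_sum]
    refine Finset.sum_le_sum fun j _ => ?_
    rw [← Real.mul_rpow hb.le (qn_nonneg 𝕜 _)]
    exact Real.rpow_le_rpow (hN0 _) (hab _).2 hq.le
  have h4 : (b ^ q * ∑ j ∈ s, ‖x j‖ ^ q) ^ (1 / q) = b * (∑ j ∈ s, ‖x j‖ ^ q) ^ (1 / q) := by
    rw [Real.mul_rpow (by positivity) hS, ← Real.rpow_mul hb.le, mul_one_div_cancel hq.ne',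
      Real.rpow_one]
  rw [mul_assoc, ← h4, le_inv_mul_iff₀ ha]
  refine (hab _).1.trans (h2.trans ?_)
  gcongr

/-- Kalton's estimate: a quasilinear map between `p`-normable spaces is almost additive on finite
sums, with an error controlled by the `q`-norm of the summands for any `q < p`. -/
theorem exists_norm_map_sum_sub_le {p : ℝ} (hX : PNormable 𝕜 p X) (hY : PNormable 𝕜 p Y) {q : ℝ}
    (hq : 0 < q) (hqp : q < p) (hp1 : p ≤ 1) : ∃ C : ℝ, 0 ≤ C ∧ ∀ F : X → Y, F 0 = 0 →
      (∀ x y, ‖F (x + y) - F x - F y‖ ≤ ‖x‖ + ‖y‖) → ∀ {ι : Type u} (s : Finset ι) (x : ι → X),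
        ‖F (∑ j ∈ s, x j) - ∑ j ∈ s, F (x j)‖ ≤ C * (∑ j ∈ s, ‖x j‖ ^ q) ^ (1 / q) := by
  obtain ⟨N, hN0, hN1, hN2, a, ha, b, hb, hab⟩ := hX
  obtain ⟨N', hN0', hN1', hN2', a', ha', b', hb', hab'⟩ := hY
  have hp : 0 < p := hq.trans hqp
  have hr1 : 1 < p / q := by rwa [one_lt_div hq]
  set θ : ℝ := (2 / 3) ^ (p / q - 1) with hθ
  have hθ1 : θ < 1 := Real.rpow_lt_one (by norm_num) (by norm_num) (by linarith)
  set K : ℝ := b' / a with hK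
  have hK0 : 0 < K := by positivity
  set M : ℝ := (1 + 1) * K ^ p / (1 - θ) with hM
  have hM0 : 0 ≤ M := by
    have : 0 < 1 - θ := by linarith
    positivity
  have hz : N 0 = 0 := by
    have := hN1 0 0
    rwa [zero_smul, norm_zero, zero_mul] at this
  have hz' : N' 0 = 0 := by
    have := hN1' 0 0
    rwa [zero_smul, norm_zero, zero_mul] at this
  refine ⟨a'⁻¹ * (M ^ (1 / p) * b), by positivity, fun F hF0 hF ι s x => ?_⟩
  have h0 : ∀ j, 0 ≤ ‖x j‖ ^ q := fun j => Real.rpow_nonneg (qn_nonneg 𝕜 _) _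
  have h0' : ∀ j, 0 ≤ N (x j) ^ q := fun j => Real.rpow_nonneg (hN0 _) _
  have hS : 0 ≤ ∑ j ∈ s, ‖x j‖ ^ q := Finset.sum_nonneg fun j _ => h0 j
  have hS' : 0 ≤ ∑ j ∈ s, N (x j) ^ q := Finset.sum_nonneg fun j _ => h0' j
  have herr : ∀ σ τ : X, N' (F (σ + τ) - F σ - F τ) ^ p ≤ K ^ p * N σ ^ p + K ^ p * N τ ^ p := by
    intro σ τ
    have h1 : N' (F (σ + τ) - F σ - F τ) ≤ K * N σ + K * N τ := by
      have h2 := hF σ τ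
      have h4 : ∀ z, ‖z‖ ≤ N z / a := fun z => by
        rw [le_div_iff₀' ha]
        exact (hab z).1
      calc _ ≤ b' * ‖F (σ + τ) - F σ - F τ‖ := (hab' _).2
        _ ≤ b' * (N σ / a + N τ / a) := by
            gcongr
            have := h4 σ
            have := h4 τ
            linarith
        _ = _ := by rw [hK]; ring
    have hσ := hN0 σ
    have hτ := hN0 τ
    rw [← Real.mul_rpow hK0.le hσ, ← Real.mul_rpow hK0.le hτ]
    exact (Real.rpow_le_rpow (hN0' _) h1 hp.le).trans
      (Real.rpow_add_le_add_rpow (by positivity) (by positivity) hp.le hp1)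
  -- the `p`-th power of the defect is almost additive, with constant one
  have key := split_bound (D := fun s => N' (F (∑ j ∈ s, x j) - ∑ j ∈ s, F (x j)) ^ p)
    (a := fun j => N (x j) ^ q) (κ := 1) (c := K ^ p) (r := p / q) (θ := θ)
    h0' zero_le_one (by positivity) hr1.le (by rw [one_mul]) hθ1 (fun t ht => ?_) (fun j => ?_)
    (fun s t hst hdec => ?_) s
  · have h1 : N' (F (∑ j ∈ s, x j) - ∑ j ∈ s, F (x j))
        ≤ M ^ (1 / p) * (∑ j ∈ s, N (x j) ^ q) ^ (1 / q) := by
      rw [← Real.rpow_le_rpow_iff (hN0' _) (by positivity) hp,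
        Real.mul_rpow (by positivity) (by positivity), ← Real.rpow_mul hS', ← Real.rpow_mul hM0,
        one_div_mul_cancel hp.ne', one_div_mul_eq_div, Real.rpow_one]
      exact key
    have h3 : (∑ j ∈ s, N (x j) ^ q) ≤ b ^ q * ∑ j ∈ s, ‖x j‖ ^ q := by
      rw [Finset.mul_sum]
      refine Finset.sum_le_sum fun j _ => ?_
      rw [← Real.mul_rpow hb.le (qn_nonneg 𝕜 _)]
      exact Real.rpow_le_rpow (hN0 _) (hab _).2 hq.le
    have h4 : (b ^ q * ∑ j ∈ s, ‖x j‖ ^ q) ^ (1 / q) = b * (∑ j ∈ s, ‖x j‖ ^ q) ^ (1 / q) := by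
      rw [Real.mul_rpow (by positivity) hS, ← Real.rpow_mul hb.le, mul_one_div_cancel hq.ne',
        Real.rpow_one]
    rw [mul_assoc, mul_assoc, ← h4, le_inv_mul_iff₀ ha']
    refine (hab' _).1.trans (h1.trans ?_)
    gcongr
  · have hx : ∀ j ∈ t, x j = 0 := fun j hj => by
      have h1 : N (x j) = 0 := ((Real.rpow_eq_zero_iff_of_nonneg (hN0 _)).1 (ht j hj)).1
      have h2 := (hab (x j)).1
      rw [h1] at h2
      refine QuasiBanach.eq_zero (𝕜 := 𝕜) _ (le_antisymm ?_ (qn_nonneg 𝕜 _))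
      exact nonpos_of_mul_nonpos_right h2 ha
    refine le_of_eq ?_
    rw [Finset.sum_eq_zero hx, Finset.sum_eq_zero fun j hj => by rw [hx j hj, hF0], hF0, sub_zero,
      hz', Real.zero_rpow hp.ne']
  · rw [Finset.sum_singleton, Finset.sum_singleton, sub_self, hz', Real.zero_rpow hp.ne']
    have := hN0 (x j)
    positivity
  · have e : F (∑ j ∈ s ∪ t, x j) - ∑ j ∈ s ∪ t, F (x j)
        = (F (∑ j ∈ s, x j) - ∑ j ∈ s, F (x j)) + (F (∑ j ∈ t, x j) - ∑ j ∈ t, F (x j))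
          + (F (∑ j ∈ s, x j + ∑ j ∈ t, x j) - F (∑ j ∈ s, x j) - F (∑ j ∈ t, x j)) := by
      rw [Finset.sum_union hst, Finset.sum_union hst]
      abel
    rw [e, one_mul]
    refine (hN2' _ _).trans (add_le_add (hN2' _ _) ((herr _ _).trans ?_))
    rw [← mul_add]
    gcongr
    have hz0 : N 0 ^ p = 0 := by rw [hz, Real.zero_rpow hp.ne']
    have h1 := Finset.le_sum_of_subadditive (fun x => N x ^ p) hz0.le hN2 s x
    have h2 := Finset.le_sum_of_subadditive (fun x => N x ^ p) hz0.le hN2 t x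
    have h3 := sum_rpow_le_rpow_sum (s ∪ t) h0' hr1.le
    have h4 : ∀ j, (N (x j) ^ q) ^ (p / q) = N (x j) ^ p := fun j => by
      rw [← Real.rpow_mul (hN0 _), mul_div_cancel₀ _ hq.ne']
    simp only [h4] at h3
    rw [Finset.sum_union hst] at h3
    linarith

end kalton

/-! ### Existence of presentations -/

/-- The exponents are reciprocals of successive integers, taken small enough for the quasi-norms of both
spaces; the space `ℓ_q` over the unit ball of `X` maps onto `X`. -/
theorem exists_presentation (𝕜 : Type) [RCLike 𝕜] (X Y : Type u)
    [AddCommGroup X] [Module 𝕜 X] [Norm X] [QuasiBanach 𝕜 X]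
    [AddCommGroup Y] [Module 𝕜 Y] [Norm Y] [QuasiBanach 𝕜 Y] : Nonempty (Presentation 𝕜 X Y) := by
  obtain ⟨Δ₁, hΔ₁, h₁⟩ := qn_quasi 𝕜 X
  obtain ⟨Δ₂, hΔ₂, h₂⟩ := qn_quasi 𝕜 Y
  set Δ := max Δ₁ Δ₂ with hΔdef
  have hΔ : 1 ≤ Δ := hΔ₁.trans (le_max_left _ _)
  have hX : ∀ x y : X, ‖x + y‖ ≤ Δ * (‖x‖ + ‖y‖) := fun x y => (h₁ x y).trans (by
    have := qn_nonneg 𝕜 x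
    have := qn_nonneg 𝕜 y
    gcongr
    exact le_max_left _ _)
  have hY : ∀ x y : Y, ‖x + y‖ ≤ Δ * (‖x‖ + ‖y‖) := fun x y => (h₂ x y).trans (by
    have := qn_nonneg 𝕜 x
    have := qn_nonneg 𝕜 y
    gcongr
    exact le_max_right _ _)
  obtain ⟨n, hn⟩ := exists_pow_lt_of_lt_one (show 0 < 1 / (2 * Δ) by positivity)
    (show (2 / 3 : ℝ) < 1 by norm_num)
  have hθ : ∀ m : ℕ, n ≤ m → Δ * (2 / 3) ^ (1 / (1 / ((m : ℝ) + 1)) - 1) ≤ 1 / 2 := by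
    intro m hm
    rw [one_div_one_div, add_sub_cancel_right, Real.rpow_natCast]
    have h1 : (2 / 3 : ℝ) ^ m ≤ (2 / 3) ^ n :=
      pow_le_pow_of_le_one (by norm_num) (by norm_num) hm
    have h2 : (2 / 3 : ℝ) ^ m ≤ 1 / (2 * Δ) := h1.trans hn.le
    rw [le_div_iff₀ (by positivity)] at h2
    linarith
  have hle : ∀ m : ℕ, 1 / ((m : ℝ) + 1) ≤ 1 := fun m => by
    rw [div_le_one (by positivity)]
    linarith [m.cast_nonneg (α := ℝ)]
  set q : ℝ := 1 / (((n + 1 : ℕ) : ℝ) + 1) with hqdef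
  have hq : 0 < q := by positivity
  have hΔ0 : 0 ≤ Δ := by linarith
  let I := {x : X // ‖x‖ ≤ 1}
  obtain ⟨T, hT, -⟩ := exists_ellq_op (𝕜 := 𝕜) hq hΔ0 hX (fun i : I => i.1) (C := 2 * (Δ + 1))
    (by positivity) (fun c s => by
      refine (norm_sum_le_of_quasi 𝕜 hΔ0 hX hq (hle _) (hθ _ (Nat.le_succ n)) s _).trans ?_
      gcongr with i hi
      · exact Finset.sum_nonneg fun i _ => Real.rpow_nonneg (qn_nonneg 𝕜 _) _
      · exact qn_nonneg 𝕜 _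
      · rw [qn_smul 𝕜]
        exact mul_le_of_le_one_right (norm_nonneg _) i.2)
  refine ⟨⟨1 / ((n : ℝ) + 1), hle n, pNormable_of_quasi hΔ0 hX (by positivity) (hle n) (hθ n le_rfl),
    pNormable_of_quasi hΔ0 hY (by positivity) (hle n) (hθ n le_rfl), q, hq, ?_, I, T, fun x => ?_⟩⟩
  · rw [hqdef]
    apply one_div_lt_one_div_of_lt (by positivity)
    push_cast
    linarith
  · rcases (qn_nonneg 𝕜 x).eq_or_lt with hx | hx
    · exact ⟨0, by rw [map_zero, QuasiBanach.eq_zero (𝕜 := 𝕜) x hx.symm]⟩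
    · have hc : ((‖x‖ : ℝ) : 𝕜) ≠ 0 := RCLike.ofReal_ne_zero.2 hx.ne'
      refine ⟨((‖x‖ : ℝ) : 𝕜) • ellqUnit 𝕜 q ⟨((‖x‖ : ℝ) : 𝕜)⁻¹ • x, ?_⟩, ?_⟩
      · rw [map_smul, hT, smul_inv_smul₀ hc]
      · rw [qn_smul 𝕜, norm_inv, RCLike.norm_ofReal, abs_of_pos hx, inv_mul_cancel₀ hx.ne']

section extensions

variable {𝕜 : Type} [RCLike 𝕜] {X Y X' Y' : Type u}
    [AddCommGroup X] [Module 𝕜 X] [Norm X] [QuasiBanach 𝕜 X]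
    [AddCommGroup Y] [Module 𝕜 Y] [Norm Y] [QuasiBanach 𝕜 Y]
    [AddCommGroup X'] [Module 𝕜 X'] [Norm X'] [QuasiBanach 𝕜 X']
    [AddCommGroup Y'] [Module 𝕜 Y'] [Norm Y'] [QuasiBanach 𝕜 Y']

variable (𝕜) in
theorem qn_sub_le_add {E : Type*} [AddCommGroup E] [Module 𝕜 E] [Norm E] [SemiQuasiNormed 𝕜 E]
    {Δ : ℝ} (h : ∀ x y : E, ‖x + y‖ ≤ Δ * (‖x‖ + ‖y‖)) (x y : E) :
    ‖x - y‖ ≤ Δ * (‖x‖ + ‖y‖) := by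
  have := h x (-y)
  rwa [qn_neg 𝕜, ← sub_eq_add_neg] at this

/-! ### Twisted sums -/

@[simp] theorem QLin.map_zero' (F : QLin 𝕜 X Y) : F 0 = 0 := by
  have := F.2.1 0 0
  rwa [zero_smul, zero_smul] at this

/-- The twisted sum `Y ⊕_F X`: the space `Y × X` with the quasi-norm
`‖(y, x)‖ = ‖y - F x‖ + ‖x‖`. -/
def Twisted (_F : QLin 𝕜 X Y) : Type u := Y × X

namespace Twisted

variable (F : QLin 𝕜 X Y)

instance : AddCommGroup (Twisted F) := inferInstanceAs (AddCommGroup (Y × X))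

instance : Module 𝕜 (Twisted F) := inferInstanceAs (Module 𝕜 (Y × X))

instance : Norm (Twisted F) := ⟨fun w => ‖w.1 - F w.2‖ + ‖w.2‖⟩

variable {F}

theorem norm_def (w : Twisted F) : ‖w‖ = ‖w.1 - F w.2‖ + ‖w.2‖ := rfl

variable (F) in
/-- The injection `y ↦ (y, 0)`. -/
def inl : Y →ₗ[𝕜] Twisted F := LinearMap.inl 𝕜 Y X

variable (F) in
/-- The linear section `x ↦ (0, x)`, which need not be bounded. -/
def inr : X →ₗ[𝕜] Twisted F := LinearMap.inr 𝕜 Y X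

variable (F) in
/-- The projection `(y, x) ↦ x`. -/
def proj : Twisted F →ₗ[𝕜] X := LinearMap.snd 𝕜 Y X

theorem norm_inl (y : Y) : ‖inl F y‖ = ‖y‖ := by
  change ‖y - F 0‖ + ‖(0 : X)‖ = ‖y‖
  rw [F.map_zero', sub_zero, qn_zero 𝕜, add_zero]

theorem norm_le_of_quasi {Δ Δ' : ℝ} (hΔ0 : 0 ≤ Δ) (hΔ0' : 0 ≤ Δ')
    (hΔ : ∀ x y : X, ‖x + y‖ ≤ Δ * (‖x‖ + ‖y‖)) (hΔ' : ∀ x y : Y, ‖x + y‖ ≤ Δ' * (‖x‖ + ‖y‖))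
    {Q : ℝ} (hQ : ‖F‖ ≤ Q) (w w' : Twisted F) :
    ‖w + w'‖ ≤ (Δ' * (Δ' + Q) + Δ) * (‖w‖ + ‖w'‖) := by
  obtain ⟨y, x⟩ := w
  obtain ⟨y', x'⟩ := w'
  change ‖y + y' - F (x + x')‖ + ‖x + x'‖
    ≤ (Δ' * (Δ' + Q) + Δ) * (‖y - F x‖ + ‖x‖ + (‖y' - F x'‖ + ‖x'‖))
  have e : y + y' - F (x + x') = (y - F x) + (y' - F x') - (F (x + x') - F x - F x') := by abel
  have hx := qn_nonneg 𝕜 x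
  have hx' := qn_nonneg 𝕜 x'
  have hy := qn_nonneg 𝕜 (y - F x)
  have hy' := qn_nonneg 𝕜 (y' - F x')
  have hF := F.norm_nonneg
  have h1 := qn_sub_le_add 𝕜 hΔ' ((y - F x) + (y' - F x')) (F (x + x') - F x - F x')
  have h2 := hΔ' (y - F x) (y' - F x')
  have h3 := F.le_norm x x'
  have h4 := hΔ x x'
  rw [e]
  have h5 : ‖F‖ * (‖x‖ + ‖x'‖) ≤ Q * (‖y - F x‖ + ‖x‖ + (‖y' - F x'‖ + ‖x'‖)) := by
    gcongr <;> linarith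
  have h6 : Δ' * (‖y - F x‖ + ‖y' - F x'‖) ≤ Δ' * (‖y - F x‖ + ‖x‖ + (‖y' - F x'‖ + ‖x'‖)) := by
    gcongr <;> linarith
  have h7 : Δ * (‖x‖ + ‖x'‖) ≤ Δ * (‖y - F x‖ + ‖x‖ + (‖y' - F x'‖ + ‖x'‖)) := by
    gcongr <;> linarith
  have h8 : Δ' * (‖y - F x + (y' - F x')‖ + ‖F (x + x') - F x - F x'‖)
      ≤ Δ' * (Δ' * (‖y - F x‖ + ‖x‖ + (‖y' - F x'‖ + ‖x'‖))
        + Q * (‖y - F x‖ + ‖x‖ + (‖y' - F x'‖ + ‖x'‖))) := by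
    gcongr <;> linarith
  linarith

instance : SemiQuasiNormed 𝕜 (Twisted F) where
  nonneg w := add_nonneg (qn_nonneg 𝕜 _) (qn_nonneg 𝕜 _)
  smul c w := by
    obtain ⟨y, x⟩ := w
    change ‖c • y - F (c • x)‖ + ‖c • x‖ = ‖c‖ * (‖y - F x‖ + ‖x‖)
    rw [show F (c • x) = c • F x from F.2.1 c x, ← smul_sub, qn_smul 𝕜, qn_smul 𝕜, mul_add]
  quasi := by
    obtain ⟨Δ, hΔ1, hΔ⟩ := qn_quasi 𝕜 X
    obtain ⟨Δ', hΔ1', hΔ'⟩ := qn_quasi 𝕜 Y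
    exact ⟨_, norm_le_of_quasi (by linarith) (by linarith) hΔ hΔ' le_rfl⟩

theorem norm_proj_le (w : Twisted F) : ‖proj F w‖ ≤ ‖w‖ :=
  le_add_of_nonneg_left (qn_nonneg 𝕜 _)

variable (F) in
/-- The section `x ↦ (F x, x)`. -/
def sec (x : X) : Twisted F := (F x, x)

theorem norm_sec (x : X) : ‖sec F x‖ = ‖x‖ := by
  change ‖F x - F x‖ + ‖x‖ = ‖x‖
  rw [sub_self, qn_zero 𝕜, zero_add]

theorem sec_smul (c : 𝕜) (x : X) : sec F (c • x) = c • sec F x :=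
  Prod.ext (F.2.1 c x) rfl

/-- A Cauchy sequence of a twisted sum has convergent projections to `X`; after subtracting
the sections of the differences from the limit, it becomes a Cauchy sequence in a translate of `Y`. -/
theorem complete : IsCompleteQN (Twisted F) := by
  intro s hs
  obtain ⟨Δ, hΔ1, hΔ⟩ := qn_quasi 𝕜 (Twisted F)
  obtain ⟨x, hx⟩ := QuasiBanach.complete (𝕜 := 𝕜) (fun n => proj F (s n)) fun ε hε => by
    obtain ⟨N, hN⟩ := hs ε hε
    exact ⟨N, fun m hm n hn => by
      rw [← map_sub]
      exact (norm_proj_le _).trans_lt (hN m hm n hn)⟩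
  let d : ℕ → Twisted F := fun n => sec F (proj F (s n) - x)
  have hd : Tendsto (fun n => ‖d n‖) atTop (𝓝 0) := hx.congr fun n => (norm_sec _).symm
  let y : ℕ → Y := fun n => (s n - d n).1
  have hy : ∀ n, s n = inl F (y n) + inr F x + d n := fun n => by
    refine Prod.ext ?_ ?_
    · change (s n).1 = ((s n).1 - (d n).1) + 0 + (d n).1
      abel
    · change (s n).2 = 0 + x + ((s n).2 - x)
      abel
  obtain ⟨z, hz⟩ := QuasiBanach.complete (𝕜 := 𝕜) y fun ε hε => by
    obtain ⟨N, hN⟩ := hs (ε / (4 * Δ ^ 2)) (by positivity)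
    obtain ⟨M, hM⟩ := eventually_atTop.1 ((tendsto_order.1 hd).2 (ε / (4 * Δ ^ 2)) (by positivity))
    refine ⟨max N M, fun m hm n hn => ?_⟩
    have e : inl F (y m - y n) = (s m - s n) - (d m - d n) := by
      rw [hy m, hy n, map_sub]
      abel
    have h1 := qn_sub_le_add 𝕜 hΔ (s m - s n) (d m - d n)
    have h2 := qn_sub_le_add 𝕜 hΔ (d m) (d n)
    have h3 := hN m (le_of_max_le_left hm) n (le_of_max_le_left hn)
    have h4 := hM m (le_of_max_le_right hm)
    have h5 := hM n (le_of_max_le_right hn)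
    rw [← norm_inl (F := F), e]
    have hΔ0 : 0 < Δ := by linarith
    calc _ ≤ Δ * (‖s m - s n‖ + ‖d m - d n‖) := h1
      _ < Δ * (Δ * (ε / (4 * Δ ^ 2) + ε / (4 * Δ ^ 2))
          + Δ * (ε / (4 * Δ ^ 2) + ε / (4 * Δ ^ 2))) := by
          have : ε / (4 * Δ ^ 2) ≤ Δ * (ε / (4 * Δ ^ 2) + ε / (4 * Δ ^ 2)) := by
            have : 0 < ε / (4 * Δ ^ 2) := by positivity
            nlinarith
          have h6 : Δ * (‖d m‖ + ‖d n‖) < Δ * (ε / (4 * Δ ^ 2) + ε / (4 * Δ ^ 2)) := by gcongr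
          gcongr
          · linarith
          · linarith
      _ = ε := by field_simp; norm_num
  refine ⟨inl F z + inr F x, ?_⟩
  have hl : Tendsto (fun n => Δ * (‖y n - z‖ + ‖d n‖)) atTop (𝓝 0) := by
    simpa using (hz.add hd).const_mul Δ
  refine squeeze_zero (fun _ => qn_nonneg 𝕜 _) (fun n => ?_) hl
  have e : s n - (inl F z + inr F x) = inl F (y n - z) + d n := by
    rw [hy n, map_sub]
    abel
  rw [e]
  refine (hΔ _ _).trans_eq ?_
  rw [norm_inl]

instance : QuasiBanach 𝕜 (Twisted F) where
  complete := complete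
  eq_zero w hw := by
    have h1 := qn_nonneg 𝕜 (w.1 - F w.2)
    have h2 := qn_nonneg 𝕜 w.2
    rw [norm_def] at hw
    have h3 : w.2 = 0 := QuasiBanach.eq_zero (𝕜 := 𝕜) _ (by linarith)
    have h4 : w.1 - F w.2 = 0 := QuasiBanach.eq_zero (𝕜 := 𝕜) _ (by linarith)
    rw [h3, F.map_zero', sub_zero] at h4
    exact Prod.ext h4 h3

variable (F) in
/-- The extension `0 → Y → Y ⊕_F X → X → 0`. -/
def extn : Extn 𝕜 X Y where
  Z := Twisted F
  i := ⟨inl F, 1, fun y => by rw [norm_inl, one_mul]⟩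
  π := ⟨proj F, 1, fun w => by rw [one_mul]; exact norm_proj_le w⟩
  inj := fun a b h => congrArg Prod.fst h
  exact := fun w => ⟨fun h => ⟨w.1, Prod.ext rfl h.symm⟩, by rintro ⟨y, rfl⟩; rfl⟩
  surj := fun x => ⟨sec F x, rfl⟩

end Twisted

/-! ### Extensions and quasilinear maps -/

namespace Extn

/-- The map `F : X → Y` represents the extension `0 → Y → Z → X → 0`: the map `i ∘ F` is the difference
between a bounded homogeneous section and a linear section of `π`. -/
def Realizes (E : Extn 𝕜 X Y) (F : X → Y) : Prop :=
  ∃ L : X →ₗ[𝕜] E.Z, E.IsSection fun x => E.i (F x) + L x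

theorem realizes_twisted (F : QLin 𝕜 X Y) : (Twisted.extn F).Realizes F := by
  have e : ∀ x, Twisted.inl F (F x) + Twisted.inr F x = Twisted.sec F x :=
    fun x => Prod.ext (add_zero _) (zero_add _)
  refine ⟨Twisted.inr F, fun c x => ?_, ⟨1, fun x => ?_⟩, fun x => ?_⟩
  · exact (e _).trans ((Twisted.sec_smul c x).trans (congrArg (c • ·) (e x).symm))
  · rw [one_mul]
    exact ((congrArg norm (e x)).trans (Twisted.norm_sec x)).le
  · exact congrArg (Twisted.extn F).π (e x)

/-- Subtracting a linear section from a bounded homogeneous one gives a quasilinear map. -/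
theorem exists_realizes (E : Extn 𝕜 X Y) {B : X → E.Z} (hB : E.IsSection B) {Q : ℝ}
    (hQ : Q ∈ E.defects B) : ∃ F : QLin 𝕜 X Y, ‖F‖ ≤ Q ∧ E.Realizes F := by
  obtain ⟨L, hL⟩ := E.π.1.exists_rightInverse_of_surjective (LinearMap.range_eq_top.2 E.surj)
  have hL' : ∀ x, E.π (L x) = x := fun x => LinearMap.congr_fun hL x
  have hex : ∀ x, ∃ y, E.i y = B x - L x := fun x =>
    (E.exact _).1 (by rw [map_sub, hB.2.2, hL', sub_self])
  choose F hF using hex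
  have hadd : ∀ x y, ‖F (x + y) - F x - F y‖ ≤ Q * (‖x‖ + ‖y‖) := fun x y => by
    refine hQ.2 x y _ ?_
    rw [map_sub, map_sub, hF, hF, hF, map_add]
    abel
  have hsmul : ∀ (c : 𝕜) x, F (c • x) = c • F x := fun c x => E.inj (by
    rw [map_smul, hF, hF, hB.1, map_smul, smul_sub])
  refine ⟨⟨F, hsmul, Q, hadd⟩, QLin.norm_le _ hQ.1 hadd, L, ?_⟩
  have e : (fun x => E.i (F x) + L x) = B := funext fun x => by rw [hF, sub_add_cancel]
  exact e ▸ hB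

theorem Realizes.norm_le {E : Extn 𝕜 X Y} {F : QLin 𝕜 X Y} (h : E.Realizes F) :
    ‖Ext.mk E‖ ≤ ‖F‖ := by
  obtain ⟨L, hB⟩ := h
  refine Ext.norm_mk_le hB ⟨F.norm_nonneg, fun x y w hw => ?_⟩
  have : w = F (x + y) - F x - F y := E.inj (by
    refine hw.trans ?_
    dsimp only
    rw [map_sub, map_sub, map_add]
    abel)
  rw [this]
  exact F.le_norm x y

/-- Two quasilinear maps representing the same extension differ by the difference of two linear
sections, up to a bounded map. -/
theorem Realizes.sub_mem {E : Extn 𝕜 X Y} {F G : QLin 𝕜 X Y} (h : E.Realizes F)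
    (h' : E.Realizes G) : F - G ∈ trivialMaps 𝕜 X Y := by
  obtain ⟨L, -, ⟨C, hC⟩, hL⟩ := h
  obtain ⟨L', -, ⟨C', hC'⟩, hL'⟩ := h'
  have hex : ∀ x, ∃ y, E.i y = L' x - L x := fun x => (E.exact _).1 (by
    have h1 := hL x
    have h2 := hL' x
    rw [map_add, π_i, zero_add] at h1 h2
    rw [map_sub, h1, h2, sub_self])
  choose M hM using hex
  obtain ⟨D, hD0, hD⟩ := E.i_lower
  obtain ⟨Δ, hΔ1, hΔ⟩ := qn_quasi 𝕜 E.Z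
  refine ⟨⟨⟨M, fun x y => E.inj ?_⟩, fun c x => E.inj ?_⟩, D * (Δ * (C + C')), fun x => ?_⟩
  · rw [map_add, hM, hM, hM, map_add, map_add]
    abel
  · change E.i (M (c • x)) = E.i (c • M x)
    rw [map_smul, hM, hM, map_smul, map_smul, smul_sub]
  · change ‖F x - G x - M x‖ ≤ _
    refine (hD _).trans ?_
    rw [mul_assoc, mul_assoc, add_mul]
    have e : E.i (F x - G x - M x) = (E.i (F x) + L x) - (E.i (G x) + L' x) := by
      rw [map_sub, map_sub, hM]
      abel
    rw [e]
    gcongr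
    refine (qn_sub_le_add 𝕜 hΔ _ _).trans ?_
    gcongr
    · exact hC x
    · exact hC' x

theorem Realizes.of_sub_mem {E : Extn 𝕜 X Y} {F G : QLin 𝕜 X Y} (h : E.Realizes F)
    (h' : G - F ∈ trivialMaps 𝕜 X Y) : E.Realizes G := by
  obtain ⟨L, hB, ⟨C, hC⟩, hL⟩ := h
  obtain ⟨M, D, hD⟩ := h'
  have hB' : ∀ (c : 𝕜) x, E.i (F (c • x)) + L (c • x) = c • (E.i (F x) + L x) := hB
  have hL' : ∀ x, E.π (E.i (F x) + L x) = x := hL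
  obtain ⟨I, hI0, hI⟩ := E.i.bound
  obtain ⟨Δ, hΔ1, hΔ⟩ := qn_quasi 𝕜 E.Z
  have e : ∀ x, E.i (G x) + (L - E.i.1 ∘ₗ M) x = (E.i (F x) + L x) + E.i ((G - F : QLin 𝕜 X Y) x - M x) := by
    intro x
    change E.i (G x) + (L x - E.i (M x)) = (E.i (F x) + L x) + E.i (G x - F x - M x)
    rw [map_sub, map_sub]
    abel
  have hsm : ∀ (c : 𝕜) x, (G - F : QLin 𝕜 X Y) (c • x) = c • (G - F : QLin 𝕜 X Y) x :=
    (G - F : QLin 𝕜 X Y).2.1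
  refine ⟨L - E.i.1 ∘ₗ M, fun c x => ?_, ⟨Δ * (C + I * D), fun x => ?_⟩, fun x => ?_⟩
  · dsimp only
    rw [e, e, hB', hsm, map_smul, ← smul_sub, map_smul, ← smul_add]
  · dsimp only
    rw [e, mul_assoc, add_mul, mul_assoc]
    refine (hΔ _ _).trans ?_
    gcongr
    · exact hC x
    · refine (hI _).trans ?_
      gcongr
      exact hD x
  · dsimp only
    rw [e, map_add, π_i, add_zero, hL']

/-- The equivalence `t` sends `L x + i y` to `L' x + i' y`, where `L` and `L'` are the linear sections
attached to the map `F`. It is bounded since it sends `B x + i y` to `B' x + i' y` for the bounded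
sections `B = i F + L` and `B' = i' F + L'`. -/
theorem Realizes.equivalent {E E' : Extn 𝕜 X Y} {F : X → Y} (h : E.Realizes F)
    (h' : E'.Realizes F) : E.Equivalent E' := by
  obtain ⟨L, hB, ⟨C, hC⟩, hL⟩ := h
  obtain ⟨L', hB', ⟨C', hC'⟩, hL'⟩ := h'
  have hπ : ∀ x, E.π (L x) = x := fun x => by simpa using hL x
  have hπ' : ∀ x, E'.π (L' x) = x := fun x => by simpa using hL' x
  have hex : ∀ z, ∃ y, E.i y = z - L (E.π z) := fun z =>
    (E.exact _).1 (by rw [map_sub, hπ, sub_self])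
  choose P hP using hex
  obtain ⟨D, hD0, hD⟩ := E.i_lower
  obtain ⟨I, hI0, hI⟩ := E'.i.bound
  obtain ⟨N, hN0, hN⟩ := E.π.bound
  obtain ⟨Δ, hΔ1, hΔ⟩ := qn_quasi 𝕜 E.Z
  obtain ⟨Δ', hΔ1', hΔ'⟩ := qn_quasi 𝕜 E'.Z
  have hPadd : ∀ z w, P (z + w) = P z + P w := fun z w => E.inj (by
    rw [map_add, hP, hP, hP, map_add, map_add]
    abel)
  have hPsmul : ∀ (c : 𝕜) z, P (c • z) = c • P z := fun c z => E.inj (by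
    rw [map_smul, hP, hP, map_smul, map_smul, smul_sub])
  let t : E.Z →ₗ[𝕜] E'.Z := L' ∘ₗ E.π.1 + E'.i.1 ∘ₗ ⟨⟨P, hPadd⟩, hPsmul⟩
  have ht : ∀ z, t z = L' (E.π z) + E'.i (P z) := fun z => rfl
  refine ⟨⟨t, Δ' * (max C' 0 * N + I * (D * (Δ * (1 + max C 0 * N)))), fun z => ?_⟩, fun y => ?_,
    fun z => ?_⟩
  · have hz := qn_nonneg 𝕜 z
    have hbd : ∀ {Z : Type u} [AddCommGroup Z] [Module 𝕜 Z] [Norm Z] (B : X → Z) (A : ℝ),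
        (∀ x, ‖B x‖ ≤ A * ‖x‖) → ‖B (E.π z)‖ ≤ max A 0 * N * ‖z‖ := fun B A hA => by
      have := qn_nonneg 𝕜 (E.π z)
      calc _ ≤ A * ‖E.π z‖ := hA _
        _ ≤ max A 0 * (N * ‖z‖) := by
            gcongr
            · exact le_max_left _ _
            · exact hN z
        _ = _ := by ring
    have h1 := hbd _ _ hC
    have h2 := hbd _ _ hC'
    have e1 : t z = (E'.i (F (E.π z)) + L' (E.π z)) + E'.i (P z - F (E.π z)) := by
      rw [ht, map_sub]
      abel
    have e2 : E.i (P z - F (E.π z)) = z - (E.i (F (E.π z)) + L (E.π z)) := by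
      rw [map_sub, hP]
      abel
    have h3 : ‖P z - F (E.π z)‖ ≤ D * (Δ * (1 + max C 0 * N)) * ‖z‖ := by
      refine (hD _).trans ?_
      rw [e2, mul_assoc, mul_assoc, add_mul, one_mul]
      gcongr
      refine (qn_sub_le_add 𝕜 hΔ _ _).trans ?_
      gcongr
    rw [e1, mul_assoc, add_mul]
    refine (hΔ' _ _).trans ?_
    gcongr
    rw [mul_assoc]
    refine (hI _).trans ?_
    gcongr
  · change t (E.i y) = _
    have : P (E.i y) = y := E.inj (by rw [hP, π_i, map_zero, sub_zero])
    rw [ht, π_i, map_zero, zero_add, this]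
  · change E'.π (t z) = _
    rw [ht, map_add, π_i, add_zero, hπ']

/-- Pull-back along `f` and push-out along `g` turn an extension represented by `F` into one represented
by `g ∘ F ∘ f`. -/
theorem Rel.realizes {f : Op 𝕜 X' X} {g : Op 𝕜 Y Y'} {E : Extn 𝕜 X Y} {E' : Extn 𝕜 X' Y'}
    (h : Rel f g E E') {F : X → Y} (hF : E.Realizes F) : E'.Realizes fun x => g (F (f x)) := by
  obtain ⟨T, h1, h2⟩ := h
  obtain ⟨L, hB, ⟨C, hC⟩, hL⟩ := hF
  obtain ⟨M, hM0, hM⟩ := T.bound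
  obtain ⟨N, hN0, hN⟩ := f.bound
  have hπ : ∀ x, E.π (L x) = x := fun x => by simpa using hL x
  let S : X' →ₗ[𝕜] E.pb f := (LinearMap.id.prod (L ∘ₗ f.1)).codRestrict (E.pb f) fun x => (hπ _).symm
  have hmem : ∀ x, ((x, E.i (F (f x)) + L (f x)) : X' × E.Z) ∈ E.pb f := fun x => (hL (f x)).symm
  have e : ∀ x, E'.i (g (F (f x))) + (T.1 ∘ₗ S) x = T ⟨(x, E.i (F (f x)) + L (f x)), hmem x⟩ := by
    intro x
    have hm : ((0 : X'), E.i (F (f x))) ∈ E.pb f := by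
      change f 0 = _
      rw [π_i, map_zero]
    rw [← h1 _ hm]
    refine (map_add T _ (S x)).symm.trans (congrArg T (Subtype.ext (Prod.ext ?_ rfl)))
    exact zero_add x
  refine ⟨T.1 ∘ₗ S, fun c x => ?_, ⟨M * max 1 (max C 0 * N), fun x => ?_⟩, fun x => ?_⟩
  · dsimp only
    rw [e, e, ← map_smul]
    refine congrArg T (Subtype.ext (Prod.ext rfl ?_))
    change E.i (F (f (c • x))) + L (f (c • x)) = c • (E.i (F (f x)) + L (f x))
    rw [map_smul f]
    exact hB c (f x)
  · dsimp only
    rw [e, mul_assoc]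
    refine (hM _).trans ?_
    gcongr
    have hx := qn_nonneg 𝕜 x
    refine max_le ?_ ?_
    · exact le_mul_of_one_le_left hx (le_max_left _ _)
    · have := qn_nonneg 𝕜 (f x)
      calc ‖E.i (F (f x)) + L (f x)‖ ≤ C * ‖f x‖ := hC _
        _ ≤ max C 0 * (N * ‖x‖) := by
            gcongr
            · exact le_max_left _ _
            · exact hN x
        _ = max C 0 * N * ‖x‖ := by ring
        _ ≤ _ := by gcongr; exact le_max_right _ _
  · dsimp only
    rw [e, h2]

theorem Realizes.prod {E : Extn 𝕜 X Y} {E' : Extn 𝕜 X' Y'} {F : X → Y} {F' : X' → Y'}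
    (h : E.Realizes F) (h' : E'.Realizes F') :
    (E.prod E').Realizes fun x => (F x.1, F' x.2) := by
  obtain ⟨L, hB, ⟨C, hC⟩, hL⟩ := h
  obtain ⟨L', hB', ⟨C', hC'⟩, hL'⟩ := h'
  refine ⟨L.prodMap L', fun c x => Prod.ext (hB c x.1) (hB' c x.2), ⟨max C C' ⊔ 0, fun x => ?_⟩,
    fun x => Prod.ext (hL x.1) (hL' x.2)⟩
  have h1 := qn_nonneg 𝕜 x.1
  have h2 := qn_nonneg 𝕜 x.2
  refine max_le ((hC _).trans ?_) ((hC' _).trans ?_)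
  · exact mul_le_mul ((le_max_left _ _).trans (le_max_left _ _)) (le_max_left _ _) h1
      (le_max_right _ _)
  · exact mul_le_mul ((le_max_right _ _).trans (le_max_left _ _)) (le_max_right _ _) h2
      (le_max_right _ _)

end Extn

namespace Ext

open Extn

theorem exists_realizes (c : Ext 𝕜 X Y) {r : ℝ} (h : ‖c‖ < r) :
    ∃ E, mk E = c ∧ ∃ F : QLin 𝕜 X Y, ‖F‖ < r ∧ E.Realizes F := by
  obtain ⟨E, rfl, B, hB, Q, hQ, hlt⟩ := exists_of_norm_lt c h
  obtain ⟨F, hF, hE⟩ := E.exists_realizes hB hQ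
  exact ⟨E, rfl, F, hF.trans_lt hlt, hE⟩

/-- A quasilinear map representing some extension in the class `c`. -/
noncomputable def rep (c : Ext 𝕜 X Y) : QLin 𝕜 X Y :=
  (exists_realizes c (lt_add_one _)).choose_spec.2.choose

/-- The class of the quasilinear maps which represent an extension. -/
noncomputable def toQ (c : Ext 𝕜 X Y) : QSpace 𝕜 X Y := (trivialMaps 𝕜 X Y).mkQ (rep c)

theorem toQ_mk_iff {E : Extn 𝕜 X Y} {F : QLin 𝕜 X Y} :
    toQ (mk E) = (trivialMaps 𝕜 X Y).mkQ F ↔ E.Realizes F := by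
  have h := (exists_realizes (mk E) (lt_add_one _)).choose_spec
  have h1 : Equivalent E _ := mk_eq_iff.1 h.1.symm
  have h2 : E.Realizes (rep (mk E)) := h1.symm.rel.realizes h.2.choose_spec.2
  constructor
  · intro h3
    exact h2.of_sub_mem ((Submodule.Quotient.eq _).1 h3.symm)
  · intro h3
    exact (Submodule.Quotient.eq _).2 (h2.sub_mem h3)

theorem exists_rep_realizes (c : Ext 𝕜 X Y) : ∃ E, mk E = c ∧ ∃ F : QLin 𝕜 X Y, E.Realizes F := by
  obtain ⟨E, hE, F, -, hF⟩ := exists_realizes c (lt_add_one _)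
  exact ⟨E, hE, F, hF⟩

/-- Pull-back and push-out of extensions correspond to composition of quasilinear maps. -/
theorem toQ_map (f : Op 𝕜 X' X) (g : Op 𝕜 Y Y') (c : Ext 𝕜 X Y) :
    toQ (map f g c) = QSpace.map f g (toQ c) := by
  obtain ⟨E, rfl, F, hF⟩ := exists_rep_realizes c
  rw [toQ_mk_iff.2 hF, QSpace.map_mk, map_mk, toQ_mk_iff]
  exact (rel_map E f g).realizes hF

theorem toQ_add (c d : Ext 𝕜 X Y) : toQ (c + d) = toQ c + toQ d := by
  obtain ⟨E, rfl, F, hF⟩ := exists_rep_realizes c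
  obtain ⟨E', rfl, F', hF'⟩ := exists_rep_realizes d
  rw [toQ_mk_iff.2 hF, toQ_mk_iff.2 hF', ← _root_.map_add, add_mk, toQ_mk_iff]
  exact (rel_add E E').realizes (hF.prod hF')

theorem toQ_smul (a : 𝕜) (c : Ext 𝕜 X Y) : toQ (a • c) = a • toQ c := by
  obtain ⟨E, rfl, F, hF⟩ := exists_rep_realizes c
  rw [toQ_mk_iff.2 hF, ← _root_.map_smul, smul_mk, toQ_mk_iff]
  exact (rel_smul a E).realizes hF

theorem norm_toQ (c : Ext 𝕜 X Y) : ‖toQ c‖ = ‖c‖ := by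
  refine le_antisymm (le_of_forall_gt fun r hr => ?_) (le_of_forall_gt fun r hr => ?_)
  · obtain ⟨E, rfl, F, hF, hE⟩ := exists_realizes c hr
    rw [toQ_mk_iff.2 hE]
    exact (quot_qn_le _ F).trans_lt hF
  · obtain ⟨F, hF, hlt⟩ := quot_qn_lt _ _ hr
    obtain ⟨E, rfl⟩ := exists_rep c
    exact ((toQ_mk_iff.1 hF.symm).norm_le).trans_lt hlt

theorem toQ_injective : Function.Injective (toQ : Ext 𝕜 X Y → QSpace 𝕜 X Y) := by
  intro c d h
  obtain ⟨E, rfl, F, hF⟩ := exists_rep_realizes c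
  obtain ⟨E', rfl⟩ := exists_rep d
  rw [toQ_mk_iff.2 hF] at h
  exact mk_eq_iff.2 (hF.equivalent (toQ_mk_iff.1 h.symm))

theorem toQ_surjective : Function.Surjective (toQ : Ext 𝕜 X Y → QSpace 𝕜 X Y) := by
  intro c
  obtain ⟨F, rfl⟩ := Submodule.mkQ_surjective _ c
  exact ⟨mk (Twisted.extn F), toQ_mk_iff.2 (realizes_twisted F)⟩

variable (𝕜 X Y) in
/-- `toQ` as a linear map. -/
noncomputable def toQLinear : Ext 𝕜 X Y →ₗ[𝕜] QSpace 𝕜 X Y where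
  toFun := toQ
  map_add' := toQ_add
  map_smul' := toQ_smul

variable (𝕜 X Y) in
/-- The isometric isomorphism between `Ext(X, Y)` and `𝒬(X, Y)`. -/
noncomputable def equivQ : Ext 𝕜 X Y ≃ₗ[𝕜] QSpace 𝕜 X Y :=
  LinearEquiv.ofBijective (toQLinear 𝕜 X Y) ⟨toQ_injective, toQ_surjective⟩

end Ext

end extensions

/-! ### Completeness of operator spaces and quotients -/

section completeness

variable {𝕜 : Type} [RCLike 𝕜] {E : Type*} {F : Type*} [AddCommGroup E] [Module 𝕜 E] [Norm E]
  [AddCommGroup F] [Module 𝕜 F] [Norm F]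

theorem Op.complete [SemiQuasiNormed 𝕜 E] [QuasiBanach 𝕜 F] : IsCompleteQN (Op 𝕜 E F) := by
  intro s hs
  obtain ⟨Δ, hΔ1, hΔ⟩ := qn_quasi 𝕜 F
  have hpt : ∀ x, ∃ y, Tendsto (fun n => ‖s n x - y‖) atTop (𝓝 0) := fun x =>
    QuasiBanach.complete (𝕜 := 𝕜) (fun n => s n x) fun ε hε => by
      have hx := qn_nonneg 𝕜 x
      obtain ⟨N, hN⟩ := hs (ε / (‖x‖ + 1)) (by positivity)
      refine ⟨N, fun m hm n hn => ?_⟩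
      rw [← Op.sub_apply]
      calc _ ≤ ‖s m - s n‖ * ‖x‖ := Op.le_norm _ _
        _ ≤ ε / (‖x‖ + 1) * ‖x‖ := by gcongr; exact (hN m hm n hn).le
        _ < ε / (‖x‖ + 1) * (‖x‖ + 1) := by gcongr; linarith
        _ = ε := by field_simp
  choose T hT using hpt
  have hnear : ∀ ε > 0, ∀ N : ℕ, (∀ m ≥ N, ∀ n ≥ N, ‖s m - s n‖ < ε) → ∀ m ≥ N, ∀ x,
      ‖s m x - T x‖ ≤ Δ * ε * ‖x‖ := fun ε hε N hN m hm x => by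
    have hl : Tendsto (fun n => Δ * (ε * ‖x‖ + ‖s n x - T x‖)) atTop (𝓝 (Δ * (ε * ‖x‖ + 0))) :=
      ((hT x).const_add _).const_mul _
    rw [add_zero, ← mul_assoc] at hl
    refine ge_of_tendsto hl ?_
    filter_upwards [eventually_ge_atTop N] with n hn
    refine (qn_sub_le 𝕜 hΔ _ (s n x) _).trans ?_
    gcongr
    rw [← Op.sub_apply]
    have hx := qn_nonneg 𝕜 x
    exact (Op.le_norm _ _).trans (by gcongr; exact (hN m hm n hn).le)
  have hadd : ∀ x y, T (x + y) = T x + T y := fun x y => by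
    refine limit_unique 𝕜 (hT (x + y)) ?_
    refine squeeze_zero (fun _ => qn_nonneg 𝕜 _) (fun n => ?_)
      (by simpa using ((hT x).add (hT y)).const_mul Δ)
    rw [map_add, add_sub_add_comm]
    exact hΔ _ _
  have hsmul : ∀ (c : 𝕜) x, T (c • x) = c • T x := fun c x => by
    refine limit_unique 𝕜 (hT (c • x)) ?_
    refine squeeze_zero (fun _ => qn_nonneg 𝕜 _) (fun n => ?_)
      (by simpa using (hT x).const_mul ‖c‖)
    rw [map_smul, ← smul_sub, qn_smul 𝕜]
  obtain ⟨N₁, hN₁⟩ := hs 1 one_pos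
  let T' : Op 𝕜 E F := ⟨⟨⟨T, hadd⟩, hsmul⟩, Δ * (‖s N₁‖ + Δ * 1), fun x => by
    have h1 := qn_sub_le_add 𝕜 hΔ (s N₁ x) (s N₁ x - T x)
    rw [sub_sub_cancel] at h1
    refine h1.trans ?_
    rw [mul_assoc, add_mul]
    gcongr
    · exact Op.le_norm _ _
    · exact hnear 1 one_pos N₁ hN₁ N₁ le_rfl x⟩
  refine ⟨T', tendsto_order.2 ⟨fun a ha => Eventually.of_forall fun _ =>
    ha.trans_le (Op.norm_nonneg _), fun ε hε => ?_⟩⟩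
  obtain ⟨N, hN⟩ := hs (ε / (2 * Δ)) (by positivity)
  filter_upwards [eventually_ge_atTop N] with m hm
  refine (Op.norm_le (s m - T') (C := ε / 2) (by positivity) fun x => ?_).trans_lt (half_lt_self hε)
  refine (hnear _ (by positivity) N hN m hm x).trans_eq ?_
  have : Δ ≠ 0 := by positivity
  field_simp

/-- Every Cauchy sequence has a rapidly Cauchy subsequence, so completeness has to be verified only for
sequences with prescribed small increments. -/
theorem isCompleteQN_of_fast [SemiQuasiNormed 𝕜 E] (r : ℕ → ℝ) (hr : ∀ n, 0 < r n)
    (h : ∀ s : ℕ → E, (∀ n, ‖s (n + 1) - s n‖ < r n) →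
      ∃ x, Tendsto (fun n => ‖s n - x‖) atTop (𝓝 0)) : IsCompleteQN E := by
  intro s hs
  obtain ⟨Δ, hΔ1, hΔ⟩ := qn_quasi 𝕜 E
  choose N hN using fun n => hs (r n) (hr n)
  let φ : ℕ → ℕ := fun n => n + ∑ k ∈ Finset.range (n + 1), N k
  have hφ1 : ∀ n, N n ≤ φ n := fun n =>
    (Finset.single_le_sum (f := N) (fun _ _ => Nat.zero_le _)
      (Finset.self_mem_range_succ n)).trans (Nat.le_add_left _ _)
  have hφ2 : ∀ n, N n ≤ φ (n + 1) := fun n =>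
    (Finset.single_le_sum (f := N) (fun _ _ => Nat.zero_le _)
      (Finset.mem_range.2 (by omega))).trans (Nat.le_add_left _ _)
  obtain ⟨x, hx⟩ := h (fun n => s (φ n)) fun n => hN n _ (hφ2 n) _ (hφ1 n)
  refine ⟨x, tendsto_order.2 ⟨fun a ha => Eventually.of_forall fun _ =>
    ha.trans_le (qn_nonneg 𝕜 _), fun ε hε => ?_⟩⟩
  obtain ⟨M, hM⟩ := hs (ε / (2 * Δ)) (by positivity)
  obtain ⟨k, hk, hMk⟩ := (((tendsto_order.1 hx).2 (ε / (2 * Δ)) (by positivity)).and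
    (eventually_ge_atTop M)).exists
  filter_upwards [eventually_ge_atTop M] with n hn
  calc _ ≤ _ := qn_sub_le 𝕜 hΔ (s n) (s (φ k)) x
    _ < Δ * (ε / (2 * Δ) + ε / (2 * Δ)) := by
        gcongr
        exact hM n hn _ (hMk.trans (Nat.le_add_right _ _))
    _ = ε := by field_simp; norm_num

/-- Quotients of complete spaces are complete, whether or not the subspace is closed. -/
theorem quotient_complete [SemiQuasiNormed 𝕜 E] (hE : IsCompleteQN E) (p : Submodule 𝕜 E) :
    IsCompleteQN (E ⧸ p) := by
  obtain ⟨Δ, hΔ1, hΔ⟩ := qn_quasi 𝕜 E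
  have hΔ0 : 0 < Δ := by linarith
  refine isCompleteQN_of_fast (𝕜 := 𝕜) (fun n => (1 / (2 * Δ)) ^ n) (fun n => by positivity) ?_
  intro s hs
  choose d hd hd' using fun n => quot_qn_lt p _ (hs n)
  obtain ⟨x₀, hx₀⟩ := p.mkQ_surjective (s 0)
  let x : ℕ → E := fun n => Nat.rec x₀ (fun k x => x + d k) n
  have hx1 : ∀ n, x (n + 1) = x n + d n := fun n => rfl
  have hx : ∀ n, p.mkQ (x n) = s n := by
    intro n
    induction n with
    | zero => exact hx₀
    | succ n ih => rw [hx1, map_add, ih, hd, add_sub_cancel]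
  obtain ⟨z, hz, -⟩ := fast_limit 𝕜 hE hΔ1 hΔ x (fun n => (1 / (2 * Δ)) ^ n)
    (fun n => by positivity)
    (fun n => by
      apply le_of_eq
      rw [pow_succ]
      field_simp)
    (fun n => by
      rw [hx1, add_sub_cancel_left]
      exact (hd' n).le)
  refine ⟨p.mkQ z, squeeze_zero (fun _ => qn_nonneg 𝕜 _) (fun n => ?_) hz⟩
  rw [← hx, ← map_sub]
  exact quot_qn_le p _

/-- Completeness is invariant under linear homeomorphisms. -/
theorem IsCompleteQN.of_equiv [SemiQuasiNormed 𝕜 E] [SemiQuasiNormed 𝕜 F] (hE : IsCompleteQN E)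
    (T : Op 𝕜 E F) (S : Op 𝕜 F E) (h : ∀ y, T (S y) = y) : IsCompleteQN F := by
  intro s hs
  obtain ⟨C, hC0, hC⟩ := S.bound
  obtain ⟨x, hx⟩ := hE (fun n => S (s n)) fun ε hε => by
    obtain ⟨N, hN⟩ := hs (ε / (C + 1)) (by positivity)
    refine ⟨N, fun m hm n hn => ?_⟩
    rw [← map_sub]
    have h1 := qn_nonneg 𝕜 (s m - s n)
    calc _ ≤ C * ‖s m - s n‖ := hC _
      _ ≤ (C + 1) * ‖s m - s n‖ := by gcongr; linarith
      _ < (C + 1) * (ε / (C + 1)) := by gcongr; exact hN m hm n hn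
      _ = ε := by field_simp
  refine ⟨T x, (T.tendsto hx).congr fun n => ?_⟩
  rw [h]

/-- An injective linear map is bounded below as soon as the open unit ball is contained in the image
of a bounded set. -/
theorem le_of_unit_ball [SemiQuasiNormed 𝕜 E] [SemiQuasiNormed 𝕜 F] (T : E →ₗ[𝕜] F)
    (hT : Function.Injective T) {C : ℝ} (h : ∀ y, ‖y‖ < 1 → ∃ x, T x = y ∧ ‖x‖ ≤ C) (x : E) :
    ‖x‖ ≤ C * ‖T x‖ := by
  have hC : 0 ≤ C := by
    obtain ⟨x, -, hx⟩ := h 0 (by rw [qn_zero 𝕜]; exact one_pos)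
    exact (qn_nonneg 𝕜 x).trans hx
  have key : ∀ ε > 0, ‖x‖ ≤ C * (‖T x‖ + ε) := fun ε hε => by
    have h0 := qn_nonneg 𝕜 (T x)
    have ht : 0 < ‖T x‖ + ε := by positivity
    have hn : ‖(((‖T x‖ + ε : ℝ) : 𝕜))⁻¹‖ = (‖T x‖ + ε)⁻¹ := by
      rw [norm_inv, RCLike.norm_ofReal, abs_of_pos ht]
    obtain ⟨x', hx', hle⟩ := h ((((‖T x‖ + ε : ℝ) : 𝕜))⁻¹ • T x) (by
      rw [qn_smul 𝕜, hn, inv_mul_lt_iff₀ ht]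
      linarith)
    rw [← map_smul] at hx'
    rw [hT hx', qn_smul 𝕜, hn, inv_mul_le_iff₀ ht] at hle
    linarith
  refine le_of_forall_pos_le_add fun ε hε => (key (ε / (C + 1)) (by positivity)).trans ?_
  rw [mul_add]
  gcongr
  rw [mul_div_assoc', div_le_iff₀ (by positivity)]
  nlinarith

end completeness

/-! ### Extensions and presentations -/

section presentations

variable {𝕜 : Type} [RCLike 𝕜] {X Y X' Y' : Type u}
    [AddCommGroup X] [Module 𝕜 X] [Norm X] [QuasiBanach 𝕜 X]
    [AddCommGroup Y] [Module 𝕜 Y] [Norm Y] [QuasiBanach 𝕜 Y]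
    [AddCommGroup X'] [Module 𝕜 X'] [Norm X'] [QuasiBanach 𝕜 X']
    [AddCommGroup Y'] [Module 𝕜 Y'] [Norm Y'] [QuasiBanach 𝕜 Y']

namespace Presentation

open Extn

theorem q_lt_one (P : Presentation 𝕜 X Y) : P.q < 1 := P.q_lt.trans_le P.p_le_one

instance (P : Presentation 𝕜 X Y) : QuasiBanach 𝕜 P.L := ellq_quasiBanach P.q_pos P.q_lt_one

instance (P : Presentation 𝕜 X Y) : QuasiBanach 𝕜 P.K := QuasiBanach.submodule (by
  intro s x hs hx
  have h1 := P.ϖ.tendsto hx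
  have h2 : ∀ n, P.ϖ (s n) = 0 := hs
  simp only [h2] at h1
  have h3 : Tendsto (fun _ : ℕ => ‖(0 : X) - 0‖) atTop (𝓝 0) := by simp [qn_zero 𝕜]
  exact limit_unique 𝕜 h1 h3)

/-- The extension `0 → K → ℓ_q(I) → X → 0`. -/
noncomputable def extn (P : Presentation 𝕜 X Y) : Extn 𝕜 X P.K where
  Z := P.L
  i := Op.incl P.K
  π := P.ϖ
  inj := Subtype.val_injective
  exact := fun z => ⟨fun h => ⟨⟨z, h⟩, rfl⟩, by rintro ⟨k, rfl⟩; exact k.2⟩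
  surj := P.surj

/-- The class of the push-out along `u : K → Y` of the extension `0 → K → ℓ_q(I) → X → 0`. -/
noncomputable def toExt (P : Presentation 𝕜 X Y) (u : Op 𝕜 P.K Y) : Ext 𝕜 X Y :=
  Ext.map Op.id u (Ext.mk P.extn)

/-- The class of an extension is the push-out along `u` when `u` is the restriction of an operator from
`ℓ_q(I)` to the middle space lifting `ϖ`. -/
theorem toExt_eq_mk_iff (P : Presentation 𝕜 X Y) {u : Op 𝕜 P.K Y} {E : Extn 𝕜 X Y} :
    P.toExt u = Ext.mk E ↔
      ∃ T : Op 𝕜 P.L E.Z, (∀ z, E.π (T z) = P.ϖ z) ∧ ∀ k : P.K, T k = E.i (u k) := by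
  constructor
  · intro h
    have h1 : (P.extn.map Op.id u).Equivalent E := Ext.mk_eq_iff.1 h
    obtain ⟨T, h2, h3⟩ := ((rel_map P.extn Op.id u).comp h1.rel).cast (f' := Op.id) (g' := u)
      (fun _ => rfl) fun _ => rfl
    let A : Op 𝕜 P.L (P.extn.pb (Op.id : Op 𝕜 X X)) :=
      Op.cod _ (P.ϖ.pair (Op.id : Op 𝕜 P.L P.L)) fun z => rfl
    refine ⟨T.comp A, fun z => h3 _, fun k => ?_⟩
    have hm : ((0 : X), P.extn.i k) ∈ P.extn.pb (Op.id : Op 𝕜 X X) := k.2.symm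
    have hA : A (k : P.L) = ⟨(0, P.extn.i k), hm⟩ := Subtype.ext (Prod.ext k.2 rfl)
    rw [Op.comp_apply, hA]
    exact h2 k hm
  · rintro ⟨T, h1, h2⟩
    have h : Rel Op.id u P.extn E :=
      ⟨T.comp ((Op.snd : Op 𝕜 (X × P.L) P.L).comp (Op.incl _)), fun k hk => h2 k,
        fun w => (h1 _).trans w.2.symm⟩
    exact Ext.mk_map_eq h

theorem toExt_add (P : Presentation 𝕜 X Y) (u v : Op 𝕜 P.K Y) :
    P.toExt (u + v) = P.toExt u + P.toExt v :=
  Ext.mk_eq_mk (rel_map P.extn Op.id (u + v)) (Ext.rel_prod_self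
    ((((rel_map P.extn Op.id u).prod (rel_map P.extn Op.id v)).comp (Ext.rel_add _ _)).cast
      (f' := Op.diag) (fun _ => rfl) fun _ => rfl)) (fun _ => rfl) fun _ => rfl

theorem toExt_smul (P : Presentation 𝕜 X Y) (c : 𝕜) (u : Op 𝕜 P.K Y) :
    P.toExt (c • u) = c • P.toExt u :=
  Ext.mk_eq_mk (rel_map P.extn Op.id (c • u)) ((rel_map P.extn Op.id u).comp (Ext.rel_smul c _))
    (fun _ => rfl) fun _ => rfl

/-- A push-out along `u` splits exactly when `u` extends to `ℓ_q(I)`. -/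
theorem toExt_eq_zero_iff (P : Presentation 𝕜 X Y) (u : Op 𝕜 P.K Y) :
    P.toExt u = 0 ↔ u ∈ P.restrictions := by
  rw [Ext.zero_def, toExt_eq_mk_iff]
  constructor
  · rintro ⟨T, -, h⟩
    exact ⟨(Op.fst : Op 𝕜 (Y × X) Y).comp T, fun k => (congrArg Prod.fst (h k)).symm⟩
  · rintro ⟨v, h⟩
    exact ⟨v.pair P.ϖ, fun z => rfl, fun k => Prod.ext (h k).symm k.2⟩

/-- The operator `u ↦ [push-out along u]`. -/
noncomputable def toExtOp (P : Presentation 𝕜 X Y) : Op 𝕜 (Op 𝕜 P.K Y) (Ext 𝕜 X Y) :=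
  ⟨{ toFun := P.toExt, map_add' := P.toExt_add, map_smul' := P.toExt_smul },
    ‖Ext.mk P.extn‖, fun u => by
      have := Ext.norm_map_le (Op.id : Op 𝕜 X X) u zero_le_one (fun x => (one_mul _).ge)
        u.norm_nonneg u.le_norm (Ext.mk P.extn)
      rw [mul_one, mul_comm] at this
      exact this⟩

/-- Every class in the unit ball of `Ext(X, Y)` is the push-out along an operator with controlled
norm. By Kalton's estimate, the vectors `(F ϖ e_i, ϖ e_i)` of the twisted sum by a quasilinear map
`F` of norm at most `1` are the images of the unit vectors under an operator defined on
`ℓ_q(I)`. -/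
theorem exists_toExt_eq (P : Presentation 𝕜 X Y) : ∃ C : ℝ, ∀ c : Ext 𝕜 X Y, ‖c‖ < 1 →
    ∃ u : Op 𝕜 P.K Y, P.toExt u = c ∧ ‖u‖ ≤ C := by
  obtain ⟨Δ, hΔ1, hΔ⟩ := qn_quasi 𝕜 X
  obtain ⟨Δ', hΔ1', hΔ'⟩ := qn_quasi 𝕜 Y
  obtain ⟨A, hA0, hA⟩ := P.pNormable_left.exists_norm_sum_le (X := X) P.q_pos P.q_lt.le
  obtain ⟨D, hD0, hD⟩ := exists_norm_map_sum_sub_le P.pNormable_left P.pNormable_right P.q_pos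
    P.q_lt P.p_le_one
  obtain ⟨M, hM0, hM⟩ := P.ϖ.bound
  have hq := P.q_pos
  refine ⟨(Δ' * (Δ' + 1) + Δ) * ((D + A) * M), fun c hc => ?_⟩
  obtain ⟨E, rfl, F, hF, hE⟩ := Ext.exists_realizes c hc
  have hΔF := Twisted.norm_le_of_quasi (F := F) (by linarith) (by linarith) hΔ hΔ' hF.le
  let e : P.I → X := fun i => P.ϖ (ellqUnit 𝕜 P.q i)
  have he : ∀ i, ‖e i‖ ≤ M := fun i => by
    have := hM (ellqUnit 𝕜 P.q i)
    rwa [ellqUnit_norm P.q_pos, mul_one] at this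
  obtain ⟨T, hT, hTn⟩ := exists_ellq_op (𝕜 := 𝕜) P.q_pos (by positivity) hΔF
    (fun i => Twisted.sec F (e i)) (C := (D + A) * M) (by positivity) fun a s => by
      have e1 : ∑ i ∈ s, a i • Twisted.sec F (e i)
          = ((∑ i ∈ s, F (a i • e i), ∑ i ∈ s, a i • e i) : Y × X) := by
        simp only [← Twisted.sec_smul]
        exact (prod_mk_sum s (fun i => F (a i • e i)) fun i => a i • e i).symm
      have hx : ∑ i ∈ s, ‖a i • e i‖ ^ P.q ≤ M ^ P.q * ∑ i ∈ s, ‖a i‖ ^ P.q := by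
        rw [Finset.mul_sum]
        refine Finset.sum_le_sum fun i _ => ?_
        rw [← Real.mul_rpow hM0 (norm_nonneg _), qn_smul 𝕜, mul_comm M]
        have := qn_nonneg 𝕜 (e i)
        gcongr
        exact he i
      have hx0 : 0 ≤ ∑ i ∈ s, ‖a i • e i‖ ^ P.q :=
        Finset.sum_nonneg fun i _ => Real.rpow_nonneg (qn_nonneg 𝕜 _) _
      have hx' : (∑ i ∈ s, ‖a i • e i‖ ^ P.q) ^ (1 / P.q)
          ≤ M * (∑ i ∈ s, ‖a i‖ ^ P.q) ^ (1 / P.q) := by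
        refine (Real.rpow_le_rpow hx0 hx (by positivity)).trans_eq ?_
        rw [Real.mul_rpow (by positivity) (by positivity), ← Real.rpow_mul hM0,
          mul_one_div_cancel P.q_pos.ne', Real.rpow_one]
      have h1 := hD F F.map_zero' (fun x y => (F.le_norm x y).trans (by
        have := qn_nonneg 𝕜 x
        have := qn_nonneg 𝕜 y
        exact mul_le_of_le_one_left (by positivity) hF.le)) s fun i => a i • e i
      have h2 := hA s fun i => a i • e i
      rw [qn_sub_comm 𝕜] at h1
      calc ‖∑ i ∈ s, a i • Twisted.sec F (e i)‖
          = ‖∑ i ∈ s, F (a i • e i) - F (∑ i ∈ s, a i • e i)‖ + ‖∑ i ∈ s, a i • e i‖ := by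
            rw [e1]; rfl
        _ ≤ (D + A) * (∑ i ∈ s, ‖a i • e i‖ ^ P.q) ^ (1 / P.q) := by
            rw [add_mul]
            exact add_le_add h1 h2
        _ ≤ (D + A) * (M * (∑ i ∈ s, ‖a i‖ ^ P.q) ^ (1 / P.q)) := by gcongr
        _ = _ := by ring
  have hπT : (Twisted.extn F).π.comp T = P.ϖ := ellq_op_ext P.q_pos fun i =>
    congrArg (Twisted.extn F).π (hT i)
  have hπT' : ∀ z, (Twisted.extn F).π (T z) = P.ϖ z := fun z => congrArg (fun S => S z) hπT
  have hk : ∀ k : P.K, T k = Twisted.inl F (T k).1 := fun k => by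
    obtain ⟨y, hy⟩ := ((Twisted.extn F).exact (T k)).1 ((hπT' k).trans k.2)
    rw [← hy]
    rfl
  let u : Op 𝕜 P.K Y := ⟨LinearMap.fst 𝕜 Y X ∘ₗ T.1 ∘ₗ P.K.subtype, _, fun k => by
    have := hTn k
    rw [hk, Twisted.norm_inl] at this
    exact this⟩
  refine ⟨u, ?_, Op.norm_le _ (by positivity) fun k => ?_⟩
  · have h1 : Ext.mk E = Ext.mk (Twisted.extn F) :=
      Ext.mk_eq_iff.2 (hE.equivalent (realizes_twisted F))
    rw [h1, toExt_eq_mk_iff]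
    exact ⟨T, hπT', hk⟩
  · have := hTn k
    rw [hk, Twisted.norm_inl] at this
    exact this

theorem toExt_surjective (P : Presentation 𝕜 X Y) : Function.Surjective P.toExt := by
  obtain ⟨C, hC⟩ := P.exists_toExt_eq
  intro c
  have hpos : 0 < ‖c‖ + 1 := by
    have := qn_nonneg 𝕜 c
    positivity
  have hne : ((‖c‖ + 1 : ℝ) : 𝕜) ≠ 0 := RCLike.ofReal_ne_zero.2 hpos.ne'
  obtain ⟨u, hu, -⟩ := hC (((‖c‖ + 1 : ℝ) : 𝕜)⁻¹ • c) (by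
    rw [qn_smul 𝕜, norm_inv, RCLike.norm_ofReal, abs_of_pos hpos, inv_mul_lt_iff₀ hpos]
    linarith)
  exact ⟨((‖c‖ + 1 : ℝ) : 𝕜) • u, by rw [toExt_smul, hu, smul_inv_smul₀ hne]⟩

/-- The operator `Ext^ϖ(X, Y) → Ext(X, Y)` sending `[u]` to the class of the push-out along `u`. -/
noncomputable def piToExt (P : Presentation 𝕜 X Y) : Op 𝕜 P.ExtPi (Ext 𝕜 X Y) :=
  Op.liftQ P.restrictions P.toExtOp fun u hu => (P.toExt_eq_zero_iff u).2 hu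

theorem cls_surjective (P : Presentation 𝕜 X Y) : Function.Surjective P.cls :=
  P.restrictions.mkQ_surjective

theorem piToExt_bijective (P : Presentation 𝕜 X Y) : Function.Bijective P.piToExt := by
  constructor
  · rw [injective_iff_map_eq_zero]
    intro c hc
    obtain ⟨u, rfl⟩ := P.cls_surjective c
    exact (Submodule.Quotient.mk_eq_zero _).2 ((P.toExt_eq_zero_iff u).1 hc)
  · intro c
    obtain ⟨u, rfl⟩ := P.toExt_surjective c
    exact ⟨P.cls u, rfl⟩

/-- The inverse `Ext(X, Y) → Ext^ϖ(X, Y)` of `piToExt`. -/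
noncomputable def extToPi (P : Presentation 𝕜 X Y) : Op 𝕜 (Ext 𝕜 X Y) P.ExtPi :=
  ⟨(LinearEquiv.ofBijective P.piToExt.1 P.piToExt_bijective).symm.toLinearMap, by
    obtain ⟨C, hC⟩ := P.exists_toExt_eq
    refine ⟨C, fun c => ?_⟩
    obtain ⟨x, rfl⟩ := P.piToExt_bijective.2 c
    refine Eq.trans_le (congrArg norm
      ((LinearEquiv.ofBijective P.piToExt.1 P.piToExt_bijective).symm_apply_apply x))
      (le_of_unit_ball P.piToExt.1 P.piToExt_bijective.1 (fun c hc => ?_) x)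
    obtain ⟨u, rfl, hu⟩ := hC c hc
    exact ⟨P.cls u, rfl, (quot_qn_le _ u).trans hu⟩⟩

@[simp] theorem extToPi_piToExt (P : Presentation 𝕜 X Y) (c : P.ExtPi) :
    P.extToPi (P.piToExt c) = c :=
  (LinearEquiv.ofBijective P.piToExt.1 P.piToExt_bijective).symm_apply_apply c

@[simp] theorem piToExt_extToPi (P : Presentation 𝕜 X Y) (c : Ext 𝕜 X Y) :
    P.piToExt (P.extToPi c) = c :=
  (LinearEquiv.ofBijective P.piToExt.1 P.piToExt_bijective).apply_symm_apply c

theorem extPi_complete (P : Presentation 𝕜 X Y) : IsCompleteQN P.ExtPi :=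
  quotient_complete (𝕜 := 𝕜) (Op.complete (𝕜 := 𝕜)) _

end Presentation

end presentations

/-! ### The action of `Ext^ϖ` on operators -/

section action

variable {𝕜 : Type} [RCLike 𝕜] {X Y X' Y' : Type u}
    [AddCommGroup X] [Module 𝕜 X] [Norm X] [QuasiBanach 𝕜 X]
    [AddCommGroup Y] [Module 𝕜 Y] [Norm Y] [QuasiBanach 𝕜 Y]
    [AddCommGroup X'] [Module 𝕜 X'] [Norm X'] [QuasiBanach 𝕜 X']
    [AddCommGroup Y'] [Module 𝕜 Y'] [Norm Y'] [QuasiBanach 𝕜 Y']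

/-- Operators into the middle space of an extension which vanish in the quotient factor through the
subspace. -/
theorem Extn.exists_factor {G : Type*} [AddCommGroup G] [Module 𝕜 G] [Norm G]
    (E : Extn 𝕜 X Y) (S : Op 𝕜 G E.Z) (hS : ∀ x, E.π (S x) = 0) :
    ∃ W : Op 𝕜 G Y, ∀ x, E.i (W x) = S x := by
  choose W hW using fun x => (E.exact _).1 (hS x)
  obtain ⟨C, hC0, hC⟩ := E.i_lower
  obtain ⟨D, hD⟩ := S.2
  refine ⟨⟨⟨⟨W, fun x y => E.inj ?_⟩, fun c x => E.inj ?_⟩, C * D, fun x => ?_⟩, hW⟩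
  · rw [map_add, hW, hW, hW, map_add]
  · change E.i (W (c • x)) = E.i (c • W x)
    rw [map_smul, hW, hW, map_smul]
  · refine (hC _).trans ?_
    rw [mul_assoc]
    gcongr
    exact (congrArg norm (hW x)).trans_le (hD x)

/-- Operators which vanish on the kernel of an operator onto factor through it. -/
theorem exists_op_factor {G H : Type*} [AddCommGroup G] [Module 𝕜 G] [Norm G] [QuasiBanach 𝕜 G]
    [AddCommGroup H] [Module 𝕜 H] [Norm H] [QuasiBanach 𝕜 H] {E : Type*} [AddCommGroup E]
    [Module 𝕜 E] [Norm E] [SemiQuasiNormed 𝕜 E] (R : Op 𝕜 G H) (hR : Function.Surjective R)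
    (S : Op 𝕜 G E) (h : ∀ x, R x = 0 → S x = 0) : ∃ v : Op 𝕜 H E, ∀ x, v (R x) = S x := by
  obtain ⟨C, hC0, hC⟩ := open_mapping R hR
  choose w hw hwC using hC
  obtain ⟨D, hD0, hD⟩ := S.bound
  have key : ∀ x x', R x = R x' → S x = S x' := fun x x' hx =>
    sub_eq_zero.1 (by rw [← map_sub]; exact h _ (by rw [map_sub, hx, sub_self]))
  refine ⟨⟨⟨⟨fun y => S (w y), fun y y' => ?_⟩, fun c y => ?_⟩, D * C, fun y => ?_⟩,
    fun x => key _ _ (hw _)⟩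
  · rw [← map_add]
    exact key _ _ (by rw [map_add, hw, hw, hw])
  · refine Eq.trans (key _ _ ?_) (map_smul S c (w y))
    rw [map_smul, hw, hw]
  · refine (hD _).trans ?_
    rw [mul_assoc]
    gcongr
    exact hwC y

namespace Presentation

open Extn

/-- If `T` and `T'` lift the two presentations to extensions `E` and `E'`, and `R` maps the pull-back of
`E` along `f` to `E'`, then `T' z' - R (ϖ' z', T z)` lies in `Y'` for all `(z', z)` in the fibre
product; this defines the required extension of `u' k' - g (u k)`. -/
theorem induces_of_map_eq (P : Presentation 𝕜 X Y) (P' : Presentation 𝕜 X' Y') {f : Op 𝕜 X' X}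
    {g : Op 𝕜 Y Y'} {u : Op 𝕜 P.K Y} {u' : Op 𝕜 P'.K Y'}
    (h : Ext.map f g (P.toExt u) = P'.toExt u') : P.Induces P' f g u u' := by
  obtain ⟨E, hE⟩ := Ext.exists_rep (P.toExt u)
  obtain ⟨E', hE'⟩ := Ext.exists_rep (P'.toExt u')
  obtain ⟨T, h1, h2⟩ := P.toExt_eq_mk_iff.1 hE.symm
  obtain ⟨T', h1', h2'⟩ := P'.toExt_eq_mk_iff.1 hE'.symm
  rw [← hE, ← hE', Ext.map_mk, Ext.mk_eq_iff] at h
  obtain ⟨R, h3, h4⟩ := ((rel_map E f g).comp h.rel).cast (f' := f) (g' := g)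
    (fun _ => rfl) fun _ => rfl
  let A : Op 𝕜 (P.fiber P' f) (E.pb f) := Op.cod _
    ((P'.ϖ.comp (Op.fst.comp (Op.incl _))).pair (T.comp (Op.snd.comp (Op.incl _)))) fun w => by
      change f (P'.ϖ w.1.1) = E.π (T w.1.2)
      rw [h1]
      exact w.2.symm
  have hA : ∀ w, (A w).1.1 = P'.ϖ w.1.1 := fun w => rfl
  let S : Op 𝕜 (P.fiber P' f) E'.Z := T'.comp (Op.fst.comp (Op.incl _)) - R.comp A
  have hS : ∀ w, S w = T' w.1.1 - R (A w) := fun w => rfl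
  obtain ⟨W, hW⟩ := E'.exists_factor S fun w => by
    rw [hS, map_sub, h1', h4, hA, sub_self]
  refine ⟨W, fun k' k hk => E'.inj ?_⟩
  have hm : ((0 : X'), E.i (u k)) ∈ E.pb f := by
    change f 0 = _
    rw [π_i, map_zero]
  have hAk : A ⟨(k', k), hk⟩ = ⟨(0, E.i (u k)), hm⟩ := Subtype.ext (Prod.ext k'.2 (h2 k))
  rw [hW, hS, hAk, h3, map_sub, ← h2']

instance (P : Presentation 𝕜 X Y) (P' : Presentation 𝕜 X' Y') (f : Op 𝕜 X' X) :
    QuasiBanach 𝕜 (P.fiber P' f) := QuasiBanach.submodule (by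
  intro s w hs hw
  have h1 := (P.ϖ.comp (Op.snd : Op 𝕜 (P'.L × P.L) P.L)).tendsto hw
  have h2 := ((f.comp P'.ϖ).comp (Op.fst : Op 𝕜 (P'.L × P.L) P'.L)).tendsto hw
  have h3 : ∀ n, P.ϖ.comp Op.snd (s n) = (f.comp P'.ϖ).comp Op.fst (s n) := hs
  simp only [h3] at h1
  exact limit_unique 𝕜 h1 h2)

/-- The operators induced by the same `u` differ by restrictions: the difference of the two operators
on the fibre product factors through the projection onto `ℓ_{q'}(I')`. -/
theorem Induces.sub_mem {P : Presentation 𝕜 X Y} {P' : Presentation 𝕜 X' Y'} {f : Op 𝕜 X' X}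
    {g : Op 𝕜 Y Y'} {u : Op 𝕜 P.K Y} {u' u'' : Op 𝕜 P'.K Y'} (h : P.Induces P' f g u u')
    (h' : P.Induces P' f g u u'') : u' - u'' ∈ P'.restrictions := by
  obtain ⟨W, hW⟩ := h
  obtain ⟨W', hW'⟩ := h'
  obtain ⟨v, hv⟩ := exists_op_factor ((Op.fst : Op 𝕜 (P'.L × P.L) P'.L).comp (Op.incl (P.fiber P' f)))
    (fun z' => by
      obtain ⟨z, hz⟩ := P.surj (f (P'.ϖ z'))
      exact ⟨⟨(z', z), hz⟩, rfl⟩) (W - W') (by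
    rintro ⟨⟨z', z⟩, hz⟩ (rfl : z' = 0)
    have hk : P.ϖ z = 0 := by
      have hz1 : P.ϖ z = f (P'.ϖ 0) := hz
      rw [hz1, map_zero, map_zero]
    have h1 := hW 0 ⟨z, hk⟩ hz
    have h2 := hW' 0 ⟨z, hk⟩ hz
    rw [map_zero] at h1 h2
    exact sub_eq_zero.2 (h1.trans h2.symm))
  refine ⟨v, fun k' => ?_⟩
  have hm : ((k' : P'.L), ((0 : P.K) : P.L)) ∈ P.fiber P' f := by
    change P.ϖ 0 = f (P'.ϖ k')
    rw [map_zero, show P'.ϖ k' = 0 from k'.2, map_zero]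
  have h1 := hv ⟨_, hm⟩
  rw [Op.sub_apply, hW k' 0 hm, hW' k' 0 hm, sub_sub_sub_cancel_right] at h1
  exact h1.symm

/-- The graph of the action of `Ext^ϖ` is that of pull-back and push-out on extensions. -/
theorem map_toExt_eq_iff (P : Presentation 𝕜 X Y) (P' : Presentation 𝕜 X' Y') {f : Op 𝕜 X' X}
    {g : Op 𝕜 Y Y'} {u : Op 𝕜 P.K Y} {u' : Op 𝕜 P'.K Y'} :
    Ext.map f g (P.toExt u) = P'.toExt u' ↔ P.Induces P' f g u u' := by
  refine ⟨P.induces_of_map_eq P', fun h => ?_⟩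
  obtain ⟨u'', hu''⟩ := P'.toExt_surjective (Ext.map f g (P.toExt u))
  have h1 := (P.induces_of_map_eq P' hu''.symm).sub_mem h
  have h2 : P'.toExtOp (u'' - u') = 0 := (P'.toExt_eq_zero_iff _).2 h1
  rw [map_sub, sub_eq_zero] at h2
  exact hu''.symm.trans h2

/-- The action of `Ext^ϖ`, transported from the action on extensions. -/
noncomputable def mapPi (P : Presentation 𝕜 X Y) (P' : Presentation 𝕜 X' Y') (f : Op 𝕜 X' X)
    (g : Op 𝕜 Y Y') : Op 𝕜 P.ExtPi P'.ExtPi :=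
  P'.extToPi.comp ((Ext.mapOp f g).comp P.piToExt)

theorem piToExt_mapPi (P : Presentation 𝕜 X Y) (P' : Presentation 𝕜 X' Y') (f : Op 𝕜 X' X)
    (g : Op 𝕜 Y Y') (c : P.ExtPi) :
    P'.piToExt (P.mapPi P' f g c) = Ext.map f g (P.piToExt c) :=
  P'.piToExt_extToPi _

end Presentation

end action

/-! ### The functors and their equivalence -/

/-- The action of `Ext^ϖ` on morphisms, for any choice of presentations. -/
noncomputable def extPiAction {𝕜 : Type} [RCLike 𝕜]
    (pres : ∀ X Y : QBan.{u} 𝕜, Presentation 𝕜 X Y) : ExtPiAction pres where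
  map {X X' Y Y'} f g := (pres X Y).mapPi (pres X' Y') (toOp f) (toOp g)
  map_cls_iff {X X' Y Y'} f g u u' := by
    rw [← (pres X Y).map_toExt_eq_iff, ← (pres X' Y').piToExt_bijective.1.eq_iff,
      Presentation.piToExt_mapPi]
    rfl
  map_id X Y := Op.ext fun c => (pres X Y).piToExt_bijective.1
    (((pres X Y).piToExt_mapPi _ _ _ c).trans (Ext.map_id _))
  map_comp {X X' X'' Y Y' Y''} f g f' g' := Op.ext fun c => (pres X'' Y'').piToExt_bijective.1 (by
    rw [Op.comp_apply, Presentation.piToExt_mapPi, Presentation.piToExt_mapPi,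
      Presentation.piToExt_mapPi, Ext.map_comp]
    rfl)

section categories

variable {𝕜 : Type} [RCLike 𝕜]

/-- An operator with target in `Type u`, as an operator into the copy of the target in a larger
universe. -/
def Op.up {E : Type v} {F : Type u} [AddCommGroup E] [Module 𝕜 E] [Norm E] [AddCommGroup F]
    [Module 𝕜 F] [Norm F] (T : Op 𝕜 E F) : Op 𝕜 E (ULift.{w} F) :=
  ⟨ULift.moduleEquiv.symm.toLinearMap ∘ₗ T.1, T.2⟩

/-- An operator with source in `Type u`, as an operator on the copy of the source in a larger
universe. -/
def Op.down {E : Type u} {F : Type v} [AddCommGroup E] [Module 𝕜 E] [Norm E] [AddCommGroup F]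
    [Module 𝕜 F] [Norm F] (T : Op 𝕜 E F) : Op 𝕜 (ULift.{w} E) F :=
  ⟨T.1 ∘ₗ ULift.moduleEquiv.toLinearMap, T.2.imp fun _ h x => h x.down⟩

/-- Mutually inverse operators form an isomorphism. -/
def SQNSp.mkIso {E F : SQNSp.{v} 𝕜} (T : Op 𝕜 E F) (S : Op 𝕜 F E) (h : ∀ x, S (T x) = x)
    (h' : ∀ y, T (S y) = y) : E ≅ F where
  hom := SQNSp.Hom.mk T
  inv := SQNSp.Hom.mk S
  hom_inv_id := congrArg SQNSp.Hom.mk (Op.ext h)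
  inv_hom_id := congrArg SQNSp.Hom.mk (Op.ext h')

/-- A natural isomorphism of functors with values in a full subcategory. -/
def liftNatIso {C : Type*} [Category C] {F G : C ⥤ SQNSp.{v} 𝕜} (e : F ≅ G)
    (hF : ∀ A, isComplete 𝕜 (F.obj A)) (hG : ∀ A, isComplete 𝕜 (G.obj A)) :
    (isComplete 𝕜).lift F hF ≅ (isComplete 𝕜).lift G hG :=
  NatIso.ofComponents (fun A => (isComplete 𝕜).isoMk (e.app A)) fun f =>
    ObjectProperty.hom_ext _ (e.hom.naturality f)

section Q

variable {X Y : Type u} [AddCommGroup X] [Module 𝕜 X] [Norm X] [QuasiBanach 𝕜 X]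
    [AddCommGroup Y] [Module 𝕜 Y] [Norm Y] [QuasiBanach 𝕜 Y]

variable (𝕜 X Y) in
/-- The operator `Ext(X, Y) → 𝒬(X, Y)`. -/
noncomputable def extToQ : Op 𝕜 (Ext 𝕜 X Y) (QSpace 𝕜 X Y) :=
  ⟨(Ext.equivQ 𝕜 X Y).toLinearMap, 1, fun c => ((Ext.norm_toQ c).trans (one_mul _).symm).le⟩

variable (𝕜 X Y) in
/-- The operator `𝒬(X, Y) → Ext(X, Y)`. -/
noncomputable def qToExt : Op 𝕜 (QSpace 𝕜 X Y) (Ext 𝕜 X Y) :=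
  ⟨(Ext.equivQ 𝕜 X Y).symm.toLinearMap, 1, fun c => by
    rw [one_mul, ← Ext.norm_toQ]
    exact (congrArg norm ((Ext.equivQ 𝕜 X Y).apply_symm_apply c)).le⟩

theorem qToExt_extToQ (c : Ext 𝕜 X Y) : qToExt 𝕜 X Y (extToQ 𝕜 X Y c) = c :=
  (Ext.equivQ 𝕜 X Y).symm_apply_apply c

theorem extToQ_qToExt (c : QSpace 𝕜 X Y) : extToQ 𝕜 X Y (qToExt 𝕜 X Y c) = c :=
  (Ext.equivQ 𝕜 X Y).apply_symm_apply c

variable (𝕜 X Y) in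
/-- Completeness is clear for `Ext^ϖ(X, Y)`, as a quotient of a space of operators, and passes on to
`Ext(X, Y)`. -/
theorem ext_complete : IsCompleteQN (Ext 𝕜 X Y) := by
  obtain ⟨P⟩ := exists_presentation 𝕜 X Y
  exact P.extPi_complete.of_equiv P.piToExt P.extToPi P.piToExt_extToPi

end Q

variable (𝕜) in
/-- The natural isomorphism between `Ext` and `𝒬`. -/
noncomputable def extIsoQ : extFunctor.{u} 𝕜 ≅ qFunctor.{u} 𝕜 ⋙ uliftFunctor 𝕜 :=
  NatIso.ofComponents (fun A => SQNSp.mkIso (extToQ 𝕜 A.1.unop A.2).up (qToExt 𝕜 A.1.unop A.2).down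
    (fun c => qToExt_extToQ c) fun c => ULift.ext _ _ (extToQ_qToExt c.down)) fun φ =>
      congrArg SQNSp.Hom.mk (Op.ext fun c => ULift.ext _ _
        (Ext.toQ_map (toOp φ.1.unop) (toOp φ.2) c))

/-- The natural isomorphism between `Ext^ϖ` and `Ext`. -/
noncomputable def extPiIsoExt (pres : ∀ X Y : QBan.{u} 𝕜, Presentation 𝕜 X Y) :
    extPiFunctor (extPiAction pres) ⋙ uliftFunctor 𝕜 ≅ extFunctor.{u} 𝕜 :=
  NatIso.ofComponents (fun A => SQNSp.mkIso (pres A.1.unop A.2).piToExt.down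
    (pres A.1.unop A.2).extToPi.up (fun c => ULift.ext _ _ ((pres _ _).extToPi_piToExt c.down))
      fun c => (pres _ _).piToExt_extToPi c) fun φ =>
      congrArg SQNSp.Hom.mk (Op.ext fun c =>
        (pres _ _).piToExt_mapPi (pres _ _) (toOp φ.1.unop) (toOp φ.2) c.down)

end categories

end QuasiExt

theorem mainTheorem4 (𝕜 : Type) [RCLike 𝕜] :
    ∃ (hExt : ∀ A, isComplete 𝕜 ((extFunctor.{u} 𝕜).obj A))
      (hQ : ∀ A, isComplete 𝕜 ((qFunctor.{u} 𝕜 ⋙ uliftFunctor 𝕜).obj A)),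
      Nonempty ((isComplete 𝕜).lift (extFunctor.{u} 𝕜) hExt ≅
        (isComplete 𝕜).lift (qFunctor.{u} 𝕜 ⋙ uliftFunctor 𝕜) hQ) ∧
      (∀ X Y : QBan.{u} 𝕜, Nonempty (Presentation 𝕜 X Y)) ∧
      ∀ pres : ∀ X Y : QBan.{u} 𝕜, Presentation 𝕜 X Y, ∃ S : ExtPiAction pres,
        ∃ hPi : ∀ A, isComplete 𝕜 ((extPiFunctor S ⋙ uliftFunctor 𝕜).obj A),
          Nonempty ((isComplete 𝕜).lift (qFunctor.{u} 𝕜 ⋙ uliftFunctor 𝕜) hQ ≅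
            (isComplete 𝕜).lift (extPiFunctor S ⋙ uliftFunctor 𝕜) hPi) := by
  have transfer : ∀ {E F : SQNSp.{u + 1} 𝕜}, (E ≅ F) → isComplete 𝕜 E → isComplete 𝕜 F :=
    fun e h => IsCompleteQN.of_equiv (𝕜 := 𝕜) h e.hom.toOp e.inv.toOp fun y =>
      congrArg (fun T : SQNSp.Hom 𝕜 _ _ => T.toOp y) e.inv_hom_id
  have hExt : ∀ A, isComplete 𝕜 ((extFunctor.{u} 𝕜).obj A) := fun A =>
    ext_complete 𝕜 A.1.unop A.2
  have hQ : ∀ A, isComplete 𝕜 ((qFunctor.{u} 𝕜 ⋙ uliftFunctor 𝕜).obj A) := fun A =>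
    transfer ((extIsoQ 𝕜).app A) (hExt A)
  refine ⟨hExt, hQ, ⟨liftNatIso (extIsoQ 𝕜) hExt hQ⟩, fun X Y => exists_presentation 𝕜 X Y,
    fun pres => ⟨extPiAction pres, fun A => transfer ((extPiIsoExt pres).symm.app A) (hExt A),
      ⟨liftNatIso ((extIsoQ 𝕜).symm ≪≫ (extPiIsoExt pres).symm) _ _⟩⟩⟩
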